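/- Let $n\ge 2$ and $p_0(z)=z^n-1$. For a polynomial $p$ let $L_p=\{z\in\mathbb C:\ |p(z)|=1\}$, and let $|L_p|$ denote its length (one-dimensional Hausdorff measure). (1) The length $|L_{p_0}|$ is finite, and there is $\delta>0$, depending only on $n$, such that $|L_p|\le |L_{p_0}|$ for every monic polynomial $p$ of degree $n$ each of whose coefficients differs from the corresponding coefficient of $p_0$ by less than $\delta$ in absolute value. Thus $p_0$ is a local maximizer of the lemniscate length. (2) There are constants $c,C,\varepsilon>0$, depending only on $n$, with the following property. Let $$p(z)=z^n-1+\sum_{k=2}^n a_k z^{n-k},\qquad a_2,\dots,a_n\in\mathbb C,\quad a_n\in\mathbb R,\qquad a:=\max_{2\le k\le n}|a_k|^{1/k}<\varepsilon .$$ (Every monic polynomial of degree $n$ can be brought to the form $z^n-1+\sum_{k=2}^n a_kz^{n-k}$ with $a_n\in\mathbb R$ by a shift and a rotation of the variable, followed by multiplication by a unimodular constant, none of which changes $|L_p|$.) Then $|L_p|<\infty$, and for every $r\in(4a,\tfrac14)$ $$|L_p|\le |L_{p_0}|-c\,a+C\Bigl(r^2+\frac{a^2}{r}\Bigr).$$ If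 $a>0$, then $r=a^{2/3}$ lies in $(4a,\tfrac14)$; and in all cases $$|L_p|\le |L_{p_0}|-c\,a+2C\,a^{4/3}\le |L_{p_0}|.$$ -/

import Mathlib

open scoped NNReal ENNReal

noncomputable section

/-- The lemniscate `{z : |p(z)| = 1}` of a complex polynomial. -/
def lemniscate (p : Polynomial ℂ) : Set ℂ := {z | ‖p.eval z‖ = 1}

/-- The length of the lemniscate: its one-dimensional Hausdorff measure in the plane. -/
def lemniscateLength (p : Polynomial ℂ) : ℝ≥0∞ :=
  MeasureTheory.Measure.hausdorffMeasure 1 (lemniscate p)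

/-- The polynomial `p₀(z) = z ^ n - 1`. -/
def extremalPoly (n : ℕ) : Polynomial ℂ := Polynomial.X ^ n - 1

/-- The normalized perturbation `p₀(z) + ∑_{k=2}^n a_k z^(n-k)`. Values `a k` with `k < 2` or
`k > n` play no role. -/
def perturbedPoly (n : ℕ) (a : ℕ → ℂ) : Polynomial ℂ :=
  extremalPoly n + ∑ k ∈ Finset.Icc 2 n, Polynomial.C (a k) * Polynomial.X ^ (n - k)

/-- `max_{2 ≤ k ≤ n} |a_k|^(1/k)`, a maximum of nonnegative numbers. -/
def coeffSize (n : ℕ) (a : ℕ → ℂ) : ℝ :=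
  (((Finset.Icc 2 n).sup fun k => ‖a k‖₊ ^ (1 / (k : ℝ)) : ℝ≥0) : ℝ)

end

/-! Write `p = q - 1` with `q = z ^ n + ∑ a_k z ^ (n - k)`, let `A` be the size of the coefficients,
and cut the plane along a circle of radius `r` about the origin. The scales are `A = b ^ 3` and `r =
b ^ 2`, so that all errors below are `O(b ^ 4)` while the gain is of order `b ^ 3`.

Outside the disc, `q` has the `n`-th root `Φ z = z (1 + ∑ a_k z ^ (-k)) ^ (1 / n)`, which maps `L_p`
into `L_{p₀}`. Since there is no term `k = 1`, `Φ z - z` is `O(A ^ 2 / |z|)` and has Lipschitz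
constant `O(A ^ 2 / ρ ^ 2)` on `|z| ≥ ρ`. The length of `L_p` in a disc of radius `ρ` is `O(ρ)`, so
summation over dyadic annuli loses only `O(A ^ 2 / r)` (`hausdorffMeasure_lemniscate_outer_le`).

Inside, `L_{p₀}` contains `2 n` arcs from the origin and has length at least `2 n ρ` in the disc of
radius `ρ`. The length of `L_p` is estimated by Crofton's inequality. On a line, points of `L_p` are
zeros of `Re (-log (1 - q))`, a perturbation of `Re z ^ n`. The Budan–Fourier theorem bounds their
number by sign changes of successive derivatives at the ends of the chord. Away from a small set of
lines these signs are those for `Re z ^ n`, and the average of the resulting bound is exactly that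
of `n` diameters, giving the length `2 n r`.

The gain comes from lines at distance at most `σ A` from the origin, where this bound is `n` but the
true count is smaller. Let `k` be the first index for which `|a_k|` is comparable to `A ^ k`.
Differentiating `n - k` times kills all later coefficients and leaves approximately `D c t ^ k + d`,
with `c = cos (n φ)` and `d` proportional to `Re (exp (i (n - k) φ) a_k)`. By Rolle, `n` zeros would
leave `k` zeros here. For `k ≥ 3` there are at most two once `d ≠ 0`; for `k = 2` there are none if
`c d > 0`. Averages of trigonometric products show that such directions `φ` have measure bounded
below; for `k = n` this uses that `a_n` is real. This saves a multiple of `σ A` in length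
(`exists_hasGain`, `hausdorffMeasure_lemniscate_inner_le`).

Altogether the length is at most `|L_{p₀}| - c b ^ 3 + C b ^ 4`. The estimate for general `r`
follows from `A ^ (4 / 3) ≤ r ^ 2 + A ^ 2 / r`, and local maximality follows after normalizing by a
shift and a rotation, both continuous enough to keep the coefficients small. -/

open MeasureTheory Set Filter Topology

/-! ### Crofton's inequality for locally nearly straight sets -/

/-- A map that expands distances by at least `c` multiplies lengths by at least `c`. -/
theorem mul_hausdorffMeasure_le_image {X Y : Type*} [MetricSpace X] [MeasurableSpace X]
    [BorelSpace X] [MetricSpace Y] [MeasurableSpace Y] [BorelSpace Y] (f : X → Y) (B : Set X)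
    {c : ℝ} (hc : 0 < c) (h : ∀ x ∈ B, ∀ y ∈ B, c * dist x y ≤ dist (f x) (f y)) :
    ENNReal.ofReal c * Measure.hausdorffMeasure 1 B ≤ Measure.hausdorffMeasure 1 (f '' B) := by
  rcases B.eq_empty_or_nonempty with rfl | ⟨x₀, hx₀⟩
  · simp
  have : Nonempty X := ⟨x₀⟩
  have hinj : InjOn f B := by
    intro x hx y hy hxy
    have := h x hx y hy
    rw [hxy, dist_self] at this
    exact dist_le_zero.1 (by by_contra! hcon; nlinarith [mul_pos hc hcon])
  have hlip : LipschitzOnWith (Real.toNNReal c⁻¹) (Function.invFunOn f B) (f '' B) := by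
    refine LipschitzOnWith.of_dist_le_mul ?_
    rintro _ ⟨x, hx, rfl⟩ _ ⟨y, hy, rfl⟩
    rw [hinj.leftInvOn_invFunOn hx, hinj.leftInvOn_invFunOn hy,
      Real.coe_toNNReal _ (inv_nonneg.2 hc.le)]
    rw [inv_mul_eq_div, le_div_iff₀ hc, mul_comm]
    exact h x hx y hy
  have := hlip.hausdorffMeasure_image_le (d := 1) zero_le_one
  rw [hinj.leftInvOn_invFunOn.image_image, ENNReal.rpow_one] at this
  calc ENNReal.ofReal c * Measure.hausdorffMeasure 1 B
      ≤ ENNReal.ofReal c * (ENNReal.ofReal c⁻¹ * Measure.hausdorffMeasure 1 (f '' B)) := by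
        gcongr; exact this
    _ = Measure.hausdorffMeasure 1 (f '' B) := by
        rw [← mul_assoc, ← ENNReal.ofReal_mul hc.le, mul_inv_cancel₀ hc.ne', ENNReal.ofReal_one,
          one_mul]

theorem integral_abs_sin_sub (α : ℝ) : ∫ x in (0 : ℝ)..Real.pi, |Real.sin (α - x)| = 2 := by
  have hper : Function.Periodic (fun x => |Real.sin x|) Real.pi := by
    intro x; simp [Real.sin_add_pi]
  rw [intervalIntegral.integral_comp_sub_left (fun x => |Real.sin x|)]
  have := hper.intervalIntegral_add_eq (α - Real.pi) 0
  rw [sub_zero]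
  rw [sub_add_cancel, zero_add] at this
  rw [this]
  have h2 : ∫ x in (0 : ℝ)..Real.pi, |Real.sin x| = ∫ x in (0 : ℝ)..Real.pi, Real.sin x := by
    apply intervalIntegral.integral_congr
    intro x hx
    rw [uIcc_of_le Real.pi_pos.le] at hx
    exact abs_of_nonneg (Real.sin_nonneg_of_nonneg_of_le_pi hx.1 hx.2)
  rw [h2, integral_sin]; norm_num

/-- `ENNReal.ofReal` cuts off the negative part of the integrand, which can only help a lower bound.
-/
theorem le_lintegral_abs_sin_sub (α ε : ℝ) :
    ENNReal.ofReal (2 - 2 * Real.pi * ε) ≤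
      ∫⁻ φ in Ioc 0 Real.pi, ENNReal.ofReal (|Real.sin (α - φ)| - 2 * ε) := by
  have hi : IntervalIntegrable (fun φ => |Real.sin (α - φ)| - 2 * ε) volume 0 Real.pi :=
    (by fun_prop : Continuous fun φ => |Real.sin (α - φ)| - 2 * ε).intervalIntegrable _ _
  have hi' : IntervalIntegrable (fun φ => max (|Real.sin (α - φ)| - 2 * ε) 0) volume 0 Real.pi :=
    (by fun_prop : Continuous fun φ => max (|Real.sin (α - φ)| - 2 * ε) 0).intervalIntegrable _ _
  have h1 : ∫ φ in (0 : ℝ)..Real.pi, (|Real.sin (α - φ)| - 2 * ε) = 2 - 2 * Real.pi * ε := by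
    rw [intervalIntegral.integral_sub _ _, integral_abs_sin_sub]
    · simp; ring
    · exact (by fun_prop : Continuous fun φ => |Real.sin (α - φ)|).intervalIntegrable _ _
    · simp
  have h2 : 2 - 2 * Real.pi * ε ≤ ∫ φ in Ioc 0 Real.pi, max (|Real.sin (α - φ)| - 2 * ε) 0 := by
    rw [← h1, ← intervalIntegral.integral_of_le Real.pi_pos.le]
    exact intervalIntegral.integral_mono_on Real.pi_pos.le hi hi' fun x _ => le_max_left _ _
  refine (ENNReal.ofReal_le_ofReal h2).trans ?_
  rw [ofReal_integral_eq_lintegral_ofReal]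
  · refine lintegral_mono fun φ => ?_
    rw [ENNReal.ofReal_max, ENNReal.ofReal_zero, max_eq_left zero_le]
  · exact hi'.1
  · exact ae_of_all _ fun x => le_max_right _ _

/-- Distances along a nearly straight set are almost preserved by the projection onto the
direction orthogonal to `exp (iφ)`, up to the factor `|sin (α - φ)|`. -/
theorem mul_norm_le_abs_im_of_flat {α φ ε : ℝ} {w : ℂ}
    (h : |(Complex.exp (-(α * Complex.I)) * w).im| ≤ ε * ‖w‖) :
    (|Real.sin (α - φ)| - 2 * ε) * ‖w‖ ≤ |(Complex.exp (-(φ * Complex.I)) * w).im| := by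
  set v := Complex.exp (-(α * Complex.I)) * w with hv
  have hvn : ‖v‖ = ‖w‖ := by
    rw [hv, norm_mul, ← neg_mul, ← Complex.ofReal_neg, Complex.norm_exp_ofReal_mul_I, one_mul]
  have h1 : Complex.exp (-(φ * Complex.I)) * w =
      Complex.exp (((α - φ : ℝ) : ℂ) * Complex.I) * v := by
    rw [hv, ← mul_assoc, ← Complex.exp_add]; congr 2; push_cast; ring
  have h2 : (Complex.exp (-(φ * Complex.I)) * w).im =
      Real.cos (α - φ) * v.im + Real.sin (α - φ) * v.re := by
    rw [h1, Complex.mul_im, Complex.exp_ofReal_mul_I_re, Complex.exp_ofReal_mul_I_im]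
  have h3 : ‖v‖ ≤ |v.re| + |v.im| := Complex.norm_le_abs_re_add_abs_im v
  have h4 : |Real.sin (α - φ)| * |v.re| ≤
      |(Complex.exp (-(φ * Complex.I)) * w).im| + |v.im| := by
    rw [h2, ← abs_mul]
    have : |Real.sin (α - φ) * v.re| ≤ |Real.cos (α - φ) * v.im + Real.sin (α - φ) * v.re|
        + |Real.cos (α - φ) * v.im| := by
      have := abs_sub (Real.cos (α - φ) * v.im + Real.sin (α - φ) * v.re) (Real.cos (α - φ) * v.im)
      simpa using this
    refine this.trans (add_le_add le_rfl ?_)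
    rw [abs_mul]
    exact mul_le_of_le_one_left (abs_nonneg _) (Real.abs_cos_le_one _)
  have h5 : |Real.sin (α - φ)| ≤ 1 := Real.abs_sin_le_one _
  have h6 : 0 ≤ |Real.sin (α - φ)| := abs_nonneg _
  rw [hvn] at h3
  nlinarith [norm_nonneg w, abs_nonneg v.im, abs_nonneg v.re]

/-- Upper Crofton inequality for sets that are locally nearly straight. -/
theorem two_mul_hausdorffMeasure_le_lintegral {A : Set ℂ} (hA : MeasurableSet A)
    (hflat : ∀ z ∈ A, ∀ ε : ℝ, 0 < ε → ∃ α : ℝ, ∃ U ∈ 𝓝 z, ∀ x ∈ A ∩ U, ∀ y ∈ A ∩ U,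
      |(Complex.exp (-(α * Complex.I)) * (x - y)).im| ≤ ε * ‖x - y‖)
    (K : ℝ → ℝ → ℝ≥0∞)
    (hK : ∀ φ s : ℝ, ∀ T : Finset ℂ, (∀ z ∈ T, z ∈ A ∧
      (Complex.exp (-(φ * Complex.I)) * z).im = s) → (T.card : ℝ≥0∞) ≤ K φ s) :
    2 * Measure.hausdorffMeasure 1 A ≤ ∫⁻ φ in Ioc 0 Real.pi, ∫⁻ s, K φ s := by
  rcases A.eq_empty_or_nonempty with rfl | hne
  · simp
  -- A fixed flatness tolerance costs `2 π ε` in the constant `2`; the limit `ε → 0` comes at the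
  -- end.
  have key : ∀ ε : ℝ, 0 < ε → ENNReal.ofReal (2 - 2 * Real.pi * ε) *
      Measure.hausdorffMeasure 1 A ≤ ∫⁻ φ in Ioc 0 Real.pi, ∫⁻ s, K φ s := by
    intro ε hε
    choose! α U hU hflat using fun z hz => hflat z hz ε hε
    obtain ⟨t, htA, htc, htU⟩ := TopologicalSpace.countable_cover_nhdsWithin
      (f := fun z => interior (U z)) (s := A)
      fun z hz => mem_nhdsWithin_of_mem_nhds (interior_mem_nhds.2 (hU z hz))
    have htne : t.Nonempty := by
      obtain ⟨z, hz⟩ := hne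
      obtain ⟨x, hx, -⟩ := mem_iUnion₂.1 (htU hz)
      exact ⟨x, hx⟩
    obtain ⟨c, rfl⟩ := htc.exists_eq_range htne
    have hcA : ∀ i, c i ∈ A := fun i => htA ⟨i, rfl⟩
    -- Countably many disjoint pieces covering `A`, each nearly straight in a direction of its own.
    set B : ℕ → Set ℂ := fun i => A ∩ disjointed (fun i => interior (U (c i))) i with hB
    have hBm : ∀ i, MeasurableSet (B i) := fun i =>
      hA.inter (MeasurableSet.disjointed (fun i => isOpen_interior.measurableSet) i)
    have hBU : ∀ i, B i ⊆ A ∩ U (c i) := fun i =>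
      inter_subset_inter_right _ ((disjointed_subset _ i).trans interior_subset)
    have hBd : Pairwise (Function.onFun Disjoint B) := fun i j hij =>
      (disjoint_disjointed _ hij).mono inter_subset_right inter_subset_right
    have hBA : ⋃ i, B i = A := by
      rw [hB, ← inter_iUnion, iUnion_disjointed]
      refine inter_eq_left.2 fun z hz => ?_
      simpa using htU hz
    set π : ℝ → ℂ → ℝ := fun φ z => (Complex.exp (-(φ * Complex.I)) * z).im with hπ
    -- If the expansion factor is positive, the projection is injective on the piece and the image
    -- is measurable. Otherwise measurability may fail and the bound is trivial, hence the
    -- measurable hull.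
    have hexp : ∀ φ i, ENNReal.ofReal (|Real.sin (α (c i) - φ)| - 2 * ε) *
        Measure.hausdorffMeasure 1 (B i) ≤ ∫⁻ s, (toMeasurable volume (π φ '' B i)).indicator 1 s ∧
        (0 < |Real.sin (α (c i) - φ)| - 2 * ε → MeasurableSet (π φ '' B i)) := by
      intro φ i
      have hd : ∀ x ∈ B i, ∀ y ∈ B i, (|Real.sin (α (c i) - φ)| - 2 * ε) * dist x y ≤
          dist (π φ x) (π φ y) := by
        intro x hx y hy
        rw [dist_eq_norm, Real.dist_eq]
        have := mul_norm_le_abs_im_of_flat (φ := φ)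
          (hflat (c i) (hcA i) x (hBU i hx) y (hBU i hy))
        rwa [mul_sub, Complex.sub_im] at this
      rw [lintegral_indicator_one (measurableSet_toMeasurable _ _), measure_toMeasurable]
      constructor
      · rcases le_or_gt (|Real.sin (α (c i) - φ)| - 2 * ε) 0 with h0 | h0
        · rw [ENNReal.ofReal_of_nonpos h0, zero_mul]; exact zero_le
        · rw [← hausdorffMeasure_real]
          exact mul_hausdorffMeasure_le_image _ _ h0 hd
      · intro h0
        refine (hBm i).image_of_continuousOn_injOn ?_ ?_
        · exact (by fun_prop : Continuous (π φ)).continuousOn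
        · intro x hx y hy hxy
          have := hd x hx y hy
          rw [hxy, dist_self] at this
          exact dist_le_zero.1 (by by_contra! hcon; nlinarith [mul_pos h0 hcon])
    have hfix : ∀ φ, ∑' i, ENNReal.ofReal (|Real.sin (α (c i) - φ)| - 2 * ε) *
        Measure.hausdorffMeasure 1 (B i) ≤ ∫⁻ s, K φ s := by
      intro φ
      classical
      rw [ENNReal.tsum_eq_iSup_sum]
      refine iSup_le fun F => ?_
      set F' := F.filter fun i => 0 < |Real.sin (α (c i) - φ)| - 2 * ε with hF'
      calc ∑ i ∈ F, ENNReal.ofReal (|Real.sin (α (c i) - φ)| - 2 * ε) *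
            Measure.hausdorffMeasure 1 (B i)
          = ∑ i ∈ F', ENNReal.ofReal (|Real.sin (α (c i) - φ)| - 2 * ε) *
            Measure.hausdorffMeasure 1 (B i) := by
            symm
            refine Finset.sum_subset (Finset.filter_subset _ _) fun i hi hi' => ?_
            have : ¬ 0 < |Real.sin (α (c i) - φ)| - 2 * ε := fun h =>
              hi' (Finset.mem_filter.2 ⟨hi, h⟩)
            rw [ENNReal.ofReal_of_nonpos (not_lt.1 this), zero_mul]
        _ ≤ ∑ i ∈ F', ∫⁻ s, (π φ '' B i).indicator 1 s := by
            refine Finset.sum_le_sum fun i hi => ?_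
            have h0 := (hexp φ i).2 (Finset.mem_filter.1 hi).2
            refine (hexp φ i).1.trans (le_of_eq ?_)
            rw [lintegral_indicator_one (measurableSet_toMeasurable _ _), measure_toMeasurable,
              lintegral_indicator_one h0]
        _ = ∫⁻ s, ∑ i ∈ F', (π φ '' B i).indicator 1 s := by
            rw [lintegral_finsetSum']
            intro i hi
            exact (measurable_one.indicator ((hexp φ i).2 (Finset.mem_filter.1 hi).2)).aemeasurable
        _ ≤ ∫⁻ s, K φ s := by
            refine lintegral_mono fun s => ?_
            set F'' := F'.filter fun i => s ∈ π φ '' B i with hF''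
            have h1 : ∑ i ∈ F', (π φ '' B i).indicator (1 : ℝ → ℝ≥0∞) s = (F''.card : ℝ≥0∞) := by
              simp only [indicator_apply, Pi.one_apply, Finset.sum_ite, Finset.sum_const_zero,
                add_zero, Finset.sum_const, nsmul_eq_mul, mul_one, hF'']
            change ∑ i ∈ F', (π φ '' B i).indicator (1 : ℝ → ℝ≥0∞) s ≤ K φ s
            rw [h1]
            -- Pieces whose projections contain `s` supply distinct points on the line, because the
            -- pieces are disjoint; the sum of indicators is thus a number of intersection points.
            have hch : ∀ i ∈ F'', ∃ z, z ∈ B i ∧ π φ z = s := fun i hi =>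
              (Finset.mem_filter.1 hi).2
            choose! z hzB hzs using hch
            have hinj : InjOn z F'' := by
              intro i hi j hj hij
              by_contra hne
              exact (hBd hne).le_bot ⟨hzB i hi, hij ▸ hzB j hj⟩
            rw [← Finset.card_image_of_injOn hinj]
            refine hK φ s _ fun w hw => ?_
            obtain ⟨i, hi, rfl⟩ := Finset.mem_image.1 hw
            exact ⟨(hBU i (hzB i hi)).1, hzs i hi⟩
    calc ENNReal.ofReal (2 - 2 * Real.pi * ε) * Measure.hausdorffMeasure 1 A
        = ∑' i, ENNReal.ofReal (2 - 2 * Real.pi * ε) * Measure.hausdorffMeasure 1 (B i) := by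
          rw [ENNReal.tsum_mul_left, ← measure_iUnion hBd hBm, hBA]
      _ ≤ ∑' i, ∫⁻ φ in Ioc 0 Real.pi, ENNReal.ofReal (|Real.sin (α (c i) - φ)| - 2 * ε) *
            Measure.hausdorffMeasure 1 (B i) := by
          refine ENNReal.tsum_le_tsum fun i => ?_
          rw [lintegral_mul_const _ (by fun_prop)]
          gcongr
          exact le_lintegral_abs_sin_sub _ _
      _ = ∫⁻ φ in Ioc 0 Real.pi, ∑' i, ENNReal.ofReal (|Real.sin (α (c i) - φ)| - 2 * ε) *
            Measure.hausdorffMeasure 1 (B i) := by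
          rw [lintegral_tsum]
          intro i; fun_prop
      _ ≤ _ := lintegral_mono fun φ => hfix φ
  have hlim : Tendsto (fun ε : ℝ => ENNReal.ofReal (2 - 2 * Real.pi * ε) *
      Measure.hausdorffMeasure 1 A) (𝓝[>] 0) (𝓝 (2 * Measure.hausdorffMeasure 1 A)) := by
    refine ENNReal.Tendsto.mul_const ?_ (Or.inl (by norm_num))
    have : Tendsto (fun ε : ℝ => 2 - 2 * Real.pi * ε) (𝓝[>] 0) (𝓝 2) := by
      have h : Continuous fun ε : ℝ => 2 - 2 * Real.pi * ε := by fun_prop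
      simpa using (h.tendsto 0).mono_left nhdsWithin_le_nhds
    simpa using ENNReal.tendsto_ofReal this
  exact le_of_tendsto hlim (eventually_mem_nhdsWithin.mono fun ε hε => key ε hε)

/-! ### Lemniscates: Crofton's inequality and a priori length bounds -/

/-- Near a regular point the lemniscate is nearly straight. -/
theorem lemniscate_flat (p : Polynomial ℂ) {z : ℂ} (hz : z ∈ lemniscate p)
    (hd : p.derivative.eval z ≠ 0) {ε : ℝ} (hε : 0 < ε) :
    ∃ α : ℝ, ∃ U ∈ 𝓝 z, ∀ x ∈ lemniscate p ∩ U, ∀ y ∈ lemniscate p ∩ U,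
      |(Complex.exp (-(α * Complex.I)) * (x - y)).im| ≤ ε * ‖x - y‖ := by
  set w := p.eval z with hw
  set d := p.derivative.eval z with hdd
  have hw1 : ‖w‖ = 1 := hz
  set g : ℂ := starRingEnd ℂ w * d with hg
  have hgn : ‖g‖ = ‖d‖ := by rw [hg, norm_mul, RCLike.norm_conj, hw1, one_mul]
  have hd0 : 0 < ‖d‖ := norm_pos_iff.2 hd
  -- Chosen so that the errors `η (‖d‖ + η)`, from replacing `P + Q` by `2 w`, and `η`, from
  -- linearization, add up to at most `ε ‖d‖`.
  set η : ℝ := min ‖d‖ (ε * ‖d‖ / (‖d‖ + ‖d‖ + 1)) with hη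
  have hη0 : 0 < η := lt_min hd0 (by positivity)
  have hηd : η ≤ ‖d‖ := min_le_left _ _
  have hηε : η * (‖d‖ + ‖d‖ + 1) ≤ ε * ‖d‖ :=
    (le_div_iff₀ (by positivity)).1 (min_le_right _ _)
  have hs : HasStrictDerivAt (fun z => p.eval z) d z := p.hasStrictDerivAt z
  have h1 : ∀ᶠ q : ℂ × ℂ in 𝓝 (z, z), ‖p.eval q.1 - p.eval q.2 - (q.1 - q.2) * d‖ ≤
      η * ‖q.1 - q.2‖ := by
    have := (hasStrictFDerivAt_iff_isLittleO.1 hs.hasStrictFDerivAt).bound hη0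
    filter_upwards [this] with q hq
    simpa using hq
  rw [nhds_prod_eq] at h1
  obtain ⟨U, hU, hUp⟩ := (Filter.eventually_prod_self_iff (r := fun x y =>
    ‖p.eval x - p.eval y - (x - y) * d‖ ≤ η * ‖x - y‖)).1 h1
  have hc : ∀ᶠ x in 𝓝 z, ‖p.eval x - w‖ < η :=
    (Metric.continuousAt_iff'.1 p.continuous.continuousAt η hη0).mono fun x hx => by
      rwa [dist_eq_norm] at hx
  -- Along the tangent, `conj w * d * (x - y)` is purely imaginary, so the tangent has argument `π /
  -- 2 - arg g`.
  refine ⟨Real.pi / 2 - g.arg, U ∩ {x | ‖p.eval x - w‖ < η}, Filter.inter_mem hU hc, ?_⟩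
  rintro x ⟨hx, hxU, hxw⟩ y ⟨hy, hyU, hyw⟩
  have hx1 : ‖p.eval x‖ = 1 := hx
  have hy1 : ‖p.eval y‖ = 1 := hy
  have hxw' : ‖p.eval x - w‖ < η := hxw
  have hyw' : ‖p.eval y - w‖ < η := hyw
  have hxy := hUp x hxU y hyU
  set P := p.eval x
  set Q := p.eval y
  have hPQ : ‖P - Q‖ ≤ (‖d‖ + η) * ‖x - y‖ := by
    have : P - Q = (P - Q - (x - y) * d) + (x - y) * d := by ring
    rw [this]
    refine (norm_add_le _ _).trans ?_
    rw [norm_mul]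
    linarith
  -- Two points of the unit circle: the chord `P - Q` is orthogonal to `P + Q`, which is close to `2
  -- w`.
  have hre : ((P - Q) * starRingEnd ℂ (P + Q)).re = 0 := by
    have h : ((P - Q) * starRingEnd ℂ (P + Q)).re = Complex.normSq P - Complex.normSq Q := by
      simp [Complex.normSq_apply]; ring
    rw [h, Complex.normSq_eq_norm_sq, Complex.normSq_eq_norm_sq, hx1, hy1, sub_self]
  have hre2 : |((P - Q) * starRingEnd ℂ w).re| ≤ η * ‖P - Q‖ := by
    have h : ((P - Q) * starRingEnd ℂ w).re =
        ((P - Q) * starRingEnd ℂ ((w - P) / 2 + (w - Q) / 2)).re := by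
      have : (P - Q) * starRingEnd ℂ w = (P - Q) * starRingEnd ℂ ((w - P) / 2 + (w - Q) / 2) +
        (1 / 2 : ℝ) * ((P - Q) * starRingEnd ℂ (P + Q)) := by
        simp only [map_add, map_sub, map_div₀, map_ofNat]; push_cast; ring
      rw [this, Complex.add_re, Complex.re_ofReal_mul, hre]; simp
    rw [h]
    refine (Complex.abs_re_le_norm _).trans ?_
    rw [norm_mul, RCLike.norm_conj, mul_comm]
    refine mul_le_mul_of_nonneg_right ?_ (norm_nonneg _)
    refine (norm_add_le _ _).trans ?_
    rw [norm_div, norm_div, norm_sub_rev w P, norm_sub_rev w Q]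
    simp only [Complex.norm_ofNat]
    linarith
  have hre3 : |(g * (x - y)).re| ≤ ε * ‖d‖ * ‖x - y‖ := by
    have h : g * (x - y) = (P - Q) * starRingEnd ℂ w -
        (P - Q - (x - y) * d) * starRingEnd ℂ w := by rw [hg]; ring
    rw [h, Complex.sub_re]
    refine (abs_sub _ _).trans ?_
    have h2 : |((P - Q - (x - y) * d) * starRingEnd ℂ w).re| ≤ η * ‖x - y‖ := by
      refine (Complex.abs_re_le_norm _).trans ?_
      rw [norm_mul, RCLike.norm_conj, hw1, mul_one]; exact hxy
    have h3 : η * ‖P - Q‖ ≤ η * ((‖d‖ + ‖d‖) * ‖x - y‖) := by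
      gcongr; exact hPQ.trans (by gcongr)
    calc _ ≤ η * (‖d‖ + ‖d‖ + 1) * ‖x - y‖ := by linarith
      _ ≤ _ := by gcongr
  have hgexp : Complex.exp (-((Real.pi / 2 - g.arg : ℝ) * Complex.I)) * (x - y) =
      ((‖d‖⁻¹ : ℝ) : ℂ) * (-Complex.I * (g * (x - y))) := by
    have h := Complex.norm_mul_exp_arg_mul_I g
    rw [hgn] at h
    have h' : Complex.exp (-((Real.pi / 2 - g.arg : ℝ) * Complex.I)) =
        -Complex.I * Complex.exp (g.arg * Complex.I) := by
      rw [← Complex.exp_neg_pi_div_two_mul_I, ← Complex.exp_add]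
      congr 1; push_cast; ring
    rw [h']
    nth_rewrite 2 [← h]
    have : (‖d‖ : ℂ) ≠ 0 := by exact_mod_cast hd0.ne'
    push_cast
    field_simp
  rw [hgexp, Complex.im_ofReal_mul, abs_mul, abs_of_pos (inv_pos.2 hd0)]
  have : (-Complex.I * (g * (x - y))).im = -(g * (x - y)).re := by simp
  rw [this, abs_neg, inv_mul_le_iff₀ hd0]
  linarith

theorem measurableSet_lemniscate (p : Polynomial ℂ) : MeasurableSet (lemniscate p) :=
  (isClosed_eq (p.continuous.norm) continuous_const).measurableSet

/-- Crofton's inequality for the part of a lemniscate in a measurable set. -/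
theorem two_mul_hausdorffMeasure_lemniscate_inter_le {p : Polynomial ℂ} (hp : p.derivative ≠ 0)
    {D : Set ℂ} (hD : MeasurableSet D) (K : ℝ → ℝ → ℝ≥0∞)
    (hK : ∀ φ s : ℝ, ∀ T : Finset ℂ, (∀ z ∈ T, z ∈ lemniscate p ∩ D ∧
      (Complex.exp (-(φ * Complex.I)) * z).im = s) → (T.card : ℝ≥0∞) ≤ K φ s) :
    2 * Measure.hausdorffMeasure 1 (lemniscate p ∩ D) ≤
      ∫⁻ φ in Ioc 0 Real.pi, ∫⁻ s, K φ s := by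
  classical
  set Z : Set ℂ := ↑p.derivative.roots.toFinset with hZ
  -- The critical points, where flatness may fail, form a finite set and carry no length.
  have hZ0 : Measure.hausdorffMeasure 1 Z = 0 := by
    have := Measure.nullSingletonClass_hausdorff ℂ (d := 1) zero_lt_one
    exact (Finset.finite_toSet _).measure_zero _
  have hZm : MeasurableSet Z := (Finset.finite_toSet _).measurableSet
  have hle : Measure.hausdorffMeasure 1 (lemniscate p ∩ D) ≤
      Measure.hausdorffMeasure 1 ((lemniscate p ∩ D) \ Z) := by
    rw [measure_sdiff_null hZ0]
  refine (mul_le_mul_right hle 2).trans ?_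
  refine two_mul_hausdorffMeasure_le_lintegral
    (((measurableSet_lemniscate p).inter hD).diff hZm) ?_ K ?_
  · rintro z ⟨⟨hz, -⟩, hzZ⟩ ε hε
    have hd : p.derivative.eval z ≠ 0 := by
      intro h
      exact hzZ (by simp [hZ, hp, h])
    obtain ⟨α, U, hU, h⟩ := lemniscate_flat p hz hd hε
    exact ⟨α, U, hU, fun x hx y hy => h x ⟨hx.1.1.1, hx.2⟩ y ⟨hy.1.1.1, hy.2⟩⟩
  · intro φ s T hT
    exact hK φ s T fun z hz => ⟨(hT z hz).1.1, (hT z hz).2⟩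

/-- A line meets the lemniscate of a polynomial of degree `n ≥ 1` in at most `2 n` points. -/
theorem card_lemniscate_line_le {p : Polynomial ℂ} (hp : 0 < p.natDegree) (φ s : ℝ)
    (T : Finset ℂ) (hT : ∀ z ∈ T, z ∈ lemniscate p ∧
      (Complex.exp (-(φ * Complex.I)) * z).im = s) : T.card ≤ 2 * p.natDegree := by
  classical
  set e := Complex.exp (-(φ * Complex.I)) with he
  have he0 : e ≠ 0 := Complex.exp_ne_zero _
  have hee : e * starRingEnd ℂ e = 1 := by
    rw [he, ← Complex.exp_conj, ← Complex.exp_add]; simp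
  -- On the line, `conj z` is the affine function `m` of `z`. Hence `|p z| ^ 2 = 1` becomes the
  -- vanishing of the polynomial `W` of degree `2 n`.
  set m : Polynomial ℂ := Polynomial.C (e * e) * Polynomial.X +
    Polynomial.C (-(2 * s * Complex.I * e)) with hm
  have hmd : m.natDegree = 1 := Polynomial.natDegree_linear (mul_ne_zero he0 he0)
  set W := p * (p.map (starRingEnd ℂ)).comp m - Polynomial.C 1 with hW
  have hp0 : p ≠ 0 := by rintro rfl; simp at hp
  have hc : ((p.map (starRingEnd ℂ)).comp m).natDegree = p.natDegree := by
    rw [Polynomial.natDegree_comp, hmd, mul_one, Polynomial.natDegree_map]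
  have hc0 : (p.map (starRingEnd ℂ)).comp m ≠ 0 := by
    intro h; rw [h] at hc; simp at hc; omega
  have hWd : W.natDegree = 2 * p.natDegree := by
    rw [hW, Polynomial.natDegree_sub_C, Polynomial.natDegree_mul hp0 hc0, hc]; ring
  have hW0 : W ≠ 0 := by intro h; rw [h] at hWd; simp at hWd; omega
  have hsub : T.val ⊆ W.roots := by
    intro z hz
    obtain ⟨hz1, hz2⟩ := hT z hz
    rw [Polynomial.mem_roots hW0, Polynomial.IsRoot.def, hW]
    have hconj : m.eval z = starRingEnd ℂ z := by
      have h1 : e * z - starRingEnd ℂ (e * z) = 2 * s * Complex.I := by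
        rw [Complex.sub_conj, hz2]; push_cast; ring
      simp only [hm, Polynomial.eval_add, Polynomial.eval_mul, Polynomial.eval_C,
        Polynomial.eval_X]
      rw [map_mul] at h1
      linear_combination e * h1 + (starRingEnd ℂ z) * hee
    have h2 : ((p.map (starRingEnd ℂ)).comp m).eval z = starRingEnd ℂ (p.eval z) := by
      rw [Polynomial.eval_comp, hconj, Polynomial.eval_map, Polynomial.eval₂_hom]
    rw [Polynomial.eval_sub, Polynomial.eval_mul, h2, Complex.mul_conj, Complex.normSq_eq_norm_sq]
    have : ‖p.eval z‖ = 1 := hz1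
    simp [this]
  calc T.card = T.val.card := rfl
    _ ≤ W.roots.card := Multiset.card_le_card ((Multiset.le_iff_subset T.nodup).2 hsub)
    _ ≤ W.natDegree := W.card_roots'
    _ = _ := hWd

/-- Only lines with `|s| < ρ` meet the disc, each in at most `2 n` points. The linear dependence on
`ρ` is what makes the dyadic sum outside the small disc converge to `O(A ^ 2 / r)`. -/
theorem hausdorffMeasure_lemniscate_inter_ball_le {p : Polynomial ℂ} (hp : 0 < p.natDegree)
    {ρ : ℝ} (hρ : 0 ≤ ρ) : Measure.hausdorffMeasure 1 (lemniscate p ∩ Metric.ball 0 ρ) ≤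
      ENNReal.ofReal (2 * Real.pi * p.natDegree * ρ) := by
  have hd : p.derivative ≠ 0 := by
    intro h
    exact hp.ne' (Polynomial.derivative_eq_zero.1 h)
  have h := two_mul_hausdorffMeasure_lemniscate_inter_le hd
    (measurableSet_ball (x := (0 : ℂ)) (ε := ρ))
    (fun _ s => (Ioo (-ρ) ρ).indicator (fun _ => ((2 * p.natDegree : ℕ) : ℝ≥0∞)) s) (by
      intro φ s T hT
      rcases T.eq_empty_or_nonempty with rfl | ⟨z, hz⟩
      · simp
      have hs : s ∈ Ioo (-ρ) ρ := by
        obtain ⟨⟨-, h1⟩, h2⟩ := hT z hz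
        rw [← h2, mem_Ioo, ← abs_lt]
        refine (Complex.abs_im_le_norm _).trans_lt ?_
        rw [norm_mul, ← neg_mul, ← Complex.ofReal_neg, Complex.norm_exp_ofReal_mul_I, one_mul]
        simpa using h1
      rw [indicator_of_mem hs]
      exact_mod_cast card_lemniscate_line_le hp φ s T fun z hz => ⟨(hT z hz).1.1, (hT z hz).2⟩)
  rw [setLIntegral_const, lintegral_indicator_const measurableSet_Ioo, Real.volume_Ioo,
    Real.volume_Ioc] at h
  have h2 : ((2 * p.natDegree : ℕ) : ℝ≥0∞) * ENNReal.ofReal (ρ - -ρ) *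
      ENNReal.ofReal (Real.pi - 0) = 2 * ENNReal.ofReal (2 * Real.pi * p.natDegree * ρ) := by
    rw [← ENNReal.ofReal_natCast, ← ENNReal.ofReal_mul (by positivity),
      ← ENNReal.ofReal_mul (by apply mul_nonneg <;> [positivity; linarith]),
      ← ENNReal.ofReal_ofNat, ← ENNReal.ofReal_mul (by norm_num)]
    congr 1; push_cast; ring
  rw [h2] at h
  exact (ENNReal.mul_le_mul_iff_right (by norm_num) (by norm_num)).1 h

theorem lemniscateLength_lt_top {p : Polynomial ℂ} (hp : 0 < p.natDegree) :
    lemniscateLength p < ⊤ := by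
  have hlim : Tendsto (fun z => ‖p.eval z‖) (cocompact ℂ) atTop :=
    p.tendsto_norm_atTop (Polynomial.natDegree_pos_iff_degree_pos.1 hp)
      tendsto_norm_cocompact_atTop
  have h1 : ∀ᶠ z in cocompact ℂ, z ∉ lemniscate p := by
    filter_upwards [hlim.eventually_gt_atTop 1] with z hz hz'
    exact hz.ne' hz'
  obtain ⟨R, hR⟩ : ∃ R : ℝ, lemniscate p ⊆ Metric.ball 0 R := by
    rw [← Metric.cobounded_eq_cocompact] at h1
    have hb : Bornology.IsBounded (lemniscate p) := by
      rw [Bornology.isBounded_def]; exact h1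
    exact hb.subset_ball 0
  have hR' : lemniscate p ⊆ Metric.ball 0 (max R 0) :=
    hR.trans (Metric.ball_subset_ball (le_max_left _ _))
  have := hausdorffMeasure_lemniscate_inter_ball_le hp (le_max_right R 0)
  rw [inter_eq_left.2 hR'] at this
  exact this.trans_lt ENNReal.ofReal_lt_top

/-! ### Rolle's theorem and the Budan–Fourier bound -/

/-- Rolle's theorem for finite sets of zeros. -/
theorem exists_finset_zeros_deriv {f f' : ℝ → ℝ} (I : Set ℝ) (hI : I.OrdConnected)
    (hf : ∀ t ∈ I, HasDerivAt f (f' t) t) (T : Finset ℝ) (hne : T.Nonempty)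
    (hT : ∀ t ∈ T, t ∈ I ∧ f t = 0) :
    ∃ T' : Finset ℝ, T.card ≤ T'.card + 1 ∧
      ∀ t ∈ T', T.min' hne < t ∧ t < T.max' hne ∧ f' t = 0 := by
  classical
  -- Adding a new largest zero creates a critical point beyond the previous largest zero, hence
  -- different from all earlier ones.
  induction T using Finset.induction_on_max with
  | empty => exact absurd hne Finset.not_nonempty_empty
  | insert a T hmax ih =>
    rcases T.eq_empty_or_nonempty with rfl | hne'
    · exact ⟨∅, by simp, by simp⟩
    obtain ⟨T', hcard, hT'⟩ := ih hne' fun t ht => hT t (Finset.mem_insert_of_mem ht)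
    have hmT := T.max'_mem hne'
    have hlt : T.max' hne' < a := hmax _ hmT
    have hmI := hT _ (Finset.mem_insert_of_mem hmT)
    have haI := hT a (Finset.mem_insert_self _ _)
    have hsub : Icc (T.max' hne') a ⊆ I := hI.out hmI.1 haI.1
    obtain ⟨c, hc, hc0⟩ := exists_hasDerivAt_eq_zero (f := f) (f' := f') hlt
      (fun t ht => (hf t (hsub ht)).continuousAt.continuousWithinAt)
      (by rw [hmI.2, haI.2]) (fun t ht => hf t (hsub (Ioo_subset_Icc_self ht)))
    have hmin : (insert a T).min' hne ≤ T.min' hne' :=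
      Finset.min'_le _ _ (Finset.mem_insert_of_mem (T.min'_mem hne'))
    have hmax' : a ≤ (insert a T).max' hne := Finset.le_max' _ _ (Finset.mem_insert_self _ _)
    have hmm : T.min' hne' ≤ T.max' hne' := Finset.min'_le_max' _ hne'
    refine ⟨insert c T', ?_, ?_⟩
    · have hcT : c ∉ T' := fun h => absurd (hT' c h).2.1 (not_lt.2 hc.1.le)
      rw [Finset.card_insert_of_notMem hcT]
      exact (Finset.card_insert_le _ _).trans (by omega)
    · intro t ht
      rcases Finset.mem_insert.1 ht with rfl | ht
      · exact ⟨by linarith [hc.1], by linarith [hc.2], hc0⟩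
      · obtain ⟨h1, h2, h3⟩ := hT' t ht
        exact ⟨by linarith, by linarith, h3⟩

/-- Iterated Rolle: `m` zeros of `f 0` give at least `m - j` zeros of the `j`-th derivative. -/
theorem exists_finset_zeros_iterate {f : ℕ → ℝ → ℝ} (I : Set ℝ) (hI : I.OrdConnected)
    (hf : ∀ k, ∀ t ∈ I, HasDerivAt (f k) (f (k + 1) t) t) (T : Finset ℝ)
    (hT : ∀ t ∈ T, t ∈ I ∧ f 0 t = 0) (j : ℕ) :
    ∃ T' : Finset ℝ, T.card ≤ T'.card + j ∧ ∀ t ∈ T', t ∈ I ∧ f j t = 0 := by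
  induction j with
  | zero => exact ⟨T, by simp, hT⟩
  | succ j ih =>
    obtain ⟨T', hc, hT'⟩ := ih
    rcases T'.eq_empty_or_nonempty with rfl | hne
    · exact ⟨∅, by simp at hc ⊢; omega, by simp⟩
    obtain ⟨T'', hc', hT''⟩ := exists_finset_zeros_deriv I hI (hf j) T' hne hT'
    refine ⟨T'', by omega, fun t ht => ?_⟩
    obtain ⟨h1, h2, h3⟩ := hT'' t ht
    exact ⟨hI.out (hT' _ (T'.min'_mem hne)).1 (hT' _ (T'.max'_mem hne)).1 ⟨h1.le, h2.le⟩, h3⟩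

/-- A zero of the derivative before the first zero of `f`, when `f` initially moves away
from `0`. -/
theorem exists_deriv_zero_of_mul_pos {f f' : ℝ → ℝ} {A t : ℝ} (hAt : A < t)
    (hf : ∀ x ∈ Icc A t, HasDerivAt f (f' x) x) (ht : f t = 0) (hpos : 0 < f A * f' A) :
    ∃ c ∈ Ioo A t, f' c = 0 := by
  by_contra! hcon
  have hc : ∀ c ∈ Ico A t, f' c ≠ 0 := by
    intro c hc
    rcases hc.1.eq_or_lt with rfl | h
    · rintro h0; rw [h0, mul_zero] at hpos; exact hpos.false
    · exact hcon c ⟨h, hc.2⟩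
  obtain ⟨c, hc1, hc2⟩ := exists_hasDerivAt_eq_slope f f' hAt
    (fun x hx => (hf x hx).continuousAt.continuousWithinAt)
    (fun x hx => hf x (Ioo_subset_Icc_self hx))
  rw [ht, zero_sub] at hc2
  have hsub : Icc A c ⊆ Ico A t := fun x hx => ⟨hx.1, hx.2.trans_lt hc1.2⟩
  have hneg : f' A * f' c < 0 := by
    rw [hc2, mul_div_assoc', mul_neg, mul_comm]
    exact div_neg_of_neg_of_pos (by linarith) (by linarith)
  have hcx : Convex ℝ (Icc A c) := convex_Icc A c
  -- By Darboux, `f'` keeps its sign on `[A, c]`; but the mean slope from `A` to the zero `t` has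
  -- the sign opposite to `f' A`.
  rcases hasDerivWithinAt_forall_lt_or_forall_gt_of_forall_ne (f := f) (f' := f') (m := 0) hcx
    (fun x hx => (hf x (Ico_subset_Icc_self (hsub hx))).hasDerivWithinAt)
    (fun x hx => hc x (hsub hx)) with h | h
  · have h1 := h A (left_mem_Icc.2 hc1.1.le)
    have h2 := h c (right_mem_Icc.2 hc1.1.le)
    nlinarith
  · have h1 := h A (left_mem_Icc.2 hc1.1.le)
    have h2 := h c (right_mem_Icc.2 hc1.1.le)
    nlinarith

/-- The mirror image of `exists_deriv_zero_of_mul_pos`. -/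
theorem exists_deriv_zero_of_mul_neg {f f' : ℝ → ℝ} {t B : ℝ} (htB : t < B)
    (hf : ∀ x ∈ Icc t B, HasDerivAt f (f' x) x) (ht : f t = 0) (hneg : f B * f' B < 0) :
    ∃ c ∈ Ioo t B, f' c = 0 := by
  obtain ⟨c, hc, hc0⟩ := exists_deriv_zero_of_mul_pos (f := fun x => f (-x))
    (f' := fun x => -f' (-x)) (A := -B) (t := -t) (by linarith)
    (fun x hx => by
      have := (hf (-x) ⟨by linarith [hx.2], by linarith [hx.1]⟩).comp x (hasDerivAt_neg x)
      simpa [Function.comp_def] using this) (by simpa using ht) (by simp; linarith)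
  exact ⟨-c, ⟨by linarith [hc.2], by linarith [hc.1]⟩, by simpa using hc0⟩

open Classical in
/-- The refined Rolle count with boundary signs. -/
theorem exists_finset_zeros_deriv_boundary {f f' : ℝ → ℝ} {A B : ℝ} (hAB : A < B)
    (hf : ∀ t ∈ Icc A B, HasDerivAt f (f' t) t) (hA : f A * f' A ≠ 0) (hB : f B * f' B ≠ 0)
    (T : Finset ℝ) (hT : ∀ t ∈ T, t ∈ Ioo A B ∧ f t = 0) :
    ∃ T' : Finset ℝ, (∀ t ∈ T', t ∈ Ioo A B ∧ f' t = 0) ∧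
      (T.card : ℤ) ≤ T'.card + (if f A * f' A < 0 then 1 else 0)
        - (if f B * f' B < 0 then 1 else 0) := by
  rcases T.eq_empty_or_nonempty with rfl | hne
  · by_cases h1 : f A * f' A < 0
    · refine ⟨∅, by simp, ?_⟩
      simp only [h1, if_true]; split_ifs <;> simp
    by_cases h2 : f B * f' B < 0
    -- With `T` empty a zero of `f'` is still owed. The function may vanish somewhere although `T`
    -- does not record it, and then the right end provides one.
    · by_cases h0 : ∃ t ∈ Ioo A B, f t = 0
      · obtain ⟨t, ht, ht0⟩ := h0
        obtain ⟨c, hc, hc0⟩ := exists_deriv_zero_of_mul_neg ht.2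
          (fun x hx => hf x ⟨ht.1.le.trans hx.1, hx.2⟩) ht0 h2
        refine ⟨{c}, ?_, by simp [h1, h2]⟩
        simp only [Finset.mem_singleton, forall_eq]
        exact ⟨⟨ht.1.trans hc.1, hc.2⟩, hc0⟩
      · push Not at h0
        have hpos : 0 < f A * f' A := lt_of_le_of_ne (not_lt.1 h1) hA.symm
        -- Without zeros of `f` and of `f'`, both keep their signs, so `f * f'` could not be
        -- positive at `A` and negative at `B`.
        have hdz : ∃ c ∈ Ioo A B, f' c = 0 := by
          by_contra! hcon
          have hcon' : ∀ c ∈ Icc A B, f' c ≠ 0 := by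
            intro c hc
            rcases hc.1.eq_or_lt with rfl | h3
            · exact right_ne_zero_of_mul hA
            rcases hc.2.eq_or_lt with rfl | h4
            · exact right_ne_zero_of_mul hB
            exact hcon c ⟨h3, h4⟩
          have hcont : ContinuousOn f (Icc A B) := fun x hx =>
            (hf x hx).continuousAt.continuousWithinAt
          have hfAB : 0 < f A * f B := by
            by_contra! hle
            have hA0 : f A ≠ 0 := left_ne_zero_of_mul hA
            have hB0 : f B ≠ 0 := left_ne_zero_of_mul hB
            rcases lt_or_gt_of_ne hA0 with ha | ha
            · have hb : 0 < f B := by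
                rcases lt_or_gt_of_ne hB0 with hb | hb
                · nlinarith
                · exact hb
              obtain ⟨x, hx, hx0⟩ := intermediate_value_Ioo hAB.le hcont ⟨ha, hb⟩
              exact h0 x hx hx0
            · have hb : f B < 0 := by
                rcases lt_or_gt_of_ne hB0 with hb | hb
                · exact hb
                · nlinarith
              obtain ⟨x, hx, hx0⟩ := intermediate_value_Ioo' hAB.le hcont ⟨hb, ha⟩
              exact h0 x hx hx0
          have hlr := hasDerivWithinAt_forall_lt_or_forall_gt_of_forall_ne (f := f) (f' := f')
            (m := 0) (convex_Icc A B) (fun x hx => (hf x hx).hasDerivWithinAt) hcon'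
          have hle := hAB.le
          have hsign : 0 < f' A * f' B := by
            rcases hlr with h | h
            · have ha := h A (left_mem_Icc.2 hle)
              have hb := h B (right_mem_Icc.2 hle)
              nlinarith
            · have ha := h A (left_mem_Icc.2 hle)
              have hb := h B (right_mem_Icc.2 hle)
              nlinarith
          have : 0 < (f A * f' A) * (f B * f' B) := by
            have := mul_pos hfAB hsign; nlinarith
          nlinarith
        obtain ⟨c, hc, hc0⟩ := hdz
        refine ⟨{c}, ?_, by simp [h1, h2]⟩
        simp only [Finset.mem_singleton, forall_eq]
        exact ⟨hc, hc0⟩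
    · exact ⟨∅, by simp, by simp [h1, h2]⟩
  · obtain ⟨T', hcard, hT'⟩ := exists_finset_zeros_deriv (Icc A B) ordConnected_Icc hf T hne
      fun t ht => ⟨Ioo_subset_Icc_self (hT t ht).1, (hT t ht).2⟩
    have hmin := hT _ (T.min'_mem hne)
    have hmax := hT _ (T.max'_mem hne)
    have hmm : T.min' hne ≤ T.max' hne := Finset.min'_le_max' _ hne
    -- Rolle loses one zero. A positive `f * f'` at `A` restores it by a critical point before the
    -- first zero; a negative `f * f'` at `B` gives another one after the last zero.
    obtain ⟨TA, hTA, hTAc⟩ : ∃ TA : Finset ℝ, (∀ t ∈ TA, t ∈ Ioo A (T.min' hne) ∧ f' t = 0) ∧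
        (1 : ℤ) ≤ TA.card + (if f A * f' A < 0 then 1 else 0) := by
      by_cases h1 : f A * f' A < 0
      · exact ⟨∅, by simp, by simp [h1]⟩
      · obtain ⟨c, hc, hc0⟩ := exists_deriv_zero_of_mul_pos hmin.1.1
          (fun x hx => hf x ⟨hx.1, hx.2.trans hmin.1.2.le⟩) hmin.2
          (lt_of_le_of_ne (not_lt.1 h1) hA.symm)
        refine ⟨{c}, ?_, by simp [h1]⟩
        simp only [Finset.mem_singleton, forall_eq]
        exact ⟨hc, hc0⟩
    obtain ⟨TB, hTB, hTBc⟩ : ∃ TB : Finset ℝ, (∀ t ∈ TB, t ∈ Ioo (T.max' hne) B ∧ f' t = 0) ∧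
        (0 : ℤ) ≤ TB.card - (if f B * f' B < 0 then 1 else 0) := by
      by_cases h1 : f B * f' B < 0
      · obtain ⟨c, hc, hc0⟩ := exists_deriv_zero_of_mul_neg hmax.1.2
          (fun x hx => hf x ⟨hmax.1.1.le.trans hx.1, hx.2⟩) hmax.2 h1
        refine ⟨{c}, ?_, by simp [h1]⟩
        simp only [Finset.mem_singleton, forall_eq]
        exact ⟨hc, hc0⟩
      · exact ⟨∅, by simp, by simp [h1]⟩
    refine ⟨TA ∪ (T' ∪ TB), ?_, ?_⟩
    · intro t ht
      rcases Finset.mem_union.1 ht with h | h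
      · obtain ⟨h1, h2⟩ := hTA t h
        exact ⟨⟨h1.1, h1.2.trans hmin.1.2⟩, h2⟩
      rcases Finset.mem_union.1 h with h | h
      · obtain ⟨h1, h2, h3⟩ := hT' t h
        exact ⟨⟨hmin.1.1.trans h1, h2.trans hmax.1.2⟩, h3⟩
      · obtain ⟨h1, h2⟩ := hTB t h
        exact ⟨⟨hmax.1.1.trans h1.1, h1.2⟩, h2⟩
    · have hd1 : Disjoint T' TB := Finset.disjoint_left.2 fun t h1 h2 =>
        absurd (hT' t h1).2.1 (not_lt.2 (hTB t h2).1.1.le)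
      have hd2 : Disjoint TA (T' ∪ TB) := Finset.disjoint_left.2 fun t h1 h2 => by
        have h3 := (hTA t h1).1.2
        rcases Finset.mem_union.1 h2 with h | h
        · linarith [(hT' t h).1]
        · linarith [(hTB t h).1.1]
      rw [Finset.card_union_of_disjoint hd2, Finset.card_union_of_disjoint hd1]
      push_cast
      have : (T.card : ℤ) ≤ T'.card + 1 := by exact_mod_cast hcard
      linarith

open Classical in
/-- The Budan–Fourier bound on the number of zeros of `f 0` in `(A, B)`. -/
theorem card_zeros_le_sign_changes {f : ℕ → ℝ → ℝ} {A B : ℝ} (hAB : A < B) (n : ℕ)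
    (hf : ∀ k, ∀ t ∈ Icc A B, HasDerivAt (f k) (f (k + 1) t) t)
    (hA : ∀ k ≤ n, f k A ≠ 0) (hB : ∀ k ≤ n, f k B ≠ 0) (hn : ∀ t ∈ Ioo A B, f n t ≠ 0)
    (T : Finset ℝ) (hT : ∀ t ∈ T, t ∈ Ioo A B ∧ f 0 t = 0) :
    (T.card : ℤ) ≤ ∑ k ∈ Finset.range n, ((if f k A * f (k + 1) A < 0 then (1 : ℤ) else 0)
        - (if f k B * f (k + 1) B < 0 then 1 else 0)) := by
  have key : ∀ j ≤ n, ∃ T' : Finset ℝ, (∀ t ∈ T', t ∈ Ioo A B ∧ f j t = 0) ∧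
      (T.card : ℤ) ≤ T'.card + ∑ k ∈ Finset.range j,
        ((if f k A * f (k + 1) A < 0 then (1 : ℤ) else 0)
        - (if f k B * f (k + 1) B < 0 then 1 else 0)) := by
    intro j
    induction j with
    | zero => exact fun _ => ⟨T, hT, by simp⟩
    | succ j ih =>
      intro hj
      obtain ⟨T', hT', hc⟩ := ih (by omega)
      obtain ⟨T'', hT'', hc'⟩ := exists_finset_zeros_deriv_boundary hAB (hf j)
        (mul_ne_zero (hA j (by omega)) (hA (j + 1) hj))
        (mul_ne_zero (hB j (by omega)) (hB (j + 1) hj)) T' hT'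
      refine ⟨T'', hT'', ?_⟩
      rw [Finset.sum_range_succ]
      linarith
  obtain ⟨T', hT', hc⟩ := key n le_rfl
  have : T' = ∅ := Finset.eq_empty_of_forall_notMem fun t ht => hn t (hT' t ht).1 (hT' t ht).2
  simpa [this] using hc

/-! ### The majorant for the line count and its integral -/

/-- Indicator of a sign change of the cosine between `x` and `x + ψ`. -/
noncomputable def cosSignChange (ψ x : ℝ) : ℝ :=
  if Real.cos x * Real.cos (x + ψ) < 0 then 1 else 0

/-- Indicator of the points where the cosine is at most `κ` in absolute value. -/
noncomputable def cosSmall (κ x : ℝ) : ℝ := if |Real.cos x| ≤ κ then 1 else 0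

theorem cosSignChange_nonneg (ψ x : ℝ) : 0 ≤ cosSignChange ψ x := by
  unfold cosSignChange; split_ifs <;> norm_num

theorem cosSignChange_le_one (ψ x : ℝ) : cosSignChange ψ x ≤ 1 := by
  unfold cosSignChange; split_ifs <;> norm_num

theorem cosSmall_nonneg (κ x : ℝ) : 0 ≤ cosSmall κ x := by
  unfold cosSmall; split_ifs <;> norm_num

theorem cosSmall_le_one (κ x : ℝ) : cosSmall κ x ≤ 1 := by
  unfold cosSmall; split_ifs <;> norm_num

theorem measurable_cosSignChange {α : Type*} [MeasurableSpace α] {f g : α → ℝ}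
    (hf : Measurable f) (hg : Measurable g) : Measurable fun x => cosSignChange (f x) (g x) := by
  unfold cosSignChange
  refine Measurable.ite ?_ measurable_const measurable_const
  exact measurableSet_lt (by fun_prop) measurable_const

theorem measurable_cosSmall {α : Type*} [MeasurableSpace α] {f : α → ℝ} (κ : ℝ)
    (hf : Measurable f) : Measurable fun x => cosSmall κ (f x) := by
  unfold cosSmall
  refine Measurable.ite ?_ measurable_const measurable_const
  exact measurableSet_le (by fun_prop) measurable_const

theorem cosSignChange_periodic (ψ : ℝ) : Function.Periodic (cosSignChange ψ) Real.pi := by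
  intro x
  unfold cosSignChange
  rw [add_right_comm, Real.cos_add_pi, Real.cos_add_pi, neg_mul_neg]

theorem cosSmall_periodic (κ : ℝ) : Function.Periodic (cosSmall κ) Real.pi := by
  intro x
  unfold cosSmall
  rw [Real.cos_add_pi, abs_neg]

theorem intervalIntegrable_of_measurable_bounded {g : ℝ → ℝ} (hg : Measurable g) {C : ℝ}
    (hC : ∀ x, |g x| ≤ C) (a b : ℝ) : IntervalIntegrable g volume a b := by
  rw [intervalIntegrable_iff]
  exact Measure.integrableOn_of_bounded (M := C) (by simp)
    hg.aestronglyMeasurable (ae_of_all _ hC)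

theorem intervalIntegrable_cosSignChange (ψ a b : ℝ) :
    IntervalIntegrable (cosSignChange ψ) volume a b :=
  intervalIntegrable_of_measurable_bounded (g := cosSignChange ψ) (C := 1)
    (measurable_cosSignChange measurable_const measurable_id)
    (fun x => abs_le.2 ⟨by linarith [cosSignChange_nonneg ψ x], cosSignChange_le_one ψ x⟩) a b

theorem intervalIntegrable_cosSmall (κ a b : ℝ) :
    IntervalIntegrable (cosSmall κ) volume a b :=
  intervalIntegrable_of_measurable_bounded (g := cosSmall κ) (C := 1)
    (measurable_cosSmall κ measurable_id)
    (fun x => abs_le.2 ⟨by linarith [cosSmall_nonneg κ x], cosSmall_le_one κ x⟩) a b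

/-- As `φ` runs through `[0, π]`, `n φ + β` runs through `n` full periods, so the phase `β` does not
matter. -/
theorem integral_comp_natCast_mul_add {g : ℝ → ℝ} (hper : Function.Periodic g Real.pi)
    (hg : ∀ a b, IntervalIntegrable g volume a b) {n : ℕ} (hn : n ≠ 0) (β : ℝ) :
    ∫ φ in (0 : ℝ)..Real.pi, g (n * φ + β) = ∫ x in (0 : ℝ)..Real.pi, g x := by
  have hn' : (n : ℝ) ≠ 0 := by exact_mod_cast hn
  rw [intervalIntegral.integral_comp_mul_add (fun x => g x) hn']
  have h1 := hper.intervalIntegral_add_zsmul_eq (n : ℤ) β hg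
  have h2 := hper.intervalIntegral_add_eq β 0
  rw [h2, zero_add] at h1
  simp only [zsmul_eq_mul, Int.cast_natCast] at h1
  rw [mul_zero, zero_add, add_comm _ β, h1, smul_eq_mul]
  field_simp

theorem le_integral_of_indicator {g : ℝ → ℝ} (hg : IntervalIntegrable g volume 0 Real.pi)
    (h0 : ∀ x, 0 ≤ g x) {a b : ℝ} (ha : 0 ≤ a) (hab : a ≤ b) (hb : b ≤ Real.pi)
    (h : ∀ x ∈ Ioo a b, 1 ≤ g x) : b - a ≤ ∫ x in (0 : ℝ)..Real.pi, g x := by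
  have h1 : IntervalIntegrable g volume a b := hg.mono_set (by
    rw [uIcc_of_le hab, uIcc_of_le (by linarith)]; exact Icc_subset_Icc ha hb)
  have h2 : ∫ x in a..b, (1 : ℝ) ≤ ∫ x in a..b, g x :=
    intervalIntegral.integral_mono_on_of_le_Ioo hab (by simp) h1 h
  have h3 : ∫ x in a..b, g x ≤ ∫ x in (0 : ℝ)..Real.pi, g x :=
    intervalIntegral.integral_mono_interval ha hab hb (ae_of_all _ h0) hg
  simp at h2
  linarith

/-- The cosine changes sign between `x` and `x + ψ` when the zero `π / 2` lies between them, which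
is an interval of `x` of length `|ψ|`. -/
theorem abs_le_integral_cosSignChange {ψ : ℝ} (hψ : |ψ| ≤ Real.pi / 2) :
    |ψ| ≤ ∫ x in (0 : ℝ)..Real.pi, cosSignChange ψ x := by
  have hpi := Real.pi_pos
  rcases le_total 0 ψ with h | h
  · rw [abs_of_nonneg h] at hψ ⊢
    have := le_integral_of_indicator (intervalIntegrable_cosSignChange ψ 0 Real.pi)
      (cosSignChange_nonneg ψ) (a := Real.pi / 2 - ψ) (b := Real.pi / 2) (by linarith)
      (by linarith) (by linarith) (by
        intro x hx
        have h1 : 0 < Real.cos x := Real.cos_pos_of_mem_Ioo ⟨by linarith [hx.1], hx.2⟩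
        have h2 : Real.cos (x + ψ) < 0 :=
          Real.cos_neg_of_pi_div_two_lt_of_lt (by linarith [hx.1]) (by linarith [hx.2])
        rw [cosSignChange, if_pos (mul_neg_of_pos_of_neg h1 h2)])
    linarith
  · rw [abs_of_nonpos h] at hψ ⊢
    have := le_integral_of_indicator (intervalIntegrable_cosSignChange ψ 0 Real.pi)
      (cosSignChange_nonneg ψ) (a := Real.pi / 2) (b := Real.pi / 2 - ψ) (by linarith)
      (by linarith) (by linarith) (by
        intro x hx
        have h1 : 0 < Real.cos (x + ψ) :=
          Real.cos_pos_of_mem_Ioo ⟨by linarith [hx.1], by linarith [hx.2]⟩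
        have h2 : Real.cos x < 0 :=
          Real.cos_neg_of_pi_div_two_lt_of_lt (by linarith [hx.1]) (by linarith [hx.2])
        rw [cosSignChange, if_pos (mul_neg_of_neg_of_pos h2 h1)])
    linarith

/-- Jordan's inequality `2 / π * |y| ≤ |sin y|` confines the set to an interval of length `π κ`
about `π / 2`. -/
theorem integral_cosSmall_le {κ : ℝ} (hκ : 0 ≤ κ) :
    ∫ x in (0 : ℝ)..Real.pi, cosSmall κ x ≤ Real.pi * κ := by
  have hpi := Real.pi_pos
  set S := Icc (Real.pi / 2 - Real.pi * κ / 2) (Real.pi / 2 + Real.pi * κ / 2) with hS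
  have h1 : ∫ x in (0 : ℝ)..Real.pi, cosSmall κ x ≤
      ∫ x in Ioc 0 Real.pi, S.indicator (fun _ => (1 : ℝ)) x := by
    rw [← intervalIntegral.integral_of_le hpi.le]
    refine intervalIntegral.integral_mono_on hpi.le (intervalIntegrable_cosSmall _ _ _) ?_ ?_
    · rw [intervalIntegrable_iff]
      exact (integrableOn_const (by simp)).indicator measurableSet_Icc
    · intro x hx
      unfold cosSmall
      split_ifs with h
      · have h2 : |Real.pi / 2 - x| ≤ Real.pi / 2 := abs_le.2 ⟨by linarith [hx.2], by linarith [hx.1]⟩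
        have h3 := Real.mul_abs_le_abs_sin h2
        rw [Real.sin_pi_div_two_sub] at h3
        have h4 : |Real.pi / 2 - x| ≤ Real.pi * κ / 2 := by
          have h5 : 2 / Real.pi * |Real.pi / 2 - x| ≤ κ := h3.trans h
          rw [div_mul_eq_mul_div, div_le_iff₀ hpi] at h5
          linarith
        rw [abs_le] at h4
        rw [indicator_of_mem (show x ∈ S from ⟨by linarith, by linarith⟩)]
      · exact indicator_nonneg (fun _ _ => zero_le_one) _
  refine h1.trans ?_
  rw [integral_indicator measurableSet_Icc, setIntegral_const, smul_eq_mul, mul_one,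
    Measure.real, Measure.restrict_apply measurableSet_Icc]
  refine (ENNReal.toReal_mono ?_ (measure_mono inter_subset_left)).trans ?_
  · simp
  · rw [Real.volume_Icc, ENNReal.toReal_ofReal (by nlinarith)]; linarith

theorem integral_arcsin_zero_one : ∫ x in (0 : ℝ)..1, Real.arcsin x = Real.pi / 2 - 1 := by
  have h := intervalIntegral.integral_eq_sub_of_hasDerivAt_of_le (a := 0) (b := 1)
    (f := fun x => x * Real.arcsin x + √(1 - x ^ 2)) (f' := Real.arcsin) zero_le_one
    (by fun_prop) (by
      intro x hx
      have hx2 : 0 < 1 - x ^ 2 := by nlinarith [hx.1, hx.2]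
      have h1 := (hasDerivAt_id' x).mul (Real.hasDerivAt_arcsin (x := x) (by linarith [hx.1])
        (by linarith [hx.2]))
      have h2 : HasDerivAt (fun x : ℝ => 1 - x ^ 2) (-(2 * x)) x := by
        simpa using ((hasDerivAt_id x).pow 2).const_sub 1
      have h3 := h1.add (h2.sqrt hx2.ne')
      have : √(1 - x ^ 2) ≠ 0 := (Real.sqrt_pos.2 hx2).ne'
      refine h3.congr_deriv ?_
      field_simp
      ring) (Real.continuous_arcsin.intervalIntegrable _ _)
  rw [h]
  simp

theorem integral_abs_arcsin_div {r : ℝ} (hr : 0 < r) :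
    ∫ s in (-r)..r, |Real.arcsin (s / r)| = r * (Real.pi - 2) := by
  rw [intervalIntegral.integral_comp_div (fun x => |Real.arcsin x|) hr.ne', neg_div,
    div_self hr.ne', smul_eq_mul]
  congr 1
  have hc : Continuous fun x => |Real.arcsin x| := Real.continuous_arcsin.abs
  rw [← intervalIntegral.integral_add_adjacent_intervals (b := 0)
    (hc.intervalIntegrable _ _) (hc.intervalIntegrable _ _)]
  have h1 : ∫ x in (0 : ℝ)..1, |Real.arcsin x| = Real.pi / 2 - 1 := by
    rw [← integral_arcsin_zero_one]
    refine intervalIntegral.integral_congr fun x hx => ?_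
    rw [uIcc_of_le zero_le_one] at hx
    exact abs_of_nonneg (Real.arcsin_nonneg.2 hx.1)
  have h2 : ∫ x in (-1 : ℝ)..0, |Real.arcsin x| = ∫ x in (0 : ℝ)..1, |Real.arcsin x| := by
    have := intervalIntegral.integral_comp_neg (a := 0) (b := 1) (fun x => |Real.arcsin x|)
    simp only [Real.arcsin_neg, abs_neg, neg_zero] at this
    exact this.symm
  rw [h2, h1]; ring

/-- The majorant for the number of intersections with the line of direction `φ` at signed
distance `s` from the origin, inside the disc of radius `r`. -/
noncomputable def lineCount (n : ℕ) (κ r σ : ℝ) (G : Set ℝ) (φ s : ℝ) : ℝ :=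
  n - (∑ m ∈ Finset.range n, (cosSignChange (Real.arcsin (s / r)) (n * φ + m * Real.arcsin (s / r))
      + cosSignChange (-Real.arcsin (s / r)) (n * φ + -(m * Real.arcsin (s / r)))))
    -- If some cosine is too small for the sign count to be reliable, this term is at least `3 n`.
    -- Since the preceding sum is at most `2 n`, the majorant then exceeds the trivial bound `2 n`.
    + 3 * n * (∑ m ∈ Finset.range (n + 1), (cosSmall κ (n * φ + m * Real.arcsin (s / r))
      + cosSmall κ (n * φ + -(m * Real.arcsin (s / r)))))
    - G.indicator 1 φ * (Icc (-σ) σ).indicator 1 s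

theorem measurable_lineCount (n : ℕ) (κ r σ : ℝ) {G : Set ℝ} (hG : MeasurableSet G) :
    Measurable (Function.uncurry (lineCount n κ r σ G)) := by
  have ha : Measurable fun q : ℝ × ℝ => Real.arcsin (q.2 / r) :=
    Real.measurable_arcsin.comp (by fun_prop)
  have h1 : ∀ m : ℕ, Measurable fun q : ℝ × ℝ => cosSignChange (Real.arcsin (q.2 / r))
      (n * q.1 + m * Real.arcsin (q.2 / r)) := fun m =>
    measurable_cosSignChange ha (by fun_prop)
  have h2 : ∀ m : ℕ, Measurable fun q : ℝ × ℝ => cosSignChange (-Real.arcsin (q.2 / r))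
      (n * q.1 + -(m * Real.arcsin (q.2 / r))) := fun m =>
    measurable_cosSignChange ha.neg (by fun_prop)
  have h3 : ∀ m : ℕ, Measurable fun q : ℝ × ℝ => cosSmall κ
      (n * q.1 + m * Real.arcsin (q.2 / r)) := fun m =>
    measurable_cosSmall κ (by fun_prop)
  have h4 : ∀ m : ℕ, Measurable fun q : ℝ × ℝ => cosSmall κ
      (n * q.1 + -(m * Real.arcsin (q.2 / r))) := fun m =>
    measurable_cosSmall κ (by fun_prop)
  have h5 : Measurable fun q : ℝ × ℝ => G.indicator (1 : ℝ → ℝ) q.1 :=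
    (measurable_one.indicator hG).comp measurable_fst
  have h6 : Measurable fun q : ℝ × ℝ => (Icc (-σ) σ).indicator (1 : ℝ → ℝ) q.2 :=
    (measurable_one.indicator measurableSet_Icc).comp measurable_snd
  unfold lineCount Function.uncurry
  exact ((measurable_const.sub (Finset.measurable_fun_sum _ fun m _ => (h1 m).add (h2 m))).add
    ((Finset.measurable_fun_sum _ fun m _ => (h3 m).add (h4 m)).const_mul _)).sub (h5.mul h6)

theorem intervalIntegrable_comp_mul_add {g : ℝ → ℝ}
    (hg : ∀ a b, IntervalIntegrable g volume a b) {c : ℝ} (hc : c ≠ 0) (β a b : ℝ) :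
    IntervalIntegrable (fun x => g (c * x + β)) volume a b := by
  have h := ((hg (c * a + β) (c * b + β)).comp_add_right β).comp_mul_left (c := c)
  simpa [hc] using h

/-- For fixed `s` each summand is a `π`-periodic function of `n φ` with a phase depending on `s`,
and the phases drop out on averaging. Each of the `2 n` sign-change terms contributes at least
`|arcsin (s / r)|`. -/
theorem integral_lineCount_le {n : ℕ} (hn : n ≠ 0) {κ r σ γ : ℝ} (hκ : 0 ≤ κ) {G : Set ℝ}
    (hG : MeasurableSet G) (hγ : γ ≤ (volume (G ∩ Ioc 0 Real.pi)).toReal) (s : ℝ) :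
    IntervalIntegrable (fun φ => lineCount n κ r σ G φ s) volume 0 Real.pi ∧
    ∫ φ in (0 : ℝ)..Real.pi, lineCount n κ r σ G φ s ≤
      n * Real.pi - 2 * n * |Real.arcsin (s / r)| + 6 * n * (n + 1) * (Real.pi * κ)
        - γ * (Icc (-σ) σ).indicator 1 s := by
  have hn' : (n : ℝ) ≠ 0 := by exact_mod_cast hn
  set ψ := Real.arcsin (s / r) with hψ
  have hψ2 : |ψ| ≤ Real.pi / 2 := abs_le.2 ⟨Real.neg_pi_div_two_le_arcsin _,
    Real.arcsin_le_pi_div_two _⟩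
  have i1 : ∀ (ψ' β : ℝ), IntervalIntegrable (fun φ => cosSignChange ψ' (n * φ + β)) volume 0
      Real.pi := fun ψ' β =>
    intervalIntegrable_comp_mul_add (intervalIntegrable_cosSignChange ψ') hn' β _ _
  have i2 : ∀ (β : ℝ), IntervalIntegrable (fun φ => cosSmall κ (n * φ + β)) volume 0
      Real.pi := fun β =>
    intervalIntegrable_comp_mul_add (intervalIntegrable_cosSmall κ) hn' β _ _
  have e1 : ∀ (ψ' β : ℝ), |ψ'| = |ψ| →
      |ψ| ≤ ∫ φ in (0 : ℝ)..Real.pi, cosSignChange ψ' (n * φ + β) := by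
    intro ψ' β h
    rw [integral_comp_natCast_mul_add (cosSignChange_periodic ψ')
      (intervalIntegrable_cosSignChange ψ') hn β, ← h]
    exact abs_le_integral_cosSignChange (h ▸ hψ2)
  have e2 : ∀ β : ℝ, ∫ φ in (0 : ℝ)..Real.pi, cosSmall κ (n * φ + β) ≤ Real.pi * κ := by
    intro β
    rw [integral_comp_natCast_mul_add (cosSmall_periodic κ) (intervalIntegrable_cosSmall κ) hn β]
    exact integral_cosSmall_le hκ
  have i3 : IntervalIntegrable (fun φ => G.indicator (1 : ℝ → ℝ) φ) volume 0 Real.pi := by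
    rw [intervalIntegrable_iff]
    exact (integrableOn_const (by simp)).indicator hG
  have e3 : γ ≤ ∫ φ in (0 : ℝ)..Real.pi, G.indicator (1 : ℝ → ℝ) φ := by
    rw [intervalIntegral.integral_of_le Real.pi_pos.le, integral_indicator_one hG, Measure.real,
      Measure.restrict_apply hG]
    exact hγ
  have j1 : IntervalIntegrable (fun φ => ∑ m ∈ Finset.range n, (cosSignChange ψ (n * φ + m * ψ)
      + cosSignChange (-ψ) (n * φ + -(m * ψ)))) volume 0 Real.pi :=
    by simpa only [Finset.sum_fn] using IntervalIntegrable.sum (Finset.range n) fun m _ =>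
      (i1 ψ (m * ψ)).add (i1 (-ψ) (-(m * ψ)))
  have j2 : IntervalIntegrable (fun φ => ∑ m ∈ Finset.range (n + 1), (cosSmall κ (n * φ + m * ψ)
      + cosSmall κ (n * φ + -(m * ψ)))) volume 0 Real.pi :=
    by simpa only [Finset.sum_fn] using IntervalIntegrable.sum (Finset.range (n + 1)) fun m _ =>
      (i2 (m * ψ)).add (i2 (-(m * ψ)))
  have k1 : 2 * n * |ψ| ≤ ∫ φ in (0 : ℝ)..Real.pi, ∑ m ∈ Finset.range n,
      (cosSignChange ψ (n * φ + m * ψ) + cosSignChange (-ψ) (n * φ + -(m * ψ))) := by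
    rw [intervalIntegral.integral_finsetSum fun m _ => (i1 _ _).add (i1 _ _)]
    calc 2 * n * |ψ| = ∑ m ∈ Finset.range n, (|ψ| + |ψ|) := by simp; ring
      _ ≤ _ := Finset.sum_le_sum fun m _ => by
        rw [intervalIntegral.integral_add (i1 _ _) (i1 _ _)]
        exact add_le_add (e1 _ _ rfl) (e1 _ _ (abs_neg ψ))
  have k2 : ∫ φ in (0 : ℝ)..Real.pi, ∑ m ∈ Finset.range (n + 1), (cosSmall κ (n * φ + m * ψ)
      + cosSmall κ (n * φ + -(m * ψ))) ≤ 2 * (n + 1) * (Real.pi * κ) := by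
    rw [intervalIntegral.integral_finsetSum fun m _ => (i2 _).add (i2 _)]
    calc _ ≤ ∑ m ∈ Finset.range (n + 1), (Real.pi * κ + Real.pi * κ) :=
        Finset.sum_le_sum fun m _ => by
          rw [intervalIntegral.integral_add (i2 _) (i2 _)]
          exact add_le_add (e2 _) (e2 _)
      _ = _ := by simp; ring
  have hI : 0 ≤ (Icc (-σ) σ).indicator (1 : ℝ → ℝ) s :=
    indicator_nonneg (fun _ _ => zero_le_one) _
  have hc : IntervalIntegrable (fun _ : ℝ => (n : ℝ)) volume 0 Real.pi := by simp
  refine ⟨((hc.sub j1).add (j2.const_mul _)).sub (i3.mul_const _), ?_⟩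
  unfold lineCount
  rw [← hψ, intervalIntegral.integral_sub ((hc.sub j1).add (j2.const_mul _)) (i3.mul_const _),
    intervalIntegral.integral_add (hc.sub j1) (j2.const_mul _),
    intervalIntegral.integral_sub hc j1, intervalIntegral.integral_const_mul,
    intervalIntegral.integral_mul_const]
  have h3 := mul_le_mul_of_nonneg_right e3 hI
  have h2 := mul_le_mul_of_nonneg_left k2 (by positivity : (0 : ℝ) ≤ 3 * n)
  have h0 : ∫ _ in (0 : ℝ)..Real.pi, (n : ℝ) = n * Real.pi := by simp; ring
  rw [h0]
  linarith

/-- The leading term is `∫ (n π - 2 n |arcsin (s / r)|) ds = 4 n r` over `|s| < r`, twice the length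
of `n` diameters. Nonnegativity of the majorant lets the subtracted gain survive `ENNReal.ofReal`.
-/
theorem lintegral_lineCount_le {n : ℕ} (hn : n ≠ 0) {κ r σ γ : ℝ} (hκ : 0 ≤ κ) (hr : 0 < r)
    (hσ : 0 ≤ σ) (hσr : σ < r) {G : Set ℝ} (hG : MeasurableSet G)
    (hγ : γ ≤ (volume (G ∩ Ioc 0 Real.pi)).toReal)
    (hpos : ∀ φ s, s ∈ Ioo (-r) r → 0 ≤ lineCount n κ r σ G φ s) :
    ∫⁻ φ in Ioc 0 Real.pi, ∫⁻ s in Ioo (-r) r, ENNReal.ofReal (lineCount n κ r σ G φ s) ≤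
      ENNReal.ofReal (4 * n * r + 12 * n * (n + 1) * Real.pi * κ * r - 2 * σ * γ) := by
  have hm := measurable_lineCount n κ r σ hG
  rw [lintegral_lintegral_swap hm.ennreal_ofReal.aemeasurable]
  set b : ℝ → ℝ := fun s => n * Real.pi - 2 * n * |Real.arcsin (s / r)|
    + 6 * n * (n + 1) * (Real.pi * κ) - γ * (Icc (-σ) σ).indicator 1 s with hb
  have h1 : ∀ s ∈ Ioo (-r) r, ∫⁻ φ in Ioc 0 Real.pi, ENNReal.ofReal (lineCount n κ r σ G φ s) ≤
      ENNReal.ofReal (b s) ∧ 0 ≤ b s := by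
    intro s hs
    obtain ⟨hi, hle⟩ := integral_lineCount_le (r := r) (σ := σ) hn hκ hG hγ s
    have h0 : 0 ≤ ∫ φ in (0 : ℝ)..Real.pi, lineCount n κ r σ G φ s :=
      intervalIntegral.integral_nonneg Real.pi_pos.le fun φ _ => hpos φ s hs
    refine ⟨?_, h0.trans hle⟩
    rw [← ofReal_integral_eq_lintegral_ofReal hi.1 (ae_of_all _ fun φ => hpos φ s hs),
      ← intervalIntegral.integral_of_le Real.pi_pos.le]
    exact ENNReal.ofReal_le_ofReal hle
  refine (setLIntegral_mono_ae' measurableSet_Ioo (ae_of_all _ fun s hs => (h1 s hs).1)).trans ?_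
  have c1 : IntervalIntegrable (fun s => n * Real.pi - 2 * n * |Real.arcsin (s / r)|
      + 6 * n * (n + 1) * (Real.pi * κ)) volume (-r) r := by
    refine Continuous.intervalIntegrable ?_ _ _
    have : Continuous fun s => Real.arcsin (s / r) := Real.continuous_arcsin.comp (by fun_prop)
    fun_prop
  have c2 : IntervalIntegrable (fun s => (Icc (-σ) σ).indicator (1 : ℝ → ℝ) s) volume (-r) r := by
    rw [intervalIntegrable_iff]
    exact (integrableOn_const (by simp)).indicator measurableSet_Icc
  have hbi : IntervalIntegrable b volume (-r) r := c1.sub (c2.const_mul γ)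
  have hle : -r ≤ r := by linarith
  have hio : IntegrableOn b (Ioo (-r) r) := hbi.1.mono_set Ioo_subset_Ioc_self
  rw [← ofReal_integral_eq_lintegral_ofReal hio
    ((ae_restrict_iff' measurableSet_Ioo).2 (ae_of_all _ fun s hs => (h1 s hs).2)),
    ← integral_Ioc_eq_integral_Ioo, ← intervalIntegral.integral_of_le hle]
  refine ENNReal.ofReal_le_ofReal (le_of_eq ?_)
  have c3 : Continuous fun s => |Real.arcsin (s / r)| :=
    (Real.continuous_arcsin.comp (by fun_prop)).abs
  have c4 : IntervalIntegrable (fun s => 2 * n * |Real.arcsin (s / r)|) volume (-r) r :=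
    (c3.const_mul _).intervalIntegrable _ _
  have d2 : ∫ s in (-r)..r, (Icc (-σ) σ).indicator (1 : ℝ → ℝ) s = 2 * σ := by
    rw [intervalIntegral.integral_of_le hle, integral_indicator_one measurableSet_Icc, Measure.real,
      Measure.restrict_apply measurableSet_Icc, inter_eq_left.2, Real.volume_Icc,
      ENNReal.toReal_ofReal (by linarith)]
    · ring
    · exact fun s hs => ⟨by linarith [hs.1], by linarith [hs.2]⟩
  have d3 : ∫ s in (-r)..r, 2 * n * |Real.arcsin (s / r)| = 2 * n * (r * (Real.pi - 2)) := by
    rw [intervalIntegral.integral_const_mul, integral_abs_arcsin_div hr]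
  rw [hb, intervalIntegral.integral_sub c1 (c2.const_mul γ), intervalIntegral.integral_const_mul,
    d2, intervalIntegral.integral_add ((intervalIntegrable_const).sub c4) intervalIntegrable_const,
    intervalIntegral.integral_sub intervalIntegrable_const c4, d3]
  simp
  ring

/-! ### Measure of the favourable directions -/

theorem integral_cos_two_mul_add {M : ℕ} (hM : M ≠ 0) (β : ℝ) :
    ∫ φ in (0 : ℝ)..Real.pi, Real.cos (2 * M * φ + β) = 0 := by
  have hM' : (2 * M : ℝ) ≠ 0 := by positivity
  rw [intervalIntegral.integral_comp_mul_add (fun x => Real.cos x) hM', integral_cos]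
  have : Real.sin (2 * M * Real.pi + β) = Real.sin β := by
    rw [show 2 * M * Real.pi + β = β + M * (2 * Real.pi) by ring, Real.sin_add_nat_mul_two_pi]
  rw [this]; simp

/-- Expanded into cosines of `φ`, the square has constant term `1 / 4`, and nonzero frequencies
average to zero. For `m = 0` the frequency `2 m` is constant too, and the condition on `β` keeps its
contribution positive. -/
theorem pi_div_four_le_integral_sq {n m : ℕ} (hmn : m < n) (β : ℝ)
    (hβ : m = 0 → Real.cos (2 * β) = 1) :
    Real.pi / 4 ≤ ∫ φ in (0 : ℝ)..Real.pi, (Real.cos (n * φ) * Real.cos (m * φ + β)) ^ 2 := by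
  have hid : ∀ φ : ℝ, (Real.cos (n * φ) * Real.cos (m * φ + β)) ^ 2 =
      1 / 4 * (1 + Real.cos (2 * n * φ + 0) + Real.cos (2 * m * φ + 2 * β)
      + 1 / 2 * (Real.cos (2 * (n + m : ℕ) * φ + 2 * β)
        + Real.cos (2 * (n - m : ℕ) * φ + -(2 * β)))) := by
    intro φ
    have h1 : Real.cos (2 * (n + m : ℕ) * φ + 2 * β) =
        Real.cos (2 * (n * φ) + 2 * (m * φ + β)) := by congr 1; push_cast; ring
    have h2 : Real.cos (2 * (n - m : ℕ) * φ + -(2 * β)) =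
        Real.cos (2 * (n * φ) - 2 * (m * φ + β)) := by
      congr 1; push_cast [Nat.cast_sub hmn.le]; ring
    have h3 : Real.cos (2 * n * φ + 0) = Real.cos (2 * (n * φ)) := by congr 1; ring
    have h4 : Real.cos (2 * m * φ + 2 * β) = Real.cos (2 * (m * φ + β)) := by congr 1; ring
    rw [h1, h2, h3, h4]
    generalize (n : ℝ) * φ = x
    generalize (m : ℝ) * φ + β = y
    rw [Real.cos_add, Real.cos_sub, Real.cos_two_mul, Real.cos_two_mul]
    ring
  have hc : ∀ c b : ℝ, IntervalIntegrable (fun φ => Real.cos (2 * c * φ + b)) volume 0 Real.pi :=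
    fun c b => (by fun_prop : Continuous fun φ => Real.cos (2 * c * φ + b)).intervalIntegrable _ _
  have h1 : IntervalIntegrable (fun _ : ℝ => (1 : ℝ)) volume 0 Real.pi := by simp
  simp_rw [hid]
  rw [intervalIntegral.integral_const_mul,
    intervalIntegral.integral_add ((h1.add (hc _ _)).add (hc _ _))
      (((hc _ _).add (hc _ _)).const_mul _),
    intervalIntegral.integral_add (h1.add (hc _ _)) (hc _ _),
    intervalIntegral.integral_add h1 (hc _ _), intervalIntegral.integral_const_mul,
    intervalIntegral.integral_add (hc _ _) (hc _ _),
    integral_cos_two_mul_add (by omega), integral_cos_two_mul_add (M := n + m) (by omega),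
    integral_cos_two_mul_add (M := n - m) (by omega)]
  rcases Nat.eq_zero_or_pos m with rfl | hm
  · have hpi := Real.pi_pos
    simp [hβ rfl]; linarith
  · rw [integral_cos_two_mul_add hm.ne']
    simp; linarith

theorem integral_le_of_le_indicator {g : ℝ → ℝ} (hg : Continuous g) {S : Set ℝ}
    (hS : MeasurableSet S) {C c : ℝ} (h : ∀ x, g x ≤ C * S.indicator 1 x + c) :
    ∫ φ in (0 : ℝ)..Real.pi, g φ ≤ C * (volume (S ∩ Ioc 0 Real.pi)).toReal + c * Real.pi := by
  have i3 : IntervalIntegrable (fun φ => S.indicator (1 : ℝ → ℝ) φ) volume 0 Real.pi := by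
    rw [intervalIntegrable_iff]
    exact (integrableOn_const (by simp)).indicator hS
  have hc : IntervalIntegrable (fun _ : ℝ => c) volume 0 Real.pi := by simp
  have h1 := intervalIntegral.integral_mono_on Real.pi_pos.le (hg.intervalIntegrable _ _)
    ((i3.const_mul C).add hc) fun x _ => h x
  rw [intervalIntegral.integral_add (i3.const_mul C) hc, intervalIntegral.integral_const_mul,
    intervalIntegral.integral_of_le (f := S.indicator 1) Real.pi_pos.le, integral_indicator_one hS,
    Measure.real, Measure.restrict_apply hS] at h1
  refine h1.trans (le_of_eq ?_)
  simp; ring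

/-- A function bounded by `1` whose mean square is at least `1 / 4` cannot be small in most
directions. -/
theorem volume_abs_cos_mul_cos {n m : ℕ} (hmn : m < n) (β : ℝ)
    (hβ : m = 0 → Real.cos (2 * β) = 1) :
    Real.pi / 16 ≤ (volume ({φ | 1 / 16 ≤ |Real.cos (n * φ) * Real.cos (m * φ + β)|} ∩
      Ioc 0 Real.pi)).toReal := by
  have h1 := pi_div_four_le_integral_sq hmn β hβ
  have h2 := integral_le_of_le_indicator
    (g := fun φ => (Real.cos (n * φ) * Real.cos (m * φ + β)) ^ 2) (by fun_prop)
    (S := {φ | 1 / 16 ≤ |Real.cos (n * φ) * Real.cos (m * φ + β)|})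
    (measurableSet_le (by fun_prop) (by fun_prop)) (C := 1) (c := 1 / 256) (by
      intro x
      have hle : |Real.cos (n * x) * Real.cos (m * x + β)| ≤ 1 := by
        rw [abs_mul]
        exact mul_le_one₀ (Real.abs_cos_le_one _) (abs_nonneg _) (Real.abs_cos_le_one _)
      rw [← sq_abs]
      by_cases hx : 1 / 16 ≤ |Real.cos (n * x) * Real.cos (m * x + β)|
      · rw [indicator_of_mem (by exact hx)]
        simp only [Pi.one_apply]
        nlinarith [abs_nonneg (Real.cos (n * x) * Real.cos (m * x + β))]
      · rw [indicator_of_notMem (by exact hx)]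
        push Not at hx
        nlinarith [abs_nonneg (Real.cos (n * x) * Real.cos (m * x + β))])
  linarith [Real.pi_pos]

/-- The one-sided bound serves the case `k = 2`, where the sign matters. The product `x` has mean
zero, so adding it to the square leaves the integral unchanged, while `x ^ 2 + x` is at most `2`,
and at most `1 / 8` where `x < 1 / 16`. -/
theorem volume_cos_mul_cos {n m : ℕ} (hmn : m + 2 = n) (β : ℝ)
    (hβ : m = 0 → Real.cos (2 * β) = 1) :
    Real.pi / 16 ≤ (volume ({φ | 1 / 16 ≤ Real.cos (n * φ) * Real.cos (m * φ + β)} ∩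
      Ioc 0 Real.pi)).toReal := by
  have h1 := pi_div_four_le_integral_sq (by omega : m < n) β hβ
  have h0 : ∫ φ in (0 : ℝ)..Real.pi, Real.cos (n * φ) * Real.cos (m * φ + β) = 0 := by
    have hid : ∀ φ : ℝ, Real.cos (n * φ) * Real.cos (m * φ + β) =
        1 / 2 * (Real.cos (2 * (m + 1 : ℕ) * φ + β) + Real.cos (2 * (1 : ℕ) * φ + -β)) := by
      intro φ
      have e1 : Real.cos (2 * (m + 1 : ℕ) * φ + β) = Real.cos (n * φ + (m * φ + β)) := by
        congr 1; rw [← hmn]; push_cast; ring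
      have e2 : Real.cos (2 * (1 : ℕ) * φ + -β) = Real.cos (n * φ - (m * φ + β)) := by
        congr 1; rw [← hmn]; push_cast; ring
      rw [e1, e2, Real.cos_add (n * φ), Real.cos_sub]; ring
    have hc : ∀ c b : ℝ, IntervalIntegrable (fun φ => Real.cos (2 * c * φ + b)) volume 0 Real.pi :=
      fun c b => (by fun_prop : Continuous fun φ => Real.cos (2 * c * φ + b)).intervalIntegrable _ _
    simp_rw [hid]
    rw [intervalIntegral.integral_const_mul, intervalIntegral.integral_add (hc _ _) (hc _ _),
      integral_cos_two_mul_add (by omega), integral_cos_two_mul_add (by omega)]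
    simp
  have h2 := integral_le_of_le_indicator
    (g := fun φ => (Real.cos (n * φ) * Real.cos (m * φ + β)) ^ 2
      + Real.cos (n * φ) * Real.cos (m * φ + β)) (by fun_prop)
    (S := {φ | 1 / 16 ≤ Real.cos (n * φ) * Real.cos (m * φ + β)})
    (measurableSet_le (by fun_prop) (by fun_prop)) (C := 2) (c := 1 / 8) (by
      intro x
      have hle : |Real.cos (n * x) * Real.cos (m * x + β)| ≤ 1 := by
        rw [abs_mul]
        exact mul_le_one₀ (Real.abs_cos_le_one _) (abs_nonneg _) (Real.abs_cos_le_one _)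
      rw [abs_le] at hle
      by_cases hx : 1 / 16 ≤ Real.cos (n * x) * Real.cos (m * x + β)
      · rw [indicator_of_mem (by exact hx)]
        simp only [Pi.one_apply]
        nlinarith
      · rw [indicator_of_notMem (by exact hx)]
        push Not at hx
        nlinarith)
  rw [intervalIntegral.integral_add, h0] at h2
  · linarith [Real.pi_pos]
  · exact (by fun_prop : Continuous fun φ =>
      (Real.cos (n * φ) * Real.cos (m * φ + β)) ^ 2).intervalIntegrable _ _
  · exact (by fun_prop : Continuous fun φ =>
      Real.cos (n * φ) * Real.cos (m * φ + β)).intervalIntegrable _ _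

/-! ### The function `Re (-log (1 - q))` along a line -/

/-- The polynomial `z ^ n + ∑ a_k z ^ (n - k)`, which is `perturbedPoly n a + 1`. -/
noncomputable def liftedPoly (n : ℕ) (a : ℕ → ℂ) : Polynomial ℂ :=
  Polynomial.X ^ n + ∑ k ∈ Finset.Icc 2 n, Polynomial.C (a k) * Polynomial.X ^ (n - k)

theorem perturbedPoly_eq (n : ℕ) (a : ℕ → ℂ) : perturbedPoly n a = liftedPoly n a - 1 := by
  unfold perturbedPoly liftedPoly extremalPoly; ring

theorem eval_iterate_derivative_liftedPoly (n : ℕ) (a : ℕ → ℂ) (j : ℕ) (z : ℂ) :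
    (Polynomial.derivative^[j] (liftedPoly n a)).eval z = n.descFactorial j * z ^ (n - j)
      + ∑ k ∈ Finset.Icc 2 n, a k * ((n - k).descFactorial j * z ^ (n - k - j)) := by
  unfold liftedPoly
  rw [iterate_map_add, Polynomial.iterate_derivative_sum,
    Polynomial.eval_add, Polynomial.eval_finsetSum]
  simp only [Polynomial.iterate_derivative_C_mul, Polynomial.iterate_derivative_X_pow_eq_smul]
  simp only [Polynomial.eval_smul, Polynomial.eval_pow, Polynomial.eval_X, Polynomial.eval_mul,
    Polynomial.eval_C, smul_eq_mul]

theorem norm_eval_liftedPoly_le {n : ℕ} {a : ℕ → ℂ} {r : ℝ}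
    (ha : ∀ k ∈ Finset.Icc 2 n, ‖a k‖ ≤ r ^ k) (hn : 1 ≤ n) (hr : 0 < r) {z : ℂ}
    (hz : ‖z‖ ≤ 2 * r) : ‖(liftedPoly n a).eval z‖ ≤ n * (2 * r) ^ n := by
  have h := eval_iterate_derivative_liftedPoly n a 0 z
  simp only [Function.iterate_zero, id, Nat.descFactorial_zero, Nat.cast_one, one_mul,
    tsub_zero] at h
  rw [h]
  have h1 : ∀ k ∈ Finset.Icc 2 n, ‖a k * z ^ (n - k)‖ ≤ (2 * r) ^ n := by
    intro k hk
    rw [norm_mul, norm_pow]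
    calc ‖a k‖ * ‖z‖ ^ (n - k) ≤ (2 * r) ^ k * (2 * r) ^ (n - k) := by
          gcongr
          exact (ha k hk).trans (by gcongr; linarith)
      _ = _ := by rw [← pow_add]; congr 1; have := (Finset.mem_Icc.1 hk).2; omega
  calc _ ≤ ‖z ^ n‖ + ∑ k ∈ Finset.Icc 2 n, ‖a k * z ^ (n - k)‖ :=
        (norm_add_le _ _).trans (by gcongr; exact norm_sum_le _ _)
    _ ≤ (2 * r) ^ n + ∑ k ∈ Finset.Icc 2 n, (2 * r) ^ n := by
        gcongr with k hk
        · rw [norm_pow]; gcongr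
        · exact h1 k hk
    _ = n * (2 * r) ^ n := by
        rw [Finset.sum_const, Nat.card_Icc, nsmul_eq_mul]
        rw [show n + 1 - 2 = n - 1 by omega, Nat.cast_sub hn]; push_cast; ring

/-- The difference between `-log (1 - q)` and its linear part `q`. -/
noncomputable def logRemainder (n : ℕ) (a : ℕ → ℂ) (z : ℂ) : ℂ :=
  -(Complex.log (1 + -(liftedPoly n a).eval z) - -(liftedPoly n a).eval z)

theorem norm_logRemainder_le {n : ℕ} {a : ℕ → ℂ} {r : ℝ}
    (ha : ∀ k ∈ Finset.Icc 2 n, ‖a k‖ ≤ r ^ k) (hn : 1 ≤ n) (hr : 0 < r)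
    (hs : n * (2 * r) ^ n ≤ 1 / 2) {z : ℂ} (hz : ‖z‖ ≤ 2 * r) :
    ‖logRemainder n a z‖ ≤ (n * (2 * r) ^ n) ^ 2 := by
  have h1 := norm_eval_liftedPoly_le ha hn hr hz
  set w := (liftedPoly n a).eval z with hw
  have h2 : ‖w‖ ≤ 1 / 2 := h1.trans hs
  have h3 := Complex.norm_log_one_add_sub_self_le (z := -w) (by rw [norm_neg]; linarith)
  rw [norm_neg] at h3
  unfold logRemainder
  rw [norm_neg]
  refine h3.trans ?_
  have h4 : (1 - ‖w‖)⁻¹ ≤ 2 := by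
    rw [inv_le_comm₀ (by linarith) (by norm_num)]; linarith
  calc ‖w‖ ^ 2 * (1 - ‖w‖)⁻¹ / 2 ≤ ‖w‖ ^ 2 * 2 / 2 := by gcongr
    _ = ‖w‖ ^ 2 := by ring
    _ ≤ _ := by gcongr

theorem differentiableOn_logRemainder {n : ℕ} {a : ℕ → ℂ} {r : ℝ}
    (ha : ∀ k ∈ Finset.Icc 2 n, ‖a k‖ ≤ r ^ k) (hn : 1 ≤ n) (hr : 0 < r)
    (hs : n * (2 * r) ^ n ≤ 1 / 2) :
    DifferentiableOn ℂ (logRemainder n a) (Metric.ball 0 (2 * r)) := by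
  intro z hz
  have hz' : ‖z‖ < 2 * r := by simpa using hz
  have h1 := norm_eval_liftedPoly_le ha hn hr hz'.le
  have h2 : 1 + -(liftedPoly n a).eval z ∈ Complex.slitPlane :=
    Complex.mem_slitPlane_of_norm_lt_one (by rw [norm_neg]; linarith)
  have hd : DifferentiableAt ℂ (fun z => (liftedPoly n a).eval z) z :=
    (liftedPoly n a).differentiable z
  exact ((((hd.neg.const_add 1).clog h2).sub hd.neg).neg).differentiableWithinAt

theorem hasDerivAt_iteratedDeriv_logRemainder {n : ℕ} {a : ℕ → ℂ} {r : ℝ}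
    (ha : ∀ k ∈ Finset.Icc 2 n, ‖a k‖ ≤ r ^ k) (hn : 1 ≤ n) (hr : 0 < r)
    (hs : n * (2 * r) ^ n ≤ 1 / 2) (j : ℕ) {z : ℂ} (hz : ‖z‖ < 2 * r) :
    HasDerivAt (iteratedDeriv j (logRemainder n a)) (iteratedDeriv (j + 1) (logRemainder n a) z)
      z := by
  have hA : AnalyticAt ℂ (logRemainder n a) z :=
    (differentiableOn_logRemainder ha hn hr hs).analyticAt
      (Metric.isOpen_ball.mem_nhds (by simpa using hz))
  rw [iteratedDeriv_succ]
  have := hA.iterated_deriv j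
  rw [← iteratedDeriv_eq_iterate] at this
  exact this.differentiableAt.hasDerivAt

/-- A constant bounding the derivatives of the logarithmic remainder. -/
noncomputable def remainderConst (n : ℕ) : ℝ := n.factorial * 2 ^ n * (n * 2 ^ n) ^ 2

theorem remainderConst_nonneg (n : ℕ) : 0 ≤ remainderConst n := by
  unfold remainderConst; positivity

/-- The remainder is quadratic in `q`, hence of size `r ^ (2 n)` on `|z| ≤ 2 r`; Cauchy's estimates
on discs of radius `r / 2` cost `r ^ (-j)`. Relative to the main term `r ^ (n - j)` this is smaller
by `r ^ n`. -/
theorem norm_iteratedDeriv_logRemainder_le {n : ℕ} {a : ℕ → ℂ} {r : ℝ}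
    (ha : ∀ k ∈ Finset.Icc 2 n, ‖a k‖ ≤ r ^ k) (hn : 1 ≤ n) (hr : 0 < r)
    (hs : n * (2 * r) ^ n ≤ 1 / 2) {j : ℕ} (hj : j ≤ n) {z : ℂ} (hz : ‖z‖ ≤ r) :
    ‖iteratedDeriv j (logRemainder n a) z‖ ≤ remainderConst n * r ^ n * r ^ (n - j) := by
  have hcl : Metric.closedBall z (r / 2) ⊆ Metric.ball 0 (2 * r) := by
    intro w hw
    have h1 : ‖w - z‖ ≤ r / 2 := by simpa [dist_eq_norm] using hw
    have h2 : ‖w‖ ≤ ‖w - z‖ + ‖z‖ := by simpa using norm_add_le (w - z) z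
    simp only [Metric.mem_ball, dist_zero_right]
    linarith
  have h := Complex.norm_iteratedDeriv_le_of_forall_mem_sphere_norm_le (f := logRemainder n a)
    (c := z) (R := r / 2) (C := (n * (2 * r) ^ n) ^ 2) j (by positivity)
    (DifferentiableOn.diffContOnCl ((differentiableOn_logRemainder ha hn hr hs).mono (by
      rw [closure_ball _ (by positivity : r / 2 ≠ 0)]; exact hcl)))
    (fun w hw => norm_logRemainder_le ha hn hr hs (by
      have := hcl (Metric.sphere_subset_closedBall hw)
      simp only [Metric.mem_ball, dist_zero_right] at this
      exact this.le))
  refine h.trans ?_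
  have e1 : (j.factorial : ℝ) ≤ n.factorial := by exact_mod_cast Nat.factorial_le hj
  have e2 : (2 : ℝ) ^ j ≤ 2 ^ n := pow_le_pow_right₀ (by norm_num) hj
  have e3 : r ^ n = r ^ (n - j) * r ^ j := by rw [← pow_add, Nat.sub_add_cancel hj]
  rw [div_pow, div_div_eq_mul_div, div_le_iff₀ (by positivity)]
  calc (j.factorial : ℝ) * (n * (2 * r) ^ n) ^ 2 * 2 ^ j
      ≤ n.factorial * (n * (2 * r) ^ n) ^ 2 * 2 ^ n := by gcongr
    _ = remainderConst n * r ^ n * r ^ n := by unfold remainderConst; rw [mul_pow]; ring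
    _ = remainderConst n * r ^ n * r ^ (n - j) * r ^ j := by rw [mul_assoc _ _ (r ^ j), ← e3]

/-- The `j`-th derivative of `t ↦ Re (-log (1 - q))` along the line of direction `φ` at signed
distance `s` from the origin. -/
noncomputable def lineDerivs (n : ℕ) (a : ℕ → ℂ) (φ s : ℝ) (j : ℕ) (t : ℝ) : ℝ :=
  (Complex.exp (φ * Complex.I) ^ j *
    ((Polynomial.derivative^[j] (liftedPoly n a)).eval
        (Complex.exp (φ * Complex.I) * (t + s * Complex.I))
      + iteratedDeriv j (logRemainder n a) (Complex.exp (φ * Complex.I) * (t + s * Complex.I)))).re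

theorem norm_line (φ s t : ℝ) :
    ‖Complex.exp (φ * Complex.I) * (t + s * Complex.I)‖ = √(t ^ 2 + s ^ 2) := by
  rw [norm_mul, Complex.norm_exp_ofReal_mul_I, one_mul, Complex.norm_add_mul_I]

theorem hasDerivAt_lineDerivs {n : ℕ} {a : ℕ → ℂ} {r : ℝ}
    (ha : ∀ k ∈ Finset.Icc 2 n, ‖a k‖ ≤ r ^ k) (hn : 1 ≤ n) (hr : 0 < r)
    (hs : n * (2 * r) ^ n ≤ 1 / 2) (φ s : ℝ) (j : ℕ) {t : ℝ}
    (ht : ‖Complex.exp (φ * Complex.I) * (t + s * Complex.I)‖ ≤ r) :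
    HasDerivAt (lineDerivs n a φ s j) (lineDerivs n a φ s (j + 1) t) t := by
  set e := Complex.exp (φ * Complex.I) with he
  set q := Polynomial.derivative^[j] (liftedPoly n a) with hq
  have h1 := hasDerivAt_iteratedDeriv_logRemainder ha hn hr hs j
    (lt_of_le_of_lt ht (by linarith : r < 2 * r))
  have h2 : HasDerivAt (fun z => q.eval z) (q.derivative.eval (e * (t + s * Complex.I)))
    (e * (t + s * Complex.I)) := q.hasDerivAt _
  have h3 : HasDerivAt (fun τ : ℂ => e * (τ + s * Complex.I)) (e * 1) (t : ℂ) :=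
    (((hasDerivAt_id' (t : ℂ)).add_const _).const_mul e)
  have h4 := (((h2.add h1).comp (t : ℂ) h3).const_mul (e ^ j)).real_of_complex
  refine h4.congr_deriv ?_
  unfold lineDerivs
  rw [Function.iterate_succ_apply', ← he, ← hq]
  congr 1; ring

/-- On the lemniscate `|1 - q| = 1`, and the real part of the logarithm is `log |1 - q|`. -/
theorem lineDerivs_zero_of_mem {n : ℕ} {a : ℕ → ℂ} (φ s t : ℝ)
    (hmem : Complex.exp (φ * Complex.I) * (t + s * Complex.I) ∈ lemniscate (perturbedPoly n a)) :
    lineDerivs n a φ s 0 t = 0 := by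
  unfold lineDerivs
  set z := Complex.exp (φ * Complex.I) * (t + s * Complex.I) with hz
  have h1 : ‖(perturbedPoly n a).eval z‖ = 1 := hmem
  rw [perturbedPoly_eq, Polynomial.eval_sub, Polynomial.eval_one, norm_sub_rev] at h1
  simp only [pow_zero, one_mul, Function.iterate_zero, id, iteratedDeriv_zero, logRemainder]
  have : (liftedPoly n a).eval z + -(Complex.log (1 + -(liftedPoly n a).eval z)
      - -(liftedPoly n a).eval z) = -Complex.log (1 - (liftedPoly n a).eval z) := by
    rw [← sub_eq_add_neg 1]; ring
  rw [this, Complex.neg_re, Complex.log_re, h1, Real.log_one, neg_zero]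

theorem descFactorial_le_factorial (m j : ℕ) : m.descFactorial j ≤ m.factorial := by
  rcases lt_or_ge m j with h | h
  · rw [Nat.descFactorial_of_lt h]; exact Nat.zero_le _
  · rw [← Nat.factorial_mul_descFactorial h]
    exact Nat.le_mul_of_pos_left _ (Nat.factorial_pos _)

/-- Comparison with the derivatives of `Re z ^ n`. -/
theorem abs_lineDerivs_sub_le {n : ℕ} {a : ℕ → ℂ} {r A : ℝ} (hA : 0 ≤ A) (hAr : A ≤ r)
    (ha : ∀ k ∈ Finset.Icc 2 n, ‖a k‖ ≤ A ^ k) (hn : 1 ≤ n) (hr : 0 < r)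
    (hs : n * (2 * r) ^ n ≤ 1 / 2) (φ s : ℝ) {j : ℕ} (hj : j ≤ n) {t : ℝ}
    (ht : ‖Complex.exp (φ * Complex.I) * (t + s * Complex.I)‖ ≤ r) :
    |lineDerivs n a φ s j t - n.descFactorial j * (Complex.exp (φ * Complex.I) ^ n *
      (t + s * Complex.I) ^ (n - j)).re| ≤
      (n * n.factorial * (A / r) ^ 2 + remainderConst n * r ^ n) * r ^ (n - j) := by
  have ha' : ∀ k ∈ Finset.Icc 2 n, ‖a k‖ ≤ r ^ k := fun k hk =>
    (ha k hk).trans (by gcongr)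
  unfold lineDerivs
  set e := Complex.exp (φ * Complex.I) with he
  have hen : ‖e‖ = 1 := Complex.norm_exp_ofReal_mul_I φ
  set w : ℂ := t + s * Complex.I with hw
  have hE := norm_iteratedDeriv_logRemainder_le ha' hn hr hs hj ht
  have hpow : e ^ n * w ^ (n - j) = e ^ j * (e * w) ^ (n - j) := by
    rw [mul_pow, ← mul_assoc, ← pow_add, Nat.add_sub_cancel' hj]
  rw [eval_iterate_derivative_liftedPoly, hpow, ← Complex.re_ofReal_mul, ← Complex.sub_re]
  refine (Complex.abs_re_le_norm _).trans ?_
  have h1 : e ^ j * (n.descFactorial j * (e * w) ^ (n - j)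
      + ∑ k ∈ Finset.Icc 2 n, a k * ((n - k).descFactorial j * (e * w) ^ (n - k - j))
      + iteratedDeriv j (logRemainder n a) (e * w))
      - ((n.descFactorial j : ℝ) : ℂ) * (e ^ j * (e * w) ^ (n - j)) =
      e ^ j * (∑ k ∈ Finset.Icc 2 n, a k * ((n - k).descFactorial j * (e * w) ^ (n - k - j))
      + iteratedDeriv j (logRemainder n a) (e * w)) := by push_cast; ring
  rw [h1, norm_mul, norm_pow, hen, one_pow, one_mul, add_mul]
  refine (norm_add_le _ _).trans (add_le_add ?_ hE)
  refine (norm_sum_le _ _).trans ?_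
  have hterm : ∀ k ∈ Finset.Icc 2 n,
      ‖a k * ((n - k).descFactorial j * (e * w) ^ (n - k - j))‖ ≤
      n.factorial * (A / r) ^ 2 * r ^ (n - j) := by
    intro k hk
    have hk' := Finset.mem_Icc.1 hk
    rcases lt_or_ge (n - k) j with hlt | hle
    · rw [Nat.descFactorial_of_lt hlt]
      simp only [Nat.cast_zero, zero_mul, mul_zero, norm_zero]
      positivity
    · rw [norm_mul, norm_mul, norm_pow, Complex.norm_natCast]
      have hdf : ((n - k).descFactorial j : ℝ) ≤ n.factorial := by
        exact_mod_cast (descFactorial_le_factorial _ _).trans (Nat.factorial_le (by omega))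
      -- The square comes from `k ≥ 2`: because `z ^ (n - 1)` is absent, the relative error is
      -- quadratic in `A / r`.
      have hAk : A ^ k ≤ (A / r) ^ 2 * r ^ k := by
        rw [div_pow]
        have : r ^ k = r ^ 2 * r ^ (k - 2) := by rw [← pow_add]; congr 1; omega
        rw [this, div_mul_eq_mul_div, le_div_iff₀ (by positivity)]
        have h2 : A ^ k = A ^ 2 * A ^ (k - 2) := by rw [← pow_add]; congr 1; omega
        rw [h2]
        have h3 : A ^ (k - 2) ≤ r ^ (k - 2) := by gcongr
        nlinarith [mul_le_mul_of_nonneg_left h3 (by positivity : 0 ≤ A ^ 2 * r ^ 2)]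
      calc ‖a k‖ * ((n - k).descFactorial j * ‖e * w‖ ^ (n - k - j))
          ≤ ((A / r) ^ 2 * r ^ k) * (n.factorial * r ^ (n - k - j)) := by
            gcongr
            exact (ha k hk).trans hAk
        _ = n.factorial * (A / r) ^ 2 * (r ^ k * r ^ (n - k - j)) := by ring
        _ = _ := by rw [← pow_add]; congr 2; omega
  refine (Finset.sum_le_sum hterm).trans ?_
  rw [Finset.sum_const, Nat.card_Icc, nsmul_eq_mul]
  have : ((n + 1 - 2 : ℕ) : ℝ) ≤ n := by exact_mod_cast (by omega : n + 1 - 2 ≤ n)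
  calc ((n + 1 - 2 : ℕ) : ℝ) * (n.factorial * (A / r) ^ 2 * r ^ (n - j))
      ≤ n * (n.factorial * (A / r) ^ 2 * r ^ (n - j)) := by gcongr
    _ = _ := by ring

/-! ### Zeros on a chord: the generic count and the gain -/

theorem mul_pos_of_abs_sub_le {y c u κ : ℝ} (hc : 0 < c) (h : |y - c * u| ≤ κ * c)
    (hu : κ < |u|) : 0 < y * u := by
  rw [abs_le] at h
  rcases lt_abs.1 hu with h1 | h1
  · have hu0 : 0 < u ∨ u ≤ 0 := lt_or_ge 0 u
    rcases hu0 with hu0 | hu0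
    · exact mul_pos (by nlinarith) hu0
    · exfalso
      have := h.1.trans h.2
      nlinarith [abs_of_nonpos hu0]
  · have hu0 : 0 < -u ∨ -u ≤ 0 := lt_or_ge 0 (-u)
    rcases hu0 with hu0 | hu0
    · have : y < 0 := by nlinarith
      nlinarith
    · exfalso
      have := h.1.trans h.2
      nlinarith

theorem mul_neg_iff_of_mul_pos {x y u v : ℝ} (h1 : 0 < x * u) (h2 : 0 < y * v) :
    x * y < 0 ↔ u * v < 0 := by
  have h : 0 < (x * y) * (u * v) := by nlinarith [mul_pos h1 h2]
  constructor
  · intro h3; by_contra! h4; nlinarith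
  · intro h3; by_contra! h4; nlinarith

/-- Sign-change count for functions whose derivatives at the ends of the chord behave as those
of `Re z ^ n`. -/
theorem card_zeros_le_of_cos {f : ℕ → ℝ → ℝ} {n : ℕ} {b x ψ κ : ℝ} (hb : 0 < b)
    (hf : ∀ k, ∀ t ∈ Icc (-b) b, HasDerivAt (f k) (f (k + 1) t) t) (c : ℕ → ℝ)
    (hc : ∀ j ≤ n, 0 < c j)
    (hB : ∀ j ≤ n, |f j b - c j * Real.cos (x + (n - j : ℕ) * ψ)| ≤ κ * c j)
    (hA : ∀ j ≤ n, |f j (-b) - c j * ((-1) ^ (n - j) * Real.cos (x + -((n - j : ℕ) * ψ)))| ≤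
      κ * c j)
    (hn : ∀ t ∈ Ioo (-b) b, |f n t - c n * Real.cos x| ≤ κ * c n)
    (hgood : ∀ m ≤ n, κ < |Real.cos (x + m * ψ)| ∧ κ < |Real.cos (x + -(m * ψ))|)
    (T : Finset ℝ) (hT : ∀ t ∈ T, t ∈ Ioo (-b) b ∧ f 0 t = 0) :
    (T.card : ℝ) ≤ n - ∑ m ∈ Finset.range n, (cosSignChange ψ (x + m * ψ)
      + cosSignChange (-ψ) (x + -(m * ψ))) := by
  classical
  have sB : ∀ j ≤ n, 0 < f j b * Real.cos (x + (n - j : ℕ) * ψ) := fun j hj =>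
    mul_pos_of_abs_sub_le (hc j hj) (hB j hj) (hgood _ (by omega)).1
  have sA : ∀ j ≤ n, 0 < f j (-b) * ((-1) ^ (n - j) * Real.cos (x + -((n - j : ℕ) * ψ))) :=
    fun j hj => mul_pos_of_abs_sub_le (hc j hj) (hA j hj) (by
      rw [abs_mul, abs_pow, abs_neg, abs_one, one_pow, one_mul]
      exact (hgood _ (by omega)).2)
  have h := card_zeros_le_sign_changes (by linarith : -b < b) n hf
    (fun k hk => left_ne_zero_of_mul (sA k hk).ne') (fun k hk => left_ne_zero_of_mul (sB k hk).ne')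
    (fun t ht h0 => by
      have := mul_pos_of_abs_sub_le (hc n le_rfl) (hn t ht) (by simpa using (hgood 0 (by omega)).1)
      rw [h0, zero_mul] at this; exact this.false) T hT
  have h' : (T.card : ℝ) ≤ ∑ k ∈ Finset.range n,
      ((if f k (-b) * f (k + 1) (-b) < 0 then (1 : ℝ) else 0)
        - (if f k b * f (k + 1) b < 0 then 1 else 0)) := by
    have : ((T.card : ℤ) : ℝ) ≤ ((∑ k ∈ Finset.range n,
      ((if f k (-b) * f (k + 1) (-b) < 0 then (1 : ℤ) else 0)
        - (if f k b * f (k + 1) b < 0 then 1 else 0)) : ℤ) : ℝ) := Int.cast_le.2 h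
    push_cast at this
    exact this
  refine h'.trans (le_of_eq ?_)
  -- The order of derivation `k` corresponds to the power `n - k` of the chord end, so the sum is
  -- reversed before comparing term by term.
  rw [← Finset.sum_range_reflect (fun m : ℕ => cosSignChange ψ (x + m * ψ)
      + cosSignChange (-ψ) (x + -(m * ψ)))]
  have hcard : (n : ℝ) = ∑ _k ∈ Finset.range n, (1 : ℝ) := by simp
  rw [hcard]
  rw [← Finset.sum_sub_distrib]
  refine Finset.sum_congr rfl fun k hk => ?_
  have hk' := Finset.mem_range.1 hk
  obtain ⟨m, hm⟩ : ∃ m, n - 1 - k = m := ⟨_, rfl⟩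
  have hm1 : n - k = m + 1 := by omega
  have hm2 : n - (k + 1) = m := by omega
  have b1 := sB k hk'.le
  have b2 := sB (k + 1) (by omega)
  have a1 := sA k hk'.le
  have a2 := sA (k + 1) (by omega)
  rw [hm1] at b1 a1
  rw [hm2] at b2 a2
  rw [hm]
  have eB : (if f k b * f (k + 1) b < 0 then (1 : ℝ) else 0) = cosSignChange ψ (x + m * ψ) := by
    unfold cosSignChange
    have e : x + m * ψ + ψ = x + (m + 1 : ℕ) * ψ := by push_cast; ring
    rw [e, mul_comm (Real.cos _)]
    exact if_congr (mul_neg_iff_of_mul_pos b1 b2) rfl rfl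
  -- The factor `(-1) ^ (n - k)` flips between consecutive derivatives at the left end, so a sign
  -- change there means no sign change of the cosine.
  have eA : (if f k (-b) * f (k + 1) (-b) < 0 then (1 : ℝ) else 0) =
      1 - cosSignChange (-ψ) (x + -(m * ψ)) := by
    unfold cosSignChange
    have e : x + -(m * ψ) + -ψ = x + -((m + 1 : ℕ) * ψ) := by push_cast; ring
    rw [e]
    have hiff := mul_neg_iff_of_mul_pos a1 a2
    set u := Real.cos (x + -((m + 1 : ℕ) * ψ))
    set v := Real.cos (x + -(m * ψ))
    have hu : (-1 : ℝ) ^ (m + 1) * u * ((-1) ^ m * v) = -(v * u) := by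
      have : ((-1 : ℝ) ^ m) * (-1) ^ m = 1 := by rw [← mul_pow]; norm_num
      rw [pow_succ]
      linear_combination (-(u * v)) * this
    rw [hu] at hiff
    have hne : v * u ≠ 0 := mul_ne_zero
      (right_ne_zero_of_mul (right_ne_zero_of_mul a2.ne'))
      (right_ne_zero_of_mul (right_ne_zero_of_mul a1.ne'))
    by_cases hvu : v * u < 0
    · rw [if_pos hvu, if_neg (by rw [hiff]; linarith)]; norm_num
    · rw [if_neg hvu, if_pos (by
        rw [hiff]
        have := lt_of_le_of_ne (not_lt.1 hvu) hne.symm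
        linarith)]; norm_num
  rw [eA, eB]; ring

set_option maxHeartbeats 1000000 in
/-- If some derivative of `f 0` behaves like `D c t ^ k + d` with `d ≠ 0`, then `f 0` has fewer
than `n` zeros. -/
theorem card_zeros_lt_of_dominant {n k : ℕ} (hk2 : 2 ≤ k) (hkn : k ≤ n) {η : ℝ} (hη : 0 < η) :
    ∃ δ₀ : ℝ, 0 < δ₀ ∧ ∀ (f : ℕ → ℝ → ℝ) (I : Set ℝ), I.OrdConnected →
      (∀ j, ∀ t ∈ I, HasDerivAt (f j) (f (j + 1) t) t) → ∀ A c d D : ℝ, 0 < A → 1 ≤ D →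
      D ≤ n.factorial → 1 / 16 ≤ |c| → |c| ≤ 1 → η * A ^ k ≤ |d| → (k = 2 → 0 < c * d) →
      (∀ t ∈ I, |f (n - k) t - (D * c * t ^ k + d)| ≤ δ₀ * (A + |t|) ^ k) →
      (∀ t ∈ I, |f (n - k + 1) t - k * D * c * t ^ (k - 1)| ≤ δ₀ * (A + |t|) ^ (k - 1)) →
      ∀ T : Finset ℝ, (∀ t ∈ T, t ∈ I ∧ f 0 t = 0) → T.card < n := by
  have hfac : (1 : ℝ) ≤ n.factorial := by exact_mod_cast Nat.factorial_pos n
  -- For `|t| ≤ ρ A` the term `D c t ^ k` is at most `η / 4 * A ^ k`, so `d` dominates.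
  set ρ : ℝ := min 1 (η / (4 * n.factorial)) with hρ
  have hρ0 : 0 < ρ := lt_min one_pos (by positivity)
  have hρ1 : ρ ≤ 1 := min_le_left _ _
  have hρη : n.factorial * ρ ≤ η / 4 := by
    have : ρ ≤ η / (4 * n.factorial) := min_le_right _ _
    rw [le_div_iff₀ (by positivity)] at this
    linarith
  -- The first two bounds serve `k = 2`; the third makes the error smaller than `d` for `|t| ≤ ρ A`,
  -- the last makes it smaller than the derivative's main term for `|t| > ρ A`.
  set δ₀ : ℝ := min (min (1 / 64) (η / 4)) (min (η / (4 * 2 ^ n)) ((ρ / 2) ^ n / 32)) with hδ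
  have hδ0 : 0 < δ₀ := by
    refine lt_min (lt_min (by norm_num) (by positivity)) (lt_min (by positivity) (by positivity))
  have hδ1 : δ₀ ≤ 1 / 64 := (min_le_left _ _).trans (min_le_left _ _)
  have hδ2 : δ₀ ≤ η / 4 := (min_le_left _ _).trans (min_le_right _ _)
  have hδ3 : δ₀ * 2 ^ n ≤ η / 4 := by
    have : δ₀ ≤ η / (4 * 2 ^ n) := (min_le_right _ _).trans (min_le_left _ _)
    rw [le_div_iff₀ (by positivity)] at this
    linarith
  have hδ4 : δ₀ ≤ (ρ / 2) ^ n / 32 := (min_le_right _ _).trans (min_le_right _ _)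
  refine ⟨δ₀, hδ0, ?_⟩
  intro f I hI hf A c d D hA hD hDn hc hc1 hd hcd h1 h2 T hT
  by_contra! hcard
  obtain ⟨T', hT'c, hT'⟩ := exists_finset_zeros_iterate I hI hf T hT (n - k)
  have hT'k : k ≤ T'.card := by omega
  rcases hk2.eq_or_lt with rfl | hk3
  -- For `k = 2`, `c` and `d` have the same sign, so nothing cancels and not even one zero is
  -- possible.
  · obtain ⟨t, ht⟩ : T'.Nonempty := Finset.card_pos.1 (by omega)
    obtain ⟨htI, ht0⟩ := hT' t ht
    have h := h1 t htI
    rw [ht0, zero_sub, abs_neg] at h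
    have hcd' := hcd rfl
    have e1 : |D * c * t ^ 2 + d| = D * |c| * t ^ 2 + |d| := by
      rcases lt_trichotomy c 0 with hc0 | hc0 | hc0
      · have hd0 : d < 0 := by nlinarith
        rw [abs_of_neg hc0, abs_of_neg hd0, abs_of_nonpos]
        · ring
        · nlinarith [mul_nonneg (mul_nonneg (by linarith : (0 : ℝ) ≤ D) (by linarith : 0 ≤ -c))
            (sq_nonneg t)]
      · rw [hc0] at hcd'; linarith
      · have hd0 : 0 < d := by nlinarith
        rw [abs_of_pos hc0, abs_of_pos hd0, abs_of_nonneg]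
        have : 0 ≤ D * c * t ^ 2 := by positivity
        linarith
    have e2 : (A + |t|) ^ 2 ≤ 2 * A ^ 2 + 2 * t ^ 2 := by
      rw [← sq_abs t]; nlinarith [sq_nonneg (A - |t|)]
    have e3 : 1 / 16 * t ^ 2 ≤ D * |c| * t ^ 2 := by
      refine mul_le_mul_of_nonneg_right ?_ (sq_nonneg t)
      nlinarith
    have hA2 : 0 < A ^ 2 := by positivity
    rw [e1] at h
    nlinarith [mul_le_mul_of_nonneg_left e2 hδ0.le, sq_nonneg t]
  -- For `k ≥ 3` the zeros lie outside `[-ρ A, ρ A]`, and there the next derivative does not vanish.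
  -- By Rolle each side has at most one zero, fewer than `k` in all.
  · have hbig : ∀ t ∈ T', ρ * A < |t| := by
      intro t ht
      obtain ⟨htI, ht0⟩ := hT' t ht
      by_contra! hle
      have h := h1 t htI
      rw [ht0, zero_sub, abs_neg] at h
      have hAk : 0 < A ^ k := by positivity
      have e1 : |D * c * t ^ k| ≤ η / 4 * A ^ k := by
        rw [abs_mul, abs_mul, abs_pow, abs_of_pos (by linarith : 0 < D)]
        calc D * |c| * |t| ^ k ≤ n.factorial * 1 * (ρ * A) ^ k := by gcongr
          _ = n.factorial * ρ ^ k * A ^ k := by rw [mul_pow]; ring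
          _ ≤ n.factorial * ρ * A ^ k := by
              gcongr
              exact pow_le_of_le_one hρ0.le hρ1 (by omega)
          _ ≤ _ := by gcongr
      have e2 : δ₀ * (A + |t|) ^ k ≤ η / 4 * A ^ k := by
        calc δ₀ * (A + |t|) ^ k ≤ δ₀ * (2 * A) ^ k := by
              gcongr; nlinarith
          _ = δ₀ * 2 ^ k * A ^ k := by rw [mul_pow]; ring
          _ ≤ δ₀ * 2 ^ n * A ^ k := by
              gcongr; norm_num
          _ ≤ _ := by gcongr
      have e3 : |d| ≤ |D * c * t ^ k + d| + |D * c * t ^ k| := by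
        have := abs_sub (D * c * t ^ k + d) (D * c * t ^ k)
        simpa using this
      nlinarith
    have hder : ∀ t ∈ I, ρ * A < |t| → f (n - k + 1) t ≠ 0 := by
      intro t htI ht h0
      have h := h2 t htI
      rw [h0, zero_sub, abs_neg, abs_mul, abs_mul, abs_mul, abs_pow, Nat.abs_cast,
        abs_of_pos (by linarith : 0 < D)] at h
      have ht0 : 0 < |t| := lt_trans (by positivity) ht
      have e1 : A + |t| ≤ 2 / ρ * |t| := by
        have : A ≤ |t| / ρ := by rw [le_div_iff₀ hρ0]; linarith
        have h3 : |t| ≤ |t| / ρ := by rw [le_div_iff₀ hρ0]; nlinarith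
        calc A + |t| ≤ |t| / ρ + |t| / ρ := add_le_add this h3
          _ = _ := by ring
      have e2 : δ₀ * (A + |t|) ^ (k - 1) ≤ 1 / 32 * |t| ^ (k - 1) := by
        calc δ₀ * (A + |t|) ^ (k - 1) ≤ (ρ / 2) ^ n / 32 * (2 / ρ * |t|) ^ (k - 1) := by gcongr
          _ = 1 / 32 * |t| ^ (k - 1) * ((ρ / 2) ^ n * (2 / ρ) ^ (k - 1)) := by
              rw [mul_pow]; ring
          _ ≤ 1 / 32 * |t| ^ (k - 1) * 1 := by
              gcongr
              have : (2 / ρ) ^ (k - 1) ≤ (2 / ρ) ^ n :=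
                pow_le_pow_right₀ (by rw [le_div_iff₀ hρ0]; linarith) (by omega)
              calc (ρ / 2) ^ n * (2 / ρ) ^ (k - 1) ≤ (ρ / 2) ^ n * (2 / ρ) ^ n := by gcongr
                _ = 1 := by
                  rw [← mul_pow, div_mul_div_comm, mul_comm ρ 2, div_self (by positivity), one_pow]
          _ = _ := by ring
      have e3 : 1 / 16 * |t| ^ (k - 1) ≤ k * D * |c| * |t| ^ (k - 1) := by
        gcongr
        have hk1 : (1 : ℝ) ≤ k := by exact_mod_cast (by omega : 1 ≤ k)
        have : 1 ≤ k * D := by nlinarith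
        nlinarith
      have : 0 < |t| ^ (k - 1) := by positivity
      nlinarith
    have hone : ∀ t₁ ∈ T', ∀ t₂ ∈ T', t₁ < t₂ → ¬ (0 < t₁ ∨ t₂ < 0) := by
      intro t₁ h₁ t₂ h₂ hlt hside
      have hsub : Icc t₁ t₂ ⊆ I := hI.out (hT' _ h₁).1 (hT' _ h₂).1
      obtain ⟨x, hx, hx0⟩ := exists_hasDerivAt_eq_zero (f := f (n - k)) (f' := f (n - k + 1)) hlt
        (fun t ht => (hf _ t (hsub ht)).continuousAt.continuousWithinAt)
        (by rw [(hT' _ h₁).2, (hT' _ h₂).2]) (fun t ht => hf _ t (hsub (Ioo_subset_Icc_self ht)))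
      refine hder x (hsub (Ioo_subset_Icc_self hx)) ?_ hx0
      rcases hside with h | h
      · have := hbig _ h₁
        rw [abs_of_pos h] at this
        rw [abs_of_pos (h.trans hx.1)]; linarith [hx.1]
      · have := hbig _ h₂
        rw [abs_of_neg h] at this
        rw [abs_of_neg (hx.2.trans h)]; linarith [hx.2]
    have hpos : (T'.filter fun t => 0 < t).card ≤ 1 := by
      rw [Finset.card_le_one]
      intro t₁ h₁ t₂ h₂
      rw [Finset.mem_filter] at h₁ h₂
      rcases lt_trichotomy t₁ t₂ with h | h | h
      · exact absurd (Or.inl h₁.2) (hone _ h₁.1 _ h₂.1 h)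
      · exact h
      · exact absurd (Or.inl h₂.2) (hone _ h₂.1 _ h₁.1 h)
    have hneg : (T'.filter fun t => ¬ 0 < t).card ≤ 1 := by
      have hlt0 : ∀ t ∈ T', ¬ 0 < t → t < 0 := by
        intro t ht h
        refine lt_of_le_of_ne (not_lt.1 h) fun h0 => ?_
        have := hbig t ht
        rw [h0, abs_zero] at this
        nlinarith [mul_pos hρ0 hA]
      rw [Finset.card_le_one]
      intro t₁ h₁ t₂ h₂
      rw [Finset.mem_filter] at h₁ h₂
      rcases lt_trichotomy t₁ t₂ with h | h | h
      · exact absurd (Or.inr (hlt0 _ h₂.1 h₂.2)) (hone _ h₁.1 _ h₂.1 h)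
      · exact h
      · exact absurd (Or.inr (hlt0 _ h₁.1 h₁.2)) (hone _ h₂.1 _ h₁.1 h)
    have := Finset.card_filter_add_card_filter_not (s := T') (fun t => 0 < t)
    omega

theorem norm_pow_sub_pow_le_mul {x y : ℂ} {M σ : ℝ} (hx : ‖x‖ ≤ M) (hy : ‖y‖ ≤ M)
    (hxy : ‖x - y‖ ≤ σ * M) (K : ℕ) : ‖x ^ K - y ^ K‖ ≤ K * σ * M ^ K := by
  have hM : 0 ≤ M := (norm_nonneg x).trans hx
  induction K with
  | zero => simp
  | succ K ih =>
    have : x ^ (K + 1) - y ^ (K + 1) = x * (x ^ K - y ^ K) + (x - y) * y ^ K := by ring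
    rw [this]
    calc _ ≤ ‖x‖ * ‖x ^ K - y ^ K‖ + ‖x - y‖ * ‖y‖ ^ K := by
          refine (norm_add_le _ _).trans ?_
          rw [norm_mul, norm_mul, norm_pow]
      _ ≤ M * (K * σ * M ^ K) + σ * M * M ^ K := by
          have := (norm_nonneg _).trans hxy
          gcongr
      _ = _ := by push_cast; ring

/-- The derivatives of order at least `n - k` along a line at distance at most `σ A` from the
origin, when the coefficients before `a k` are small relative to the scale `A = b ^ 3`. -/
theorem abs_lineDerivs_sub_dominant_le {n k : ℕ} (hk2 : 2 ≤ k) (hkn : k ≤ n) {a : ℕ → ℂ}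
    {b σ δ : ℝ} (hb : 0 < b) (hb1 : b ≤ 1) (hσ : 0 ≤ σ) (hσ1 : σ ≤ 1) (hδ : 0 ≤ δ)
    (ha : ∀ i ∈ Finset.Icc 2 n, ‖a i‖ ≤ (b ^ 3) ^ i)
    (hak : ∀ i ∈ Finset.Icc 2 n, i < k → ‖a i‖ ≤ δ * (b ^ 3) ^ i)
    (hs : n * (2 * b ^ 2) ^ n ≤ 1 / 2) {φ s t : ℝ} (hsσ : |s| ≤ σ * b ^ 3)
    (ht : ‖Complex.exp (φ * Complex.I) * (t + s * Complex.I)‖ ≤ b ^ 2)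
    {J : ℕ} (hJ : n - k ≤ J) (hJn : J ≤ n) (hJ' : J ≤ n - k + 1) :
    |lineDerivs n a φ s J t - (n.descFactorial J * Real.cos (n * φ) * t ^ (n - J) +
      (if J = n - k then
        (n - k).factorial * (Complex.exp (φ * Complex.I) ^ (n - k) * a k).re else 0))| ≤
      (n.factorial * n * σ + n * n.factorial * δ + remainderConst n * b) *
        (b ^ 3 + |t|) ^ (n - J) := by
  have hn : 1 ≤ n := by omega
  have hbb : b ^ 3 ≤ b ^ 2 := by nlinarith [sq_nonneg b]
  have ha' : ∀ i ∈ Finset.Icc 2 n, ‖a i‖ ≤ (b ^ 2) ^ i := fun i hi =>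
    (ha i hi).trans (by gcongr)
  have hE := norm_iteratedDeriv_logRemainder_le ha' hn (by positivity) hs hJn ht
  unfold lineDerivs
  set e := Complex.exp (φ * Complex.I) with he
  have hen : ‖e‖ = 1 := Complex.norm_exp_ofReal_mul_I φ
  set w : ℂ := t + s * Complex.I with hw
  set M : ℝ := b ^ 3 + |t| with hM
  have hM0 : 0 < M := by positivity
  have hAM : b ^ 3 ≤ M := by rw [hM]; linarith [abs_nonneg t]
  have hwM : ‖w‖ ≤ M := by
    refine (norm_add_le _ _).trans ?_
    rw [norm_mul, Complex.norm_I, mul_one, Complex.norm_real, Complex.norm_real,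
      Real.norm_eq_abs, Real.norm_eq_abs, hM]
    nlinarith [pow_pos hb 3]
  have htM : ‖(t : ℂ)‖ ≤ M := by
    rw [Complex.norm_real, Real.norm_eq_abs, hM]; linarith [pow_pos hb 3]
  have hwt : ‖w - t‖ ≤ σ * M := by
    have : w - t = s * Complex.I := by rw [hw]; ring
    rw [this, norm_mul, Complex.norm_I, mul_one, Complex.norm_real, Real.norm_eq_abs]
    exact hsσ.trans (by gcongr)
  set dk : ℂ := if J = n - k then (n - k).factorial * (e ^ (n - k) * a k) else 0 with hdk
  have hdre : (if J = n - k then (n - k).factorial * (e ^ (n - k) * a k).re else 0) = dk.re := by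
    rw [hdk]; split_ifs
    · rw [← Complex.ofReal_natCast, Complex.re_ofReal_mul]
    · simp
  have hcos : n.descFactorial J * Real.cos (n * φ) * t ^ (n - J) =
      (n.descFactorial J * (e ^ n * (t : ℂ) ^ (n - J))).re := by
    have : e ^ n = Complex.exp (((n * φ : ℝ) : ℂ) * Complex.I) := by
      rw [he, ← Complex.exp_nat_mul]; congr 1; push_cast; ring
    rw [this, ← Complex.ofReal_natCast, Complex.re_ofReal_mul, ← Complex.ofReal_pow,
      Complex.re_mul_ofReal, Complex.exp_ofReal_mul_I_re]; ring
  have hpow : e ^ n = e ^ J * e ^ (n - J) := by rw [← pow_add, Nat.add_sub_cancel' hJn]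
  have hkmem : k ∈ Finset.Icc 2 n := Finset.mem_Icc.2 ⟨hk2, hkn⟩
  rw [hdre, hcos, ← Complex.add_re, ← Complex.sub_re, eval_iterate_derivative_liftedPoly]
  refine (Complex.abs_re_le_norm _).trans ?_
  -- Three errors: the offset `s` of the line from the origin, the coefficients other than `a k`,
  -- and the logarithmic remainder.
  have hsplit : e ^ J * (n.descFactorial J * (e * w) ^ (n - J)
      + ∑ i ∈ Finset.Icc 2 n, a i * ((n - i).descFactorial J * (e * w) ^ (n - i - J))
      + iteratedDeriv J (logRemainder n a) (e * w))
      - (n.descFactorial J * (e ^ n * (t : ℂ) ^ (n - J)) + dk) =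
      n.descFactorial J * e ^ n * (w ^ (n - J) - (t : ℂ) ^ (n - J))
      + ∑ i ∈ Finset.Icc 2 n, (e ^ J * (a i * ((n - i).descFactorial J * (e * w) ^ (n - i - J)))
        - if i = k then dk else 0)
      + e ^ J * iteratedDeriv J (logRemainder n a) (e * w) := by
    rw [Finset.sum_sub_distrib, Finset.sum_ite_eq' _ k, if_pos hkmem, ← Finset.mul_sum, hpow,
      mul_pow]
    ring
  rw [hsplit]
  have hdf : ∀ m ≤ n, (m.descFactorial J : ℝ) ≤ n.factorial := fun m hm => by
    exact_mod_cast (descFactorial_le_factorial _ _).trans (Nat.factorial_le hm)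
  have t1 : ‖(n.descFactorial J : ℂ) * e ^ n * (w ^ (n - J) - (t : ℂ) ^ (n - J))‖ ≤
      n.factorial * n * σ * M ^ (n - J) := by
    rw [norm_mul, norm_mul, norm_pow, hen, one_pow, mul_one, Complex.norm_natCast]
    have h := norm_pow_sub_pow_le_mul hwM htM hwt (n - J)
    have hJ2 : ((n - J : ℕ) : ℝ) ≤ n := by exact_mod_cast Nat.sub_le _ _
    calc _ ≤ (n.factorial : ℝ) * ((n - J : ℕ) * σ * M ^ (n - J)) := by
          gcongr; exact_mod_cast hdf n le_rfl
      _ ≤ n.factorial * (n * σ * M ^ (n - J)) := by gcongr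
      _ = _ := by ring
  have t3 : ‖e ^ J * iteratedDeriv J (logRemainder n a) (e * w)‖ ≤
      remainderConst n * b * M ^ (n - J) := by
    rw [norm_mul, norm_pow, hen, one_pow, one_mul]
    refine hE.trans ?_
    rw [mul_assoc, mul_assoc]
    refine mul_le_mul_of_nonneg_left ?_ (remainderConst_nonneg n)
    -- The bound on the disc of radius `b ^ 2` has to be read on the finer scale `b ^ 3`; since `n ≥
    -- 1`, a factor `b` is left over.
    calc (b ^ 2) ^ n * (b ^ 2) ^ (n - J) = b ^ (2 * n + 2 * (n - J)) := by
          rw [← pow_mul, ← pow_mul, ← pow_add]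
      _ ≤ b ^ (1 + 3 * (n - J)) := pow_le_pow_of_le_one hb.le hb1 (by omega)
      _ = b * (b ^ 3) ^ (n - J) := by rw [pow_add, pow_one, pow_mul]
      _ ≤ b * M ^ (n - J) := by gcongr
  have t2 : ∀ i ∈ Finset.Icc 2 n,
      ‖e ^ J * (a i * ((n - i).descFactorial J * (e * w) ^ (n - i - J)))
        - (if i = k then dk else 0)‖ ≤ n.factorial * δ * M ^ (n - J) := by
    intro i hi
    have hi' := Finset.mem_Icc.1 hi
    rcases lt_trichotomy i k with hik | hik | hik
    · rw [if_neg hik.ne, sub_zero, norm_mul, norm_pow, hen, one_pow, one_mul, norm_mul, norm_mul,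
        norm_pow, norm_mul, hen, one_mul, Complex.norm_natCast]
      calc ‖a i‖ * ((n - i).descFactorial J * ‖w‖ ^ (n - i - J))
          ≤ (δ * M ^ i) * (n.factorial * M ^ (n - i - J)) := by
            gcongr
            · exact (hak i hi hik).trans (by gcongr)
            · exact_mod_cast hdf (n - i) (by omega)
        _ = n.factorial * δ * (M ^ i * M ^ (n - i - J)) := by ring
        _ = n.factorial * δ * M ^ (n - J) := by
            rw [← pow_add]; congr 2; omega
    · have hzero : e ^ J * (a i * ((n - i).descFactorial J * (e * w) ^ (n - i - J)))
        - (if i = k then dk else 0) = 0 := by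
        rw [if_pos hik, hdk, hik]
        split_ifs with hJk
        · rw [hJk, Nat.descFactorial_self, Nat.sub_self, pow_zero]; ring
        · rw [Nat.descFactorial_of_lt (by omega)]; simp
      rw [hzero, norm_zero]; positivity
    -- Coefficients after `a k` multiply powers of degree below `n - k` and vanish after `J ≥ n - k`
    -- derivatives.
    · rw [if_neg hik.ne', Nat.descFactorial_of_lt (by omega)]
      simp only [Nat.cast_zero, zero_mul, mul_zero, sub_zero, norm_zero]
      positivity
  have t2' : ‖∑ i ∈ Finset.Icc 2 n, (e ^ J * (a i * ((n - i).descFactorial J *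
      (e * w) ^ (n - i - J))) - if i = k then dk else 0)‖ ≤
      n * n.factorial * δ * M ^ (n - J) := by
    refine (norm_sum_le _ _).trans ((Finset.sum_le_sum t2).trans ?_)
    rw [Finset.sum_const, Nat.card_Icc, nsmul_eq_mul]
    have : ((n + 1 - 2 : ℕ) : ℝ) ≤ n := by exact_mod_cast (by omega : n + 1 - 2 ≤ n)
    calc ((n + 1 - 2 : ℕ) : ℝ) * (n.factorial * δ * M ^ (n - J))
        ≤ n * (n.factorial * δ * M ^ (n - J)) := by gcongr
      _ = _ := by ring
  refine (norm_add₃_le).trans ?_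
  rw [add_mul, add_mul]
  exact add_le_add (add_le_add t1 t2') t3

/-- A set of lines, of measure proportional to `b ^ 3`, each meeting the lemniscate in fewer than
`n` points of the disc of radius `b ^ 2`. -/
def HasGain (n : ℕ) (a : ℕ → ℂ) (b σ : ℝ) : Prop :=
  ∃ G : Set ℝ, MeasurableSet G ∧ Real.pi / 16 ≤ (volume (G ∩ Ioc 0 Real.pi)).toReal ∧
    ∀ φ ∈ G, 1 / 16 ≤ |Real.cos (n * φ)| ∧ ∀ s : ℝ, |s| ≤ σ * b ^ 3 → ∀ T : Finset ℝ,
      (∀ t ∈ T, t ∈ Ioo (-√((b ^ 2) ^ 2 - s ^ 2)) (√((b ^ 2) ^ 2 - s ^ 2)) ∧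
        lineDerivs n a φ s 0 t = 0) → T.card < n

theorem HasGain.mono {n : ℕ} {a : ℕ → ℂ} {b σ σ' : ℝ} (hb : 0 < b) (h : HasGain n a b σ)
    (hσ : σ' ≤ σ) : HasGain n a b σ' := by
  obtain ⟨G, h1, h2, h3⟩ := h
  exact ⟨G, h1, h2, fun φ hφ => ⟨(h3 φ hφ).1, fun s hs => (h3 φ hφ).2 s (hs.trans (by gcongr))⟩⟩

theorem norm_line_le {φ s t r : ℝ} (hr : 0 ≤ r) (ht : |t| ≤ √(r ^ 2 - s ^ 2)) (hs : |s| ≤ r) :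
    ‖Complex.exp (φ * Complex.I) * (t + s * Complex.I)‖ ≤ r := by
  rw [norm_line]
  have h0 : 0 ≤ r ^ 2 - s ^ 2 := by
    have := sq_le_sq' (by linarith [abs_nonneg s]) hs
    rw [sq_abs] at this; linarith
  have h1 : t ^ 2 ≤ r ^ 2 - s ^ 2 := by
    have := pow_le_pow_left₀ (abs_nonneg t) ht 2
    rwa [sq_abs, Real.sq_sqrt h0] at this
  exact Real.sqrt_le_iff.2 ⟨hr, by linarith⟩

/-- When `a k` is the first coefficient of full size, `card_zeros_lt_of_dominant` applies with `c =
cos (n φ)` and `d = (n - k)! ‖a k‖ cos ((n - k) φ + β)`. Favourable directions keep the product of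
the two cosines away from zero, and positive if `k = 2`. -/
theorem hasGain_of_dominant {n k : ℕ} (hk2 : 2 ≤ k) (hkn : k ≤ n) {η : ℝ} (hη : 0 < η) :
    ∃ δ σ b₀ : ℝ, 0 < δ ∧ 0 < σ ∧ σ ≤ 1 ∧ 0 < b₀ ∧ b₀ ≤ 1 ∧ ∀ (a : ℕ → ℂ) (b : ℝ), 0 < b → b ≤ b₀ →
      n * (2 * b ^ 2) ^ n ≤ 1 / 2 → (∀ i ∈ Finset.Icc 2 n, ‖a i‖ ≤ (b ^ 3) ^ i) →
      (∀ i ∈ Finset.Icc 2 n, i < k → ‖a i‖ ≤ δ * (b ^ 3) ^ i) → η * (b ^ 3) ^ k ≤ ‖a k‖ →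
      (a n).im = 0 → HasGain n a b σ := by
  obtain ⟨δ₀, hδ₀, hdom⟩ := card_zeros_lt_of_dominant hk2 hkn (η := η / 16) (by positivity)
  have hC := remainderConst_nonneg n
  set N : ℝ := n * n.factorial + 1 with hN
  have hN0 : 0 < N := by positivity
  set δ : ℝ := min 1 (δ₀ / (3 * N)) with hδ
  have hδ0 : 0 < δ := lt_min one_pos (by positivity)
  have hδN : N * δ ≤ δ₀ / 3 := by
    have : δ ≤ δ₀ / (3 * N) := min_le_right _ _
    rw [le_div_iff₀ (by positivity)] at this
    linarith
  set b₀ : ℝ := min 1 (δ₀ / (3 * (remainderConst n + 1))) with hb₀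
  have hb₀0 : 0 < b₀ := lt_min one_pos (by positivity)
  have hb₀C : (remainderConst n + 1) * b₀ ≤ δ₀ / 3 := by
    have : b₀ ≤ δ₀ / (3 * (remainderConst n + 1)) := min_le_right _ _
    rw [le_div_iff₀ (by positivity)] at this
    linarith
  refine ⟨δ, δ, b₀, hδ0, hδ0, min_le_left _ _, hb₀0, min_le_left _ _, ?_⟩
  intro a b hb hbb hsm ha hak hηk him
  have hb1 : b ≤ 1 := hbb.trans (min_le_left _ _)
  have hA : 0 < b ^ 3 := by positivity
  have hak0 : 0 < ‖a k‖ := lt_of_lt_of_le (by positivity) hηk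
  set m := n - k with hm
  set β := (a k).arg with hβ
  -- For `k = n` the constant `d` does not depend on the direction; `a n` being real keeps its real
  -- part from vanishing.
  have hβ1 : m = 0 → Real.cos (2 * β) = 1 := by
    intro h
    have hkn' : k = n := by omega
    have hsin : Real.sin β = 0 := by rw [hβ, Complex.sin_arg, hkn', him, zero_div]
    rw [Real.cos_two_mul, Real.cos_sq', hsin]; norm_num
  have hre : ∀ φ : ℝ, (Complex.exp (φ * Complex.I) ^ m * a k).re =
      ‖a k‖ * Real.cos (m * φ + β) := by
    intro φ
    have : Complex.exp (φ * Complex.I) ^ m * a k =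
        ‖a k‖ * Complex.exp (((m * φ + β : ℝ) : ℂ) * Complex.I) := by
      conv_lhs => rw [← Complex.norm_mul_exp_arg_mul_I (a k)]
      rw [← Complex.exp_nat_mul, mul_left_comm, ← Complex.exp_add]
      congr 2; push_cast; ring
    rw [this, Complex.re_ofReal_mul, Complex.exp_ofReal_mul_I_re]
  have htot : n.factorial * n * δ + n * n.factorial * δ + remainderConst n * b ≤ δ₀ := by
    have h1 : remainderConst n * b ≤ δ₀ / 3 := by nlinarith
    have h2 : n * n.factorial * δ ≤ δ₀ / 3 := by rw [hN] at hδN; linarith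
    linarith
  have hcount : ∀ φ : ℝ, 1 / 16 ≤ |Real.cos (n * φ) * Real.cos (m * φ + β)| →
      (k = 2 → 1 / 16 ≤ Real.cos (n * φ) * Real.cos (m * φ + β)) →
      1 / 16 ≤ |Real.cos (n * φ)| ∧ ∀ s : ℝ, |s| ≤ δ * b ^ 3 → ∀ T : Finset ℝ,
      (∀ t ∈ T, t ∈ Ioo (-√((b ^ 2) ^ 2 - s ^ 2)) (√((b ^ 2) ^ 2 - s ^ 2)) ∧
        lineDerivs n a φ s 0 t = 0) → T.card < n := by
    intro φ h1 h2
    rw [abs_mul] at h1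
    have hc1 : |Real.cos (n * φ)| ≤ 1 := Real.abs_cos_le_one _
    have hc2 : |Real.cos (m * φ + β)| ≤ 1 := Real.abs_cos_le_one _
    have hc3 : 1 / 16 ≤ |Real.cos (n * φ)| := h1.trans (mul_le_of_le_one_right (abs_nonneg _) hc2)
    have hc4 : 1 / 16 ≤ |Real.cos (m * φ + β)| :=
      h1.trans (mul_le_of_le_one_left (abs_nonneg _) hc1)
    refine ⟨hc3, fun s hs T hT => ?_⟩
    have hsr : |s| ≤ b ^ 2 := by
      have h3 : δ ≤ 1 := min_le_left _ _
      have h4 : b ^ 3 ≤ b ^ 2 := by nlinarith [sq_nonneg b]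
      nlinarith
    have hline : ∀ t ∈ Ioo (-√((b ^ 2) ^ 2 - s ^ 2)) (√((b ^ 2) ^ 2 - s ^ 2)),
        ‖Complex.exp (φ * Complex.I) * (t + s * Complex.I)‖ ≤ b ^ 2 := fun t ht =>
      norm_line_le (by positivity) (abs_lt.2 ht).le hsr
    have hbb' : b ^ 3 ≤ b ^ 2 := by nlinarith [sq_nonneg b]
    have ha' : ∀ i ∈ Finset.Icc 2 n, ‖a i‖ ≤ (b ^ 2) ^ i := fun i hi =>
      (ha i hi).trans (by gcongr)
    have hfpos : (1 : ℝ) ≤ (m.factorial : ℝ) := by exact_mod_cast Nat.factorial_pos m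
    refine hdom (lineDerivs n a φ s) _ ordConnected_Ioo
      (fun j t ht => hasDerivAt_lineDerivs ha' (by omega) (by positivity) hsm φ s j (hline t ht))
      (b ^ 3) (Real.cos (n * φ)) (m.factorial * (‖a k‖ * Real.cos (m * φ + β)))
      (n.descFactorial m) hA ?_ ?_ hc3 hc1 ?_ ?_ ?_ ?_ T hT
    · exact_mod_cast Nat.one_le_iff_ne_zero.2 fun h => by
        rw [Nat.descFactorial_eq_zero_iff_lt] at h; omega
    · exact_mod_cast descFactorial_le_factorial _ _
    · rw [abs_mul, abs_mul, abs_norm, Nat.abs_cast]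
      calc η / 16 * (b ^ 3) ^ k = 1 * (η * (b ^ 3) ^ k * (1 / 16)) := by ring
        _ ≤ m.factorial * (‖a k‖ * |Real.cos (m * φ + β)|) := by gcongr
    · intro hk
      have := h2 hk
      have h3 : 0 < (m.factorial : ℝ) * ‖a k‖ := by positivity
      nlinarith [mul_pos h3 (by linarith : 0 < Real.cos (n * φ) * Real.cos (m * φ + β))]
    · intro t ht
      have h := abs_lineDerivs_sub_dominant_le hk2 hkn hb hb1 hδ0.le (min_le_left _ _) hδ0.le ha hak
        hsm hs (hline t ht) (J := m) le_rfl (by omega) (by omega)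
      rw [if_pos rfl, hre, show n - m = k by omega] at h
      exact h.trans (by gcongr)
    · intro t ht
      have h := abs_lineDerivs_sub_dominant_le hk2 hkn hb hb1 hδ0.le (min_le_left _ _) hδ0.le ha hak
        hsm hs (hline t ht) (J := m + 1) (by omega) (by omega) (by omega)
      rw [if_neg (by omega), add_zero, show n - (m + 1) = k - 1 by omega, Nat.descFactorial_succ,
        show n - m = k by omega] at h
      push_cast at h
      exact h.trans (by gcongr)
  by_cases hk : k = 2
  · refine ⟨{φ | 1 / 16 ≤ Real.cos (n * φ) * Real.cos (m * φ + β)},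
      measurableSet_le (by fun_prop) (by fun_prop), volume_cos_mul_cos (by omega) β hβ1, ?_⟩
    intro φ hφ
    have hφ' : 1 / 16 ≤ Real.cos (n * φ) * Real.cos (m * φ + β) := hφ
    exact hcount φ (hφ'.trans (le_abs_self _)) fun _ => hφ'
  · refine ⟨{φ | 1 / 16 ≤ |Real.cos (n * φ) * Real.cos (m * φ + β)|},
      measurableSet_le (by fun_prop) (by fun_prop), volume_abs_cos_mul_cos (by omega) β hβ1, ?_⟩
    intro φ hφ
    have hφ' : 1 / 16 ≤ |Real.cos (n * φ) * Real.cos (m * φ + β)| := hφ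
    exact hcount φ hφ' fun h => absurd h hk

/-- Some coefficient has exactly full size. The indices are examined with thresholds fixed from the
largest index downwards: either `a (n - i)` is above the threshold already found for larger indices,
and dominates provided the earlier ones are smaller still, or it is small as well and the previous
case applies. At the start all coefficients would be small, which is absurd. -/
theorem exists_hasGain {n : ℕ} (hn : 2 ≤ n) :
    ∃ σ b₀ : ℝ, 0 < σ ∧ σ ≤ 1 ∧ 0 < b₀ ∧ b₀ ≤ 1 ∧ ∀ (a : ℕ → ℂ) (b : ℝ), 0 < b → b ≤ b₀ →
      n * (2 * b ^ 2) ^ n ≤ 1 / 2 → (∀ i ∈ Finset.Icc 2 n, ‖a i‖ ≤ (b ^ 3) ^ i) →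
      (∃ k ∈ Finset.Icc 2 n, ‖a k‖ = (b ^ 3) ^ k) → (a n).im = 0 → HasGain n a b σ := by
  have key : ∀ i : ℕ, i + 1 ≤ n → ∃ δ σ b₀ : ℝ, 0 < δ ∧ 0 < σ ∧ σ ≤ 1 ∧ 0 < b₀ ∧ b₀ ≤ 1 ∧
      ∀ (a : ℕ → ℂ) (b : ℝ), 0 < b → b ≤ b₀ → n * (2 * b ^ 2) ^ n ≤ 1 / 2 →
      (∀ i ∈ Finset.Icc 2 n, ‖a i‖ ≤ (b ^ 3) ^ i) →
      (∃ k ∈ Finset.Icc 2 n, ‖a k‖ = (b ^ 3) ^ k) → (a n).im = 0 →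
      (∀ l ∈ Finset.Icc 2 n, l < n + 1 - i → ‖a l‖ ≤ δ * (b ^ 3) ^ l) → HasGain n a b σ := by
    intro i
    induction i with
    | zero =>
      intro _
      refine ⟨1 / 2, 1, 1, by norm_num, one_pos, le_rfl, one_pos, le_rfl, ?_⟩
      intro a b hb _ _ _ ⟨k, hk, hke⟩ _ hsmall
      exfalso
      have h := hsmall k hk (by have := (Finset.mem_Icc.1 hk).2; omega)
      have : 0 < (b ^ 3) ^ k := by positivity
      rw [hke] at h; linarith
    | succ i ih =>
      intro hi
      obtain ⟨δ, σ, b₀, hδ, hσ, hσ1, hb₀, hb₀1, h⟩ := ih (by omega)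
      obtain ⟨δ', σ', b₀', hδ', hσ', hσ1', hb₀', hb₀1', h'⟩ :=
        hasGain_of_dominant (n := n) (k := n - i) (by omega) (by omega) hδ
      refine ⟨min δ δ', min σ σ', min b₀ b₀', lt_min hδ hδ', lt_min hσ hσ',
        (min_le_left _ _).trans hσ1, lt_min hb₀ hb₀', (min_le_left _ _).trans hb₀1, ?_⟩
      intro a b hb hbb hsm ha hex him hsmall
      have hkm : n - i ∈ Finset.Icc 2 n := Finset.mem_Icc.2 ⟨by omega, by omega⟩
      rcases le_total (δ * (b ^ 3) ^ (n - i)) ‖a (n - i)‖ with hle | hle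
      · refine (h' a b hb (hbb.trans (min_le_right _ _)) hsm ha (fun l hl hlk => ?_) hle him).mono hb
          (min_le_right _ _)
        exact (hsmall l hl (by omega)).trans (by gcongr; exact min_le_right _ _)
      · refine (h a b hb (hbb.trans (min_le_left _ _)) hsm ha hex him fun l hl hlk => ?_).mono hb
          (min_le_left _ _)
        rcases (by omega : l = n - i ∨ l < n - i) with rfl | hlt
        · exact hle
        · exact (hsmall l hl (by omega)).trans (by gcongr; exact min_le_left _ _)
  obtain ⟨δ, σ, b₀, hδ, hσ, hσ1, hb₀, hb₀1, h⟩ := key (n - 1) (by omega)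
  refine ⟨σ, b₀, hσ, hσ1, hb₀, hb₀1, fun a b hb hbb hsm ha hex him => ?_⟩
  refine h a b hb hbb hsm ha hex him fun l hl hlk => ?_
  have := (Finset.mem_Icc.1 hl).1
  omega

/-! ### Length inside the small disc -/

theorem exists_real_finset_of_line {n : ℕ} {a : ℕ → ℂ} {φ s r : ℝ} (T : Finset ℂ)
    (hT : ∀ z ∈ T, z ∈ lemniscate (perturbedPoly n a) ∩ Metric.ball 0 r ∧
      (Complex.exp (-(φ * Complex.I)) * z).im = s) :
    ∃ T' : Finset ℝ, T'.card = T.card ∧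
      ∀ t ∈ T', t ∈ Ioo (-√(r ^ 2 - s ^ 2)) (√(r ^ 2 - s ^ 2)) ∧ lineDerivs n a φ s 0 t = 0 := by
  classical
  have hz : ∀ z ∈ T, z = Complex.exp (φ * Complex.I) *
      (((Complex.exp (-(φ * Complex.I)) * z).re : ℝ) + s * Complex.I) := by
    intro z hz
    rw [← (hT z hz).2, Complex.re_add_im, ← mul_assoc, ← Complex.exp_add, add_neg_cancel,
      Complex.exp_zero, one_mul]
  refine ⟨T.image fun z => (Complex.exp (-(φ * Complex.I)) * z).re,
    Finset.card_image_of_injOn fun z₁ h₁ z₂ h₂ h => ?_, ?_⟩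
  · rw [hz z₁ h₁, hz z₂ h₂]
    rw [h]
  · intro t ht
    obtain ⟨z, hzT, rfl⟩ := Finset.mem_image.1 ht
    have h1 := hz z hzT
    obtain ⟨⟨h2, h3⟩, -⟩ := hT z hzT
    rw [h1] at h2 h3
    refine ⟨?_, lineDerivs_zero_of_mem _ _ _ h2⟩
    rw [mem_ball_zero_iff, norm_line] at h3
    set t := (Complex.exp (-(φ * Complex.I)) * z).re
    rw [mem_Ioo, ← abs_lt, ← Real.sqrt_sq_eq_abs]
    have hr : 0 < r := lt_of_le_of_lt (Real.sqrt_nonneg _) h3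
    rw [Real.sqrt_lt' hr] at h3
    exact Real.sqrt_lt_sqrt (sq_nonneg _) (by linarith)

/-- The cosine is `1`-Lipschitz, so shifts below `1 / 16` cannot change its sign at such an `x`. -/
theorem cosSignChange_eq_zero {x y ψ : ℝ} (hx : 1 / 16 ≤ |Real.cos x|) (hy : |y| < 1 / 16)
    (hy' : |y + ψ| < 1 / 16) : cosSignChange ψ (x + y) = 0 := by
  unfold cosSignChange
  rw [if_neg]
  have hl : ∀ u v : ℝ, |Real.cos (u + v) - Real.cos u| ≤ |v| := by
    intro u v
    simpa using Real.abs_cos_sub_cos_le (u + v) u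
  have h1 := abs_le.1 (hl x y)
  have h2 := abs_le.1 (hl x (y + ψ))
  rw [← add_assoc] at h2
  push Not
  rcases le_abs.1 hx with h | h
  · exact mul_nonneg (by linarith) (by linarith)
  · exact mul_nonneg_of_nonpos_of_nonpos (by linarith) (by linarith)

theorem abs_arcsin_le {x : ℝ} (hx : |x| ≤ 1) : |Real.arcsin x| ≤ 2 * |x| := by
  have h := Real.mul_abs_le_abs_sin (x := Real.arcsin x)
    (abs_le.2 ⟨Real.neg_pi_div_two_le_arcsin _, Real.arcsin_le_pi_div_two _⟩)
  rw [Real.sin_arcsin (abs_le.1 hx).1 (abs_le.1 hx).2, div_mul_eq_mul_div,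
    div_le_iff₀ Real.pi_pos] at h
  nlinarith [Real.pi_lt_four, abs_nonneg x, Real.pi_pos]

/-- A constant controlling the relative error between the derivatives of `Re (-log (1 - q))` and
those of `Re z ^ n`. -/
noncomputable def comparisonConst (n : ℕ) : ℝ := n * n.factorial + remainderConst n

theorem comparisonConst_nonneg (n : ℕ) : 0 ≤ comparisonConst n :=
  add_nonneg (by positivity) (remainderConst_nonneg n)

/-- On lines avoiding the small exceptional set, the number of intersection points is bounded as
for the `n` lines `Re z ^ n = 0`. -/
theorem card_zeros_lineDerivs_le {n : ℕ} (hn : 2 ≤ n) {a : ℕ → ℂ} {b : ℝ} (hb : 0 < b)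
    (hb1 : b ≤ 1) (hsm : n * (2 * b ^ 2) ^ n ≤ 1 / 2)
    (ha : ∀ i ∈ Finset.Icc 2 n, ‖a i‖ ≤ (b ^ 3) ^ i) {φ s : ℝ} (hs : s ∈ Ioo (-b ^ 2) (b ^ 2))
    (hgood : ∀ m ≤ n, comparisonConst n * b ^ 2 <
        |Real.cos (n * φ + m * Real.arcsin (s / b ^ 2))| ∧
      comparisonConst n * b ^ 2 < |Real.cos (n * φ + -(m * Real.arcsin (s / b ^ 2)))|)
    (T : Finset ℝ) (hT : ∀ t ∈ T, t ∈ Ioo (-√((b ^ 2) ^ 2 - s ^ 2)) (√((b ^ 2) ^ 2 - s ^ 2)) ∧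
        lineDerivs n a φ s 0 t = 0) :
    (T.card : ℝ) ≤ n - ∑ m ∈ Finset.range n,
      (cosSignChange (Real.arcsin (s / b ^ 2)) (n * φ + m * Real.arcsin (s / b ^ 2))
      + cosSignChange (-Real.arcsin (s / b ^ 2)) (n * φ + -(m * Real.arcsin (s / b ^ 2)))) := by
  set r := b ^ 2 with hr
  have hr0 : 0 < r := by positivity
  set ψ := Real.arcsin (s / r) with hψ
  have hsr : |s / r| < 1 := by
    rw [abs_div, abs_of_pos hr0, div_lt_one hr0]; exact abs_lt.2 hs
  have hsin : r * Real.sin ψ = s := by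
    rw [hψ, Real.sin_arcsin (abs_lt.1 hsr).1.le (abs_lt.1 hsr).2.le]; field_simp
  have hcosψ : r * Real.cos ψ = √(r ^ 2 - s ^ 2) := by
    rw [hψ, Real.cos_arcsin]
    have : r ^ 2 - s ^ 2 = r ^ 2 * (1 - (s / r) ^ 2) := by field_simp
    rw [this, Real.sqrt_mul (sq_nonneg r), Real.sqrt_sq hr0.le]
  set B := √(r ^ 2 - s ^ 2) with hB
  have hB0 : 0 < B := by
    rw [hB]; refine Real.sqrt_pos.2 ?_
    have := sq_lt_sq' hs.1 hs.2
    linarith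
  have hbb : b ^ 3 ≤ r := by rw [hr]; nlinarith [sq_nonneg b]
  have ha' : ∀ i ∈ Finset.Icc 2 n, ‖a i‖ ≤ r ^ i := fun i hi => (ha i hi).trans (by gcongr)
  have hline : ∀ t : ℝ, |t| ≤ B → ‖Complex.exp (φ * Complex.I) * (t + s * Complex.I)‖ ≤ r :=
    fun t ht => norm_line_le hr0.le ht (abs_lt.2 hs).le
  -- With `A / r = b`, both the coefficients and the logarithmic remainder give a relative error
  -- `O(b ^ 2)`.
  have hrn : r ^ n ≤ b ^ 2 := by
    rw [hr]; exact pow_le_of_le_one (by positivity) (pow_le_one₀ hb.le hb1) (by omega)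
  have hconst : n * n.factorial * (b ^ 3 / r) ^ 2 + remainderConst n * r ^ n ≤
      comparisonConst n * b ^ 2 := by
    have h1 : b ^ 3 / r = b := by rw [hr]; field_simp
    rw [h1, comparisonConst, add_mul]
    gcongr
    exact remainderConst_nonneg n
  have hest : ∀ j ≤ n, ∀ t : ℝ, |t| ≤ B → |lineDerivs n a φ s j t - n.descFactorial j *
      (Complex.exp (φ * Complex.I) ^ n * (t + s * Complex.I) ^ (n - j)).re| ≤
      comparisonConst n * b ^ 2 * (n.descFactorial j * r ^ (n - j)) := by
    intro j hj t ht
    refine (abs_lineDerivs_sub_le (by positivity) hbb ha (by omega) hr0 hsm φ s hj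
      (hline t ht)).trans ?_
    have h1 : (1 : ℝ) ≤ n.descFactorial j := by
      exact_mod_cast Nat.one_le_iff_ne_zero.2 fun h => by
        rw [Nat.descFactorial_eq_zero_iff_lt] at h; omega
    have hc := comparisonConst_nonneg n
    calc _ ≤ comparisonConst n * b ^ 2 * (1 * r ^ (n - j)) := by rw [one_mul]; gcongr
      _ ≤ _ := by gcongr
  have hexp : ∀ (x : ℝ) (j : ℕ), Complex.exp (φ * Complex.I) ^ n *
      Complex.exp (x * Complex.I) ^ j = Complex.exp (((n * φ + j * x : ℝ) : ℂ) * Complex.I) := by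
    intro x j
    rw [← Complex.exp_nat_mul, ← Complex.exp_nat_mul, ← Complex.exp_add]
    congr 1; push_cast; ring
  have hcs : ∀ x : ℝ, Complex.exp (x * Complex.I) =
      (Real.cos x : ℂ) + (Real.sin x : ℂ) * Complex.I := by
    intro x; rw [Complex.exp_mul_I, Complex.ofReal_cos, Complex.ofReal_sin]
  refine card_zeros_le_of_cos (f := lineDerivs n a φ s) (κ := comparisonConst n * b ^ 2) hB0
    (fun j t ht => hasDerivAt_lineDerivs ha' (by omega) hr0 hsm φ s j (hline t (abs_le.2 ht)))
    (fun j => n.descFactorial j * r ^ (n - j)) (fun j hj => ?_) (fun j hj => ?_) (fun j hj => ?_)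
    (fun t ht => ?_) hgood T hT
  · have : n.descFactorial j ≠ 0 := fun h => by
      rw [Nat.descFactorial_eq_zero_iff_lt] at h; omega
    positivity
  · have h := hest j hj B (abs_of_pos hB0).le
    -- The ends of the chord are `r exp (i ψ)` and `-r exp (-i ψ)` before rotation by `φ`, with `sin
    -- ψ = s / r`.
    have hz : (B : ℂ) + s * Complex.I = r * Complex.exp (ψ * Complex.I) := by
      rw [hcs, ← hcosψ, ← hsin]; push_cast; ring
    rw [hz, mul_pow, mul_left_comm, hexp, ← Complex.ofReal_pow, Complex.re_ofReal_mul,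
      Complex.exp_ofReal_mul_I_re] at h
    rwa [← mul_assoc] at h
  · have h := hest j hj (-B) (by rw [abs_neg, abs_of_pos hB0])
    have hz : ((-B : ℝ) : ℂ) + s * Complex.I = ((-r : ℝ) : ℂ) *
        Complex.exp (((-ψ : ℝ) : ℂ) * Complex.I) := by
      rw [hcs, Real.cos_neg, Real.sin_neg, ← hcosψ, ← hsin]; push_cast; ring
    rw [hz, mul_pow, mul_left_comm, hexp, ← Complex.ofReal_pow, Complex.re_ofReal_mul,
      Complex.exp_ofReal_mul_I_re, neg_pow r, mul_neg] at h
    convert h using 3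
    ring
  · have h := hest n le_rfl t (abs_lt.2 ht).le
    rw [Nat.sub_self, pow_zero, mul_one] at h
    have h2 := hexp 0 0
    rw [pow_zero, mul_one] at h2
    rw [h2, Complex.exp_ofReal_mul_I_re] at h
    simpa using h

/-- The number of intersection points of a line with the part of the lemniscate in the disc of
radius `b ^ 2` is at most `lineCount`. -/
theorem card_le_lineCount {n : ℕ} (hn : 2 ≤ n) {a : ℕ → ℂ} {b σ : ℝ} (hb : 0 < b)
    (hb1 : b ≤ 1) (hbn : 32 * n * b < 1) (hσ1 : σ ≤ 1)
    (hsm : n * (2 * b ^ 2) ^ n ≤ 1 / 2) (hdeg : (perturbedPoly n a).natDegree = n)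
    (ha : ∀ i ∈ Finset.Icc 2 n, ‖a i‖ ≤ (b ^ 3) ^ i) {G : Set ℝ}
    (hG : ∀ φ ∈ G, 1 / 16 ≤ |Real.cos (n * φ)| ∧ ∀ s : ℝ, |s| ≤ σ * b ^ 3 → ∀ T : Finset ℝ,
      (∀ t ∈ T, t ∈ Ioo (-√((b ^ 2) ^ 2 - s ^ 2)) (√((b ^ 2) ^ 2 - s ^ 2)) ∧
        lineDerivs n a φ s 0 t = 0) → T.card < n) {φ s : ℝ} (hs : s ∈ Ioo (-b ^ 2) (b ^ 2))
    (T : Finset ℂ) (hT : ∀ z ∈ T, z ∈ lemniscate (perturbedPoly n a) ∩ Metric.ball 0 (b ^ 2) ∧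
      (Complex.exp (-(φ * Complex.I)) * z).im = s) :
    (T.card : ℝ) ≤ lineCount n (comparisonConst n * b ^ 2) (b ^ 2) (σ * b ^ 3) G φ s := by
  have hb2 : 0 < b ^ 2 := by positivity
  obtain ⟨T', hT'c, hT'⟩ := exists_real_finset_of_line T hT
  rw [← hT'c]
  unfold lineCount
  set ψ := Real.arcsin (s / b ^ 2) with hψ
  set S := ∑ m ∈ Finset.range n, (cosSignChange ψ (n * φ + m * ψ)
      + cosSignChange (-ψ) (n * φ + -(m * ψ))) with hS
  set Q := ∑ m ∈ Finset.range (n + 1), (cosSmall (comparisonConst n * b ^ 2) (n * φ + m * ψ)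
      + cosSmall (comparisonConst n * b ^ 2) (n * φ + -(m * ψ))) with hQ
  have hQterm : ∀ m ∈ Finset.range (n + 1),
      0 ≤ cosSmall (comparisonConst n * b ^ 2) (n * φ + m * ψ)
      + cosSmall (comparisonConst n * b ^ 2) (n * φ + -(m * ψ)) := fun m _ =>
    add_nonneg (cosSmall_nonneg _ _) (cosSmall_nonneg _ _)
  have hQ0 : 0 ≤ Q := Finset.sum_nonneg hQterm
  have hnQ : 0 ≤ 3 * n * Q := by positivity
  by_cases hφ : φ ∈ G ∧ s ∈ Icc (-(σ * b ^ 3)) (σ * b ^ 3)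
  · obtain ⟨hφG, hsσ⟩ := hφ
    obtain ⟨hc, hcount⟩ := hG φ hφG
    have hlt := hcount s (abs_le.2 hsσ) T' hT'
    have hle : (T'.card : ℝ) ≤ n - 1 := by
      have : T'.card + 1 ≤ n := hlt
      have : ((T'.card + 1 : ℕ) : ℝ) ≤ n := by exact_mod_cast this
      push_cast at this; linarith
    -- On central lines `|s| / r ≤ b`, so all phases `m ψ` are below `1 / 16`. There are then no
    -- sign changes and the generic bound is exactly `n`, against which `n - 1` is a real gain.
    have hψb : |ψ| ≤ 2 * b := by
      have h1 : |s / b ^ 2| ≤ b := by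
        rw [abs_div, abs_of_pos hb2, div_le_iff₀ hb2]
        have := abs_le.2 hsσ
        have h3 : 0 < b ^ 3 := by positivity
        nlinarith
      exact (abs_arcsin_le (h1.trans hb1)).trans (by linarith)
    have hmψ : ∀ m : ℕ, m ≤ n → |(m : ℝ) * ψ| < 1 / 16 := by
      intro m hm
      rw [abs_mul, Nat.abs_cast]
      have hmn : (m : ℝ) ≤ n := by exact_mod_cast hm
      calc (m : ℝ) * |ψ| ≤ n * (2 * b) := by gcongr
        _ < _ := by linarith
    have hS0 : S = 0 := by
      refine Finset.sum_eq_zero fun m hm => ?_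
      have hm' := Finset.mem_range.1 hm
      have h1 := hmψ m hm'.le
      have h2 := hmψ (m + 1) hm'
      push_cast at h2
      rw [cosSignChange_eq_zero hc h1 (by rwa [add_one_mul] at h2),
        cosSignChange_eq_zero hc (by rwa [abs_neg])
          (by rwa [← neg_add, abs_neg, ← add_one_mul]), add_zero]
    rw [hS0, indicator_of_mem hφG, indicator_of_mem hsσ]
    simp only [Pi.one_apply]
    linarith
  · have hind : G.indicator (1 : ℝ → ℝ) φ * (Icc (-(σ * b ^ 3)) (σ * b ^ 3)).indicator 1 s = 0 := by
      by_cases h : φ ∈ G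
      · rw [indicator_of_notMem (fun h' => hφ ⟨h, h'⟩), mul_zero]
      · rw [indicator_of_notMem h, zero_mul]
    rw [hind, sub_zero]
    by_cases hgood : ∀ m ≤ n, comparisonConst n * b ^ 2 < |Real.cos (n * φ + m * ψ)| ∧
      comparisonConst n * b ^ 2 < |Real.cos (n * φ + -(m * ψ))|
    · have := card_zeros_lineDerivs_le hn hb hb1 hsm ha hs hgood T' hT'
      linarith
    -- On an exceptional line the count falls back on the algebraic bound `2 n`.
    · have hQ1 : 1 ≤ Q := by
        push Not at hgood
        obtain ⟨m, hm, hbad⟩ := hgood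
        refine le_trans ?_ (Finset.single_le_sum hQterm (Finset.mem_range.2 (by omega : m < n + 1)))
        by_cases h1 : comparisonConst n * b ^ 2 < |Real.cos (n * φ + m * ψ)|
        · have h2 : cosSmall (comparisonConst n * b ^ 2) (n * φ + -(m * ψ)) = 1 := if_pos (hbad h1)
          rw [h2]; linarith [cosSmall_nonneg (comparisonConst n * b ^ 2) (n * φ + m * ψ)]
        · have h2 : cosSmall (comparisonConst n * b ^ 2) (n * φ + m * ψ) = 1 :=
            if_pos (not_lt.1 h1)
          rw [h2]; linarith [cosSmall_nonneg (comparisonConst n * b ^ 2) (n * φ + -(m * ψ))]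
      have hS2 : S ≤ 2 * n := by
        calc S ≤ ∑ m ∈ Finset.range n, (1 + 1 : ℝ) := Finset.sum_le_sum fun m _ =>
              add_le_add (cosSignChange_le_one _ _) (cosSignChange_le_one _ _)
          _ = 2 * n := by simp; ring
      have hcard : T'.card ≤ 2 * n := by
        rw [hT'c]
        have := card_lemniscate_line_le (p := perturbedPoly n a) (by omega) φ s T
          fun z hz => ⟨(hT z hz).1.1, (hT z hz).2⟩
        rwa [hdeg] at this
      have hcard' : (T'.card : ℝ) ≤ 2 * n := by exact_mod_cast hcard
      have h3 : 3 * (n : ℝ) * 1 ≤ 3 * n * Q := by gcongr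
      linarith

theorem perturbedPoly_natDegree {n : ℕ} (hn : 2 ≤ n) (a : ℕ → ℂ) :
    (perturbedPoly n a).natDegree = n := by
  have h : (∑ k ∈ Finset.Icc 2 n, Polynomial.C (a k) * Polynomial.X ^ (n - k)).degree < (n : WithBot ℕ) := by
    refine (Polynomial.degree_sum_le _ _).trans_lt ?_
    refine (Finset.sup_lt_iff (WithBot.bot_lt_coe n)).2 ?_
    intro k hk
    have hk' := Finset.mem_Icc.1 hk
    refine (Polynomial.degree_C_mul_X_pow_le _ _).trans_lt ?_
    have h1 : n - k < n := by omega
    exact Nat.cast_lt.2 h1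
  have h0 : (extremalPoly n).degree = n := by
    unfold extremalPoly
    exact Polynomial.degree_X_pow_sub_C (R := ℂ) (by omega) 1
  have h1 : (perturbedPoly n a).degree = n := by
    unfold perturbedPoly
    rw [Polynomial.degree_add_eq_left_of_degree_lt (by rwa [h0]), h0]
  exact Polynomial.natDegree_eq_of_degree_eq_some h1

/-- The length of the lemniscate inside the disc of radius `b ^ 2`. -/
theorem hausdorffMeasure_lemniscate_inner_le {n : ℕ} (hn : 2 ≤ n) :
    ∃ c C b₀ : ℝ, 0 < c ∧ 0 < C ∧ 0 < b₀ ∧ ∀ (a : ℕ → ℂ) (b : ℝ), 0 < b → b ≤ b₀ →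
      (∀ i ∈ Finset.Icc 2 n, ‖a i‖ ≤ (b ^ 3) ^ i) →
      (∃ k ∈ Finset.Icc 2 n, ‖a k‖ = (b ^ 3) ^ k) → (a n).im = 0 →
      Measure.hausdorffMeasure 1 (lemniscate (perturbedPoly n a) ∩ Metric.ball 0 (b ^ 2)) ≤
        ENNReal.ofReal (2 * n * b ^ 2 - c * b ^ 3 + C * b ^ 4) := by
  obtain ⟨σ, b₀, hσ, hσ1, hb₀, hb₀1, hgain⟩ := exists_hasGain hn
  have hcc := comparisonConst_nonneg n
  have hpi := Real.pi_pos
  have hn0 : (0 : ℝ) < n := by exact_mod_cast (by omega : 0 < n)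
  -- The strip `|s| ≤ σ b ^ 3` times the directions in `G` has measure at least `2 σ b ^ 3 * π /
  -- 16`, and Crofton's inequality halves it.
  refine ⟨σ * (Real.pi / 16), 6 * n * (n + 1) * Real.pi * comparisonConst n + 1,
    min b₀ (1 / (64 * n)), by positivity, by positivity, lt_min hb₀ (by positivity), ?_⟩
  intro a b hb hbb ha hex him
  have hb1 : b ≤ 1 := (hbb.trans (min_le_left _ _)).trans hb₀1
  have hbn : 64 * n * b ≤ 1 := by
    have := hbb.trans (min_le_right _ _)
    rw [le_div_iff₀ (by positivity)] at this
    linarith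
  have hsm : n * (2 * b ^ 2) ^ n ≤ 1 / 2 := by
    have h1 : b ≤ 1 / 64 := by
      have : (1 : ℝ) ≤ n := by exact_mod_cast (by omega : 1 ≤ n)
      nlinarith
    have h2 : (2 * b ^ 2) ^ n ≤ 2 * b ^ 2 :=
      pow_le_of_le_one (by positivity) (by nlinarith) (by omega)
    calc n * (2 * b ^ 2) ^ n ≤ n * (2 * b ^ 2) := by gcongr
      _ ≤ 1 / 2 := by nlinarith
  obtain ⟨G, hGm, hGv, hG⟩ := hgain a b hb (hbb.trans (min_le_left _ _)) hsm ha hex him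
  have hdeg := perturbedPoly_natDegree hn a
  have hpt : ∀ φ s : ℝ, s ∈ Ioo (-b ^ 2) (b ^ 2) → ∀ T : Finset ℂ,
      (∀ z ∈ T, z ∈ lemniscate (perturbedPoly n a) ∩ Metric.ball 0 (b ^ 2) ∧
      (Complex.exp (-(φ * Complex.I)) * z).im = s) →
      (T.card : ℝ) ≤ lineCount n (comparisonConst n * b ^ 2) (b ^ 2) (σ * b ^ 3) G φ s :=
    fun φ s hs T hT => card_le_lineCount hn hb hb1 (by linarith) hσ1 hsm hdeg ha hG hs T hT
  have hder : (perturbedPoly n a).derivative ≠ 0 := by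
    intro h
    rw [Polynomial.derivative_eq_zero] at h
    omega
  have h1 := two_mul_hausdorffMeasure_lemniscate_inter_le hder
    (measurableSet_ball (x := (0 : ℂ)) (ε := b ^ 2))
    (fun φ s => (Ioo (-b ^ 2) (b ^ 2)).indicator (fun s => ENNReal.ofReal
      (lineCount n (comparisonConst n * b ^ 2) (b ^ 2) (σ * b ^ 3) G φ s)) s) (by
      intro φ s T hT
      rcases T.eq_empty_or_nonempty with rfl | ⟨z, hz⟩
      · simp
      have hs : s ∈ Ioo (-b ^ 2) (b ^ 2) := by
        obtain ⟨⟨-, h1⟩, h2⟩ := hT z hz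
        rw [← h2, mem_Ioo, ← abs_lt]
        refine (Complex.abs_im_le_norm _).trans_lt ?_
        rw [norm_mul, ← neg_mul, ← Complex.ofReal_neg, Complex.norm_exp_ofReal_mul_I, one_mul]
        simpa using h1
      rw [indicator_of_mem hs, ← ENNReal.ofReal_natCast]
      exact ENNReal.ofReal_le_ofReal (hpt φ s hs T hT))
  simp only [lintegral_indicator measurableSet_Ioo] at h1
  have h2 := lintegral_lineCount_le (n := n) (κ := comparisonConst n * b ^ 2) (r := b ^ 2)
    (σ := σ * b ^ 3) (by omega) (by positivity) (by positivity) (by positivity) (by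
      have hlt : b < 1 := by
        have : (1 : ℝ) ≤ n := by exact_mod_cast (by omega : 1 ≤ n)
        nlinarith
      calc σ * b ^ 3 ≤ 1 * b ^ 3 := by gcongr
        _ < b ^ 2 := by rw [one_mul]; exact pow_lt_pow_right_of_lt_one₀ hb hlt (by norm_num)) hGm hGv (fun φ s hs => by simpa using hpt φ s hs ∅ (by simp))
  have h3 := h1.trans h2
  have h4 : ENNReal.ofReal (4 * n * b ^ 2 + 12 * n * (n + 1) * Real.pi *
      (comparisonConst n * b ^ 2) * b ^ 2 - 2 * (σ * b ^ 3) * (Real.pi / 16)) ≤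
      2 * ENNReal.ofReal (2 * n * b ^ 2 - σ * (Real.pi / 16) * b ^ 3 +
        (6 * n * (n + 1) * Real.pi * comparisonConst n + 1) * b ^ 4) := by
    rw [← ENNReal.ofReal_ofNat, ← ENNReal.ofReal_mul (by norm_num)]
    refine ENNReal.ofReal_le_ofReal ?_
    have : 0 < b ^ 4 := by positivity
    nlinarith
  exact (ENNReal.mul_le_mul_iff_right (by norm_num) (by norm_num)).1 (h3.trans h4)

/-! ### Length outside the small disc -/

theorem sum_Icc_two_half_pow_le (n : ℕ) : ∑ k ∈ Finset.Icc 2 n, (1 / 2 : ℝ) ^ k ≤ 1 / 2 := by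
  have h : ∀ n : ℕ, 1 ≤ n → ∑ k ∈ Finset.Icc 2 n, (1 / 2 : ℝ) ^ k = 1 / 2 - (1 / 2) ^ n := by
    intro n hn
    induction n, hn using Nat.le_induction with
    | base => simp
    | succ n hn ih => rw [Finset.sum_Icc_succ_top (by omega), ih]; ring
  rcases Nat.eq_zero_or_pos n with rfl | hn
  · simp
  · rw [h n hn]; linarith [pow_pos (by norm_num : (0 : ℝ) < 1 / 2) n]

/-- The `n`-th root of `z ^ n + ∑ a_k z ^ (n - k)` near infinity, tangent to the identity. -/
theorem exists_root_near_infinity {n : ℕ} (hn : 2 ≤ n) {a : ℕ → ℂ} {A : ℝ} (hA : 0 < A)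
    (ha : ∀ k ∈ Finset.Icc 2 n, ‖a k‖ ≤ A ^ k) :
    ∃ Φ : ℂ → ℂ, (∀ z, 4 * A < ‖z‖ → Φ z ^ n = (liftedPoly n a).eval z) ∧
      (∀ z, 4 * A < ‖z‖ → ‖Φ z - z‖ ≤ 24 * A ^ 2 / ‖z‖) ∧
      ∀ ρ, 4 * A < ρ → ∀ z w, ρ ≤ ‖z‖ → ρ ≤ ‖w‖ →
        ‖(Φ z - z) - (Φ w - w)‖ ≤ 24 * A ^ 2 / ρ ^ 2 * ‖z - w‖ := by
  have hn0 : (n : ℝ) ≠ 0 := by exact_mod_cast (by omega : n ≠ 0)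
  -- In the variable `u = 1 / z`, `|u| < R` gives `A |u| ≤ 1 / 2`, so `|e u| ≤ ∑_{k ≥ 2} 2 ^ (-k) ≤
  -- 1 / 2` and the principal root is holomorphic.
  set R : ℝ := 1 / (2 * A) with hR
  have hR0 : 0 < R := by positivity
  set e : ℂ → ℂ := fun u => ∑ k ∈ Finset.Icc 2 n, a k * u ^ k with he
  have hen : ∀ u ∈ Metric.ball (0 : ℂ) R, ‖e u‖ ≤ 1 / 2 := by
    intro u hu
    have hu' : A * ‖u‖ ≤ 1 / 2 := by
      have h1 : ‖u‖ < 1 / (2 * A) := mem_ball_zero_iff.1 hu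
      rw [lt_div_iff₀ (by positivity)] at h1
      linarith
    refine (norm_sum_le _ _).trans (le_trans (Finset.sum_le_sum fun k hk => ?_)
      (sum_Icc_two_half_pow_le n))
    rw [norm_mul, norm_pow]
    calc ‖a k‖ * ‖u‖ ^ k ≤ A ^ k * ‖u‖ ^ k := by gcongr; exact ha k hk
      _ = (A * ‖u‖) ^ k := by rw [mul_pow]
      _ ≤ (1 / 2) ^ k := by gcongr
  set F : ℂ → ℂ := fun u => (1 + e u) ^ ((n : ℂ)⁻¹) with hF
  have hslit : ∀ u ∈ Metric.ball (0 : ℂ) R, 1 + e u ∈ Complex.slitPlane := fun u hu =>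
    Complex.mem_slitPlane_of_norm_lt_one (by linarith [hen u hu])
  have hed : ∀ u, HasDerivAt e (∑ k ∈ Finset.Icc 2 n, a k * (k * u ^ (k - 1))) u := by
    intro u
    refine HasDerivAt.fun_sum fun k _ => ?_
    simpa using (hasDerivAt_pow k u).const_mul (a k)
  have hFd : ∀ u ∈ Metric.ball (0 : ℂ) R, HasDerivAt F ((n : ℂ)⁻¹ * (1 + e u) ^ ((n : ℂ)⁻¹ - 1) *
      ∑ k ∈ Finset.Icc 2 n, a k * (k * u ^ (k - 1))) u := fun u hu =>
    ((hed u).const_add 1).cpow_const (hslit u hu)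
  have hFdiff : DifferentiableOn ℂ F (Metric.ball 0 R) := fun u hu =>
    (hFd u hu).differentiableAt.differentiableWithinAt
  have h0mem : (0 : ℂ) ∈ Metric.ball (0 : ℂ) R := Metric.mem_ball_self hR0
  have he0 : e 0 = 0 := by
    refine Finset.sum_eq_zero fun k hk => ?_
    rw [zero_pow (by have := (Finset.mem_Icc.1 hk).1; omega), mul_zero]
  have hF0 : F 0 = 1 := by simp [hF, he0]
  have hF'0 : deriv F 0 = 0 := by
    rw [(hFd 0 h0mem).deriv]
    have : ∑ k ∈ Finset.Icc 2 n, a k * (k * (0 : ℂ) ^ (k - 1)) = 0 := by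
      refine Finset.sum_eq_zero fun k hk => ?_
      rw [zero_pow (by have := (Finset.mem_Icc.1 hk).1; omega), mul_zero, mul_zero]
    rw [this, mul_zero]
  have hFn : MapsTo F (Metric.ball 0 R) (Metric.closedBall (F 0) 3) := by
    intro u hu
    rw [hF0, mem_closedBall_iff_norm]
    have h1 : ‖F u‖ ≤ 2 := by
      have h2 : ‖1 + e u‖ ≤ 2 := (norm_add_le _ _).trans (by
        rw [norm_one]; linarith [hen u hu])
      have h3 : ((n : ℂ)⁻¹) = (((n : ℝ)⁻¹ : ℝ) : ℂ) := by push_cast; rfl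
      simp only [hF]
      rw [h3, Complex.norm_cpow_real]
      calc ‖1 + e u‖ ^ ((n : ℝ)⁻¹) ≤ 2 ^ ((n : ℝ)⁻¹) := by gcongr
        _ ≤ 2 ^ (1 : ℝ) := by
            refine Real.rpow_le_rpow_of_exponent_le (by norm_num) ?_
            exact inv_le_one_of_one_le₀ (by exact_mod_cast (by omega : 1 ≤ n))
        _ = 2 := by norm_num
    calc ‖F u - 1‖ ≤ ‖F u‖ + ‖(1 : ℂ)‖ := norm_sub_le _ _
      _ ≤ 3 := by rw [norm_one]; linarith
  -- `G u = (F u - 1) / u`, so `z F (1 / z) = z + G (1 / z)`. Schwarz's lemma gives `3 / R = 6 A`,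
  -- and Cauchy's estimate at radius `R / 2` then gives the Lipschitz constant `24 A ^ 2`. The
  -- missing term `k = 1` makes `G 0 = 0`.
  set G := dslope F 0 with hG
  have hGd : DifferentiableOn ℂ G (Metric.ball 0 R) :=
    (Complex.differentiableOn_dslope (Metric.isOpen_ball.mem_nhds h0mem)).2 hFdiff
  have hGn : ∀ u ∈ Metric.ball (0 : ℂ) R, ‖G u‖ ≤ 6 * A := by
    intro u hu
    have := Complex.norm_dslope_le_div_of_mapsTo_ball hFdiff hFn hu
    refine this.trans (le_of_eq ?_)
    rw [hR]; field_simp; norm_num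
  have hG0 : G 0 = 0 := by rw [hG, dslope_same, hF'0]
  have hGder : ∀ u ∈ Metric.ball (0 : ℂ) (R / 2), ‖deriv G u‖ ≤ 24 * A ^ 2 := by
    intro u hu
    have hcl : Metric.closedBall u (R / 2) ⊆ Metric.ball 0 R := by
      intro w hw
      have h1 : ‖w - u‖ ≤ R / 2 := by simpa [dist_eq_norm] using hw
      have h2 : ‖w‖ ≤ ‖w - u‖ + ‖u‖ := by simpa using norm_add_le (w - u) u
      have h3 : ‖u‖ < R / 2 := by simpa using hu
      simp only [Metric.mem_ball, dist_zero_right]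
      linarith
    have := Complex.norm_deriv_le_of_forall_mem_sphere_norm_le (f := G) (c := u) (R := R / 2)
      (C := 6 * A) (by positivity) (DifferentiableOn.diffContOnCl (hGd.mono (by
        rw [closure_ball _ (by positivity : R / 2 ≠ 0)]; exact hcl)))
      (fun w hw => hGn w (hcl (Metric.sphere_subset_closedBall hw)))
    refine this.trans (le_of_eq ?_)
    rw [hR]; field_simp; norm_num
  have hGlip : ∀ u ∈ Metric.ball (0 : ℂ) (R / 2), ∀ v ∈ Metric.ball (0 : ℂ) (R / 2),
      ‖G u - G v‖ ≤ 24 * A ^ 2 * ‖u - v‖ := by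
    intro u hu v hv
    refine Convex.norm_image_sub_le_of_norm_deriv_le (𝕜 := ℂ) (fun w hw => ?_) hGder
      (convex_ball _ _) hv hu
    exact hGd.differentiableAt (Metric.isOpen_ball.mem_nhds
      (Metric.ball_subset_ball (by linarith) hw))
  have hinv : ∀ z : ℂ, 4 * A < ‖z‖ → z⁻¹ ∈ Metric.ball (0 : ℂ) (R / 2) ∧ z ≠ 0 := by
    intro z hz
    have hz0 : 0 < ‖z‖ := lt_trans (by positivity) hz
    refine ⟨?_, norm_pos_iff.1 hz0⟩
    simp only [Metric.mem_ball, dist_zero_right, norm_inv]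
    rw [hR, div_div, inv_lt_comm₀ hz0 (by positivity)]
    simp only [one_div, inv_inv]
    linarith
  refine ⟨fun z => z + G z⁻¹, ?_, ?_, ?_⟩
  · intro z hz
    obtain ⟨hzi, hz0⟩ := hinv z hz
    have h1 : F z⁻¹ = 1 + z⁻¹ * G z⁻¹ := by
      have := sub_smul_dslope F 0 z⁻¹
      rw [hF0, sub_zero, smul_eq_mul] at this
      rw [hG, this]; ring
    have h2 : z + G z⁻¹ = z * F z⁻¹ := by rw [h1]; field_simp
    have h3 : F z⁻¹ ^ n = 1 + e z⁻¹ := Complex.cpow_nat_inv_pow _ (by omega)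
    have h4 := eval_iterate_derivative_liftedPoly n a 0 z
    simp only [Function.iterate_zero, id, Nat.descFactorial_zero, Nat.cast_one, one_mul,
      tsub_zero] at h4
    simp only
    rw [h2, mul_pow, h3, h4, mul_add, mul_one, he, Finset.mul_sum]
    congr 1
    refine Finset.sum_congr rfl fun k hk => ?_
    have hk' := (Finset.mem_Icc.1 hk).2
    have : z ^ n = z ^ (n - k) * z ^ k := by rw [← pow_add, Nat.sub_add_cancel hk']
    rw [this, inv_pow]; field_simp
  · intro z hz
    have h := hGlip _ (hinv z hz).1 0 (Metric.mem_ball_self (by positivity))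
    rw [hG0, sub_zero, sub_zero, norm_inv] at h
    simpa [div_eq_mul_inv] using h
  · intro ρ hρ z w hz hw
    have hz' := hinv z (hρ.trans_le hz)
    have hw' := hinv w (hρ.trans_le hw)
    have h := hGlip _ hz'.1 _ hw'.1
    have hρ0 : 0 < ρ := lt_trans (by positivity) hρ
    simp only [add_sub_cancel_left]
    refine h.trans ?_
    rw [inv_sub_inv hz'.2 hw'.2, norm_div, norm_mul, norm_sub_rev, div_mul_eq_mul_div,
      mul_div_assoc]
    gcongr
    rw [sq]; gcongr

theorem mem_lemniscate_extremalPoly_of_pow_eq {n : ℕ} {a : ℕ → ℂ} {z w : ℂ}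
    (h : w ^ n = (liftedPoly n a).eval z) (hz : z ∈ lemniscate (perturbedPoly n a)) :
    w ∈ lemniscate (extremalPoly n) := by
  have hz' : ‖(perturbedPoly n a).eval z‖ = 1 := hz
  rw [perturbedPoly_eq, Polynomial.eval_sub, Polynomial.eval_one, ← h] at hz'
  simpa [lemniscate, extremalPoly] using hz'

/-- Comparison of the lemniscates outside the disc of radius `r`. -/
theorem hausdorffMeasure_lemniscate_outer_le {n : ℕ} (hn : 2 ≤ n) {a : ℕ → ℂ} {A r : ℝ}
    (hA : 0 < A) (ha : ∀ k ∈ Finset.Icc 2 n, ‖a k‖ ≤ A ^ k) (hr : 8 * A ≤ r) :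
    Measure.hausdorffMeasure 1 (lemniscate (perturbedPoly n a) \ Metric.ball 0 r) ≤
      Measure.hausdorffMeasure 1 (lemniscate (extremalPoly n) \ Metric.ball 0 (r - 24 * A ^ 2 / r))
        + ENNReal.ofReal (192 * Real.pi * n * A ^ 2 / r) := by
  have hr0 : 0 < r := by linarith
  have hAr : 24 * A ^ 2 / r ^ 2 < 1 := by
    rw [div_lt_one (by positivity)]; nlinarith
  obtain ⟨Φ, hΦ1, hΦ2, hΦ3⟩ := exists_root_near_infinity hn hA ha
  set p := perturbedPoly n a with hp
  have hdeg : p.natDegree = n := perturbedPoly_natDegree hn a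
  have hexpand : ∀ ρ, r ≤ ρ → ∀ z w, ρ ≤ ‖z‖ → ρ ≤ ‖w‖ →
      (1 - 24 * A ^ 2 / ρ ^ 2) * dist z w ≤ dist (Φ z) (Φ w) := by
    intro ρ hρ z w hz hw
    have h := hΦ3 ρ (by linarith) z w hz hw
    rw [dist_eq_norm, dist_eq_norm]
    have h2 : z - w = (Φ z - Φ w) - ((Φ z - z) - (Φ w - w)) := by ring
    have h3 : ‖z - w‖ ≤ ‖Φ z - Φ w‖ + ‖(Φ z - z) - (Φ w - w)‖ := by
      nth_rewrite 1 [h2]; exact norm_sub_le _ _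
    linarith
  have hinj : InjOn Φ {z | r ≤ ‖z‖} := by
    intro z hz w hw hzw
    have := hexpand r le_rfl z w hz hw
    rw [hzw, dist_self] at this
    refine dist_le_zero.1 ?_
    by_contra! hcon
    nlinarith [mul_pos (sub_pos.2 hAr) hcon]
  have hcont : ContinuousOn Φ {z | r ≤ ‖z‖} := by
    have hlip : LipschitzOnWith (Real.toNNReal 2) Φ {z | r ≤ ‖z‖} := by
      refine LipschitzOnWith.of_dist_le_mul fun z hz w hw => ?_
      have h := hΦ3 r (by linarith) z w hz hw
      rw [dist_eq_norm, dist_eq_norm, Real.coe_toNNReal _ (by norm_num)]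
      have h2 : Φ z - Φ w = (z - w) + ((Φ z - z) - (Φ w - w)) := by ring
      rw [h2]
      refine (norm_add_le _ _).trans ?_
      nlinarith [norm_nonneg (z - w)]
    exact hlip.continuousOn
  -- A single expansion factor `1 - 24 A ^ 2 / r ^ 2` for the whole exterior would lose too much; on
  -- dyadic annuli the factor improves with the distance.
  set D : ℕ → Set ℂ := fun j => lemniscate p ∩ {z | 2 ^ j * r ≤ ‖z‖ ∧ ‖z‖ < 2 ^ (j + 1) * r}
    with hD
  have hDr : ∀ j, D j ⊆ {z | r ≤ ‖z‖} := by
    rintro j z ⟨-, hz, -⟩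
    exact le_trans (by nlinarith [one_le_pow₀ (by norm_num : (1 : ℝ) ≤ 2) (n := j)]) hz
  have hDm : ∀ j, MeasurableSet (D j) := fun j =>
    (measurableSet_lemniscate p).inter ((measurableSet_le measurable_const measurable_norm).inter
      (measurableSet_lt measurable_norm measurable_const))
  have hcover : lemniscate p \ Metric.ball 0 r ⊆ ⋃ j, D j := by
    rintro z ⟨hz, hzr⟩
    have hzr' : r ≤ ‖z‖ := by simpa using hzr
    obtain ⟨j, hj1, hj2⟩ := exists_nat_pow_near (x := ‖z‖ / r) (y := (2 : ℝ))
      (by rwa [le_div_iff₀ hr0, one_mul]) (by norm_num)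
    rw [le_div_iff₀ hr0] at hj1
    rw [div_lt_iff₀ hr0] at hj2
    exact mem_iUnion.2 ⟨j, hz, hj1, hj2⟩
  have hDd : Pairwise (Function.onFun Disjoint D) := by
    intro i j hij
    wlog h : i < j generalizing i j
    · exact (this hij.symm (lt_of_le_of_ne (not_lt.1 h) hij.symm)).symm
    refine Set.disjoint_left.2 fun z hz1 hz2 => ?_
    have h1 := hz1.2.2
    have h2 := hz2.2.1
    have h3 : (2 : ℝ) ^ (i + 1) ≤ 2 ^ j := pow_le_pow_right₀ (by norm_num) h
    nlinarith
  have himd : Pairwise (Function.onFun Disjoint fun j => Φ '' D j) := by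
    intro i j hij
    refine Set.disjoint_left.2 ?_
    rintro _ ⟨z, hz, rfl⟩ ⟨w, hw, hzw⟩
    have := hinj (hDr j hw) (hDr i hz) hzw
    subst this
    exact Set.disjoint_left.1 (hDd hij) hz hw
  have himm : ∀ j, MeasurableSet (Φ '' D j) := fun j =>
    (hDm j).image_of_continuousOn_injOn (hcont.mono (hDr j)) (hinj.mono (hDr j))
  have himsub : ⋃ j, Φ '' D j ⊆ lemniscate (extremalPoly n) \
      Metric.ball 0 (r - 24 * A ^ 2 / r) := by
    refine iUnion_subset fun j => ?_
    rintro _ ⟨z, hz, rfl⟩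
    have hzr : r ≤ ‖z‖ := hDr j hz
    refine ⟨mem_lemniscate_extremalPoly_of_pow_eq (hΦ1 z (by linarith)) hz.1, ?_⟩
    simp only [Metric.mem_ball, dist_zero_right, not_lt]
    have h1 := hΦ2 z (by linarith)
    have h2 : ‖z‖ ≤ ‖Φ z‖ + ‖Φ z - z‖ := by
      have : z = Φ z - (Φ z - z) := by ring
      nth_rewrite 1 [this]; exact norm_sub_le _ _
    have h3 : 24 * A ^ 2 / ‖z‖ ≤ 24 * A ^ 2 / r := by gcongr
    linarith
  set K : ℝ := 96 * Real.pi * n * A ^ 2 / r with hK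
  have hK0 : 0 ≤ K := by positivity
  have hpiece : ∀ j, Measure.hausdorffMeasure 1 (D j) ≤ Measure.hausdorffMeasure 1 (Φ '' D j) +
      ENNReal.ofReal (K * (1 / 2) ^ j) := by
    intro j
    set ρ := 2 ^ j * r with hρ
    have hρr : r ≤ ρ := by
      rw [hρ]; nlinarith [one_le_pow₀ (by norm_num : (1 : ℝ) ≤ 2) (n := j)]
    have hρ0 : 0 < ρ := by linarith
    set θ := 24 * A ^ 2 / ρ ^ 2 with hθ
    have hθ0 : 0 ≤ θ := by positivity
    have hθ1 : θ < 1 := lt_of_le_of_lt (by rw [hθ]; gcongr) hAr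
    have h1 := mul_hausdorffMeasure_le_image Φ (D j) (sub_pos.2 hθ1)
      (fun z hz w hw => hexpand ρ hρr z w hz.2.1 hw.2.1)
    have h2 : Measure.hausdorffMeasure 1 (D j) ≤
        ENNReal.ofReal (2 * Real.pi * n * (2 ^ (j + 1) * r)) := by
      have h3 := hausdorffMeasure_lemniscate_inter_ball_le (p := p) (by omega)
        (ρ := 2 ^ (j + 1) * r) (by positivity)
      rw [hdeg] at h3
      refine (measure_mono ?_).trans h3
      rintro z ⟨hz, -, hz2⟩
      exact ⟨hz, by simpa using hz2⟩
    -- The lost fraction `θ` multiplies a length `O(ρ)`, leaving `K / 2 ^ j`.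
    calc Measure.hausdorffMeasure 1 (D j)
        = ENNReal.ofReal (1 - θ) * Measure.hausdorffMeasure 1 (D j)
          + ENNReal.ofReal θ * Measure.hausdorffMeasure 1 (D j) := by
          rw [← add_mul, ← ENNReal.ofReal_add (by linarith) hθ0, sub_add_cancel,
            ENNReal.ofReal_one, one_mul]
      _ ≤ _ := by
          refine add_le_add h1 ((mul_le_mul_right h2 _).trans ?_)
          rw [← ENNReal.ofReal_mul hθ0]
          refine ENNReal.ofReal_le_ofReal (le_of_eq ?_)
          rw [hθ, hK, hρ, one_div, inv_pow]
          field_simp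
          ring
  calc Measure.hausdorffMeasure 1 (lemniscate p \ Metric.ball 0 r)
      ≤ ∑' j, Measure.hausdorffMeasure 1 (D j) := (measure_mono hcover).trans (measure_iUnion_le D)
    _ ≤ ∑' j, (Measure.hausdorffMeasure 1 (Φ '' D j) + ENNReal.ofReal (K * (1 / 2) ^ j)) :=
        ENNReal.tsum_le_tsum hpiece
    _ = Measure.hausdorffMeasure 1 (⋃ j, Φ '' D j) + ENNReal.ofReal (2 * K) := by
        rw [ENNReal.tsum_add, measure_iUnion himd himm, ← ENNReal.ofReal_tsum_of_nonneg
          (fun j => by positivity) (summable_geometric_two.mul_left K), tsum_mul_left,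
          tsum_geometric_two, mul_comm K 2]
    _ ≤ _ := by
        refine add_le_add (measure_mono himsub) (ENNReal.ofReal_le_ofReal (le_of_eq ?_))
        rw [hK]; ring

/-! ### The extremal lemniscate near the origin -/

/-- The `2 n` arcs of the extremal lemniscate issuing from the origin. -/
noncomputable def extremalArc (n : ℕ) (i : Fin n × Bool) (t : ℝ) : ℂ :=
  t * Complex.exp (((if i.2 then 1 else -1) * Real.arccos (t ^ n / 2) / n : ℝ) * Complex.I) *
    Complex.exp (2 * Real.pi * Complex.I / n) ^ (i.1 : ℕ)

theorem norm_extremalArc (n : ℕ) (i : Fin n × Bool) {t : ℝ} (ht : 0 ≤ t) :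
    ‖extremalArc n i t‖ = t := by
  have h : Complex.exp (2 * Real.pi * Complex.I / n) =
      Complex.exp (((2 * Real.pi / n : ℝ) : ℂ) * Complex.I) := by congr 1; push_cast; ring
  unfold extremalArc
  rw [h, norm_mul, norm_mul, norm_pow, Complex.norm_exp_ofReal_mul_I, Complex.norm_exp_ofReal_mul_I,
    Complex.norm_real, Real.norm_of_nonneg ht]; simp

theorem extremalArc_pow {n : ℕ} (hn : n ≠ 0) (i : Fin n × Bool) (t : ℝ) :
    extremalArc n i t ^ n = ((t ^ n : ℝ) : ℂ) *
      Complex.exp (((if i.2 then 1 else -1) * Real.arccos (t ^ n / 2) : ℝ) * Complex.I) := by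
  have hn' : (n : ℂ) ≠ 0 := by exact_mod_cast hn
  have h1 := (Complex.isPrimitiveRoot_exp n hn).pow_eq_one
  unfold extremalArc
  rw [mul_pow, mul_pow, ← pow_mul, mul_comm (i.1 : ℕ) n, pow_mul, h1, one_pow, mul_one,
    ← Complex.exp_nat_mul]
  push_cast
  congr 2
  field_simp

theorem extremalArc_mem {n : ℕ} (hn : n ≠ 0) (i : Fin n × Bool) {t : ℝ} (ht : t ∈ Icc (0 : ℝ) 1) :
    extremalArc n i t ∈ lemniscate (extremalPoly n) := by
  have h0 : 0 ≤ t ^ n := pow_nonneg ht.1 n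
  have h1 : t ^ n ≤ 1 := pow_le_one₀ ht.1 ht.2
  have hc : Real.cos ((if i.2 then 1 else -1) * Real.arccos (t ^ n / 2)) = t ^ n / 2 := by
    split_ifs
    · rw [one_mul, Real.cos_arccos (by linarith) (by linarith)]
    · rw [neg_one_mul, Real.cos_neg, Real.cos_arccos (by linarith) (by linarith)]
  change ‖(extremalPoly n).eval (extremalArc n i t)‖ = 1
  have he : (extremalPoly n).eval (extremalArc n i t) = extremalArc n i t ^ n - 1 := by
    simp [extremalPoly]
  rw [he, extremalArc_pow hn]
  set θ := (if i.2 then 1 else -1) * Real.arccos (t ^ n / 2)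
  set x := t ^ n
  have hsq : ‖(x : ℂ) * Complex.exp (θ * Complex.I) - 1‖ ^ 2 = 1 := by
    rw [← Complex.normSq_eq_norm_sq, Complex.normSq_apply, Complex.sub_re, Complex.sub_im,
      Complex.re_ofReal_mul, Complex.im_ofReal_mul, Complex.exp_ofReal_mul_I_re,
      Complex.exp_ofReal_mul_I_im, Complex.one_re, Complex.one_im, hc]
    have := Real.sin_sq_add_cos_sq θ
    rw [hc] at this
    linear_combination x ^ 2 * this
  exact (pow_eq_one_iff_of_nonneg (norm_nonneg _) two_ne_zero).1 hsq

/-- In polar coordinates the lemniscate is `2 cos (n θ) = t ^ n`. The modulus does not increase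
distances, so each of the `2 n` disjoint arcs is at least as long as its range of moduli. -/
theorem le_hausdorffMeasure_extremal_inter_ball {n : ℕ} (hn : n ≠ 0) {ρ : ℝ}
    (hρ : ρ ≤ 1) : ENNReal.ofReal (2 * n * ρ) ≤
      Measure.hausdorffMeasure 1 (lemniscate (extremalPoly n) ∩ Metric.ball 0 ρ) := by
  set S : Fin n × Bool → Set ℂ := fun i => extremalArc n i '' Ioo 0 ρ with hS
  have hinj : ∀ i, InjOn (extremalArc n i) (Ioo 0 ρ) := by
    intro i s hs t ht hst
    rw [← norm_extremalArc n i hs.1.le, hst, norm_extremalArc n i ht.1.le]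
  have hSm : ∀ i, MeasurableSet (S i) := by
    intro i
    refine measurableSet_Ioo.image_of_continuousOn_injOn (Continuous.continuousOn ?_) (hinj i)
    unfold extremalArc
    have : Continuous fun t : ℝ => Real.arccos (t ^ n / 2) :=
      Real.continuous_arccos.comp (by fun_prop)
    fun_prop
  have hSd : Pairwise (Function.onFun Disjoint S) := by
    intro i j hij
    refine Set.disjoint_left.2 ?_
    rintro _ ⟨s, hs, rfl⟩ ⟨t, ht, hst⟩
    have hts : t = s := by
      rw [← norm_extremalArc n j ht.1.le, hst, norm_extremalArc n i hs.1.le]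
    subst hts
    have ht0 : (t : ℂ) ≠ 0 := by exact_mod_cast ht.1.ne'
    have hx0 : 0 < t ^ n := pow_pos ht.1 n
    have hx1 : t ^ n ≤ 1 := pow_le_one₀ ht.1.le (ht.2.le.trans hρ)
    have hsin : 0 < Real.sin (Real.arccos (t ^ n / 2)) := by
      rw [Real.sin_arccos]; exact Real.sqrt_pos.2 (by nlinarith)
    -- The sign of the imaginary part of the `n`-th power distinguishes the two signs of the angle;
    -- the roots of unity distinguish the rest.
    have h2 : i.2 = j.2 := by
      have hp : extremalArc n j t ^ n = extremalArc n i t ^ n := by rw [hst]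
      rw [extremalArc_pow hn, extremalArc_pow hn] at hp
      have h3 := mul_left_cancel₀ (by exact_mod_cast hx0.ne') hp
      have h4 := congrArg Complex.im h3
      rw [Complex.exp_ofReal_mul_I_im, Complex.exp_ofReal_mul_I_im] at h4
      by_contra hne
      rcases hi : i.2 <;> rcases hj : j.2 <;> rw [hi, hj] at h4 hne <;>
        simp [Real.sin_neg] at h4 hne <;> linarith
    have h1 : i.1 = j.1 := by
      unfold extremalArc at hst
      rw [h2] at hst
      have h3 := mul_left_cancel₀ (mul_ne_zero ht0 (Complex.exp_ne_zero _)) hst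
      exact (Fin.ext ((Complex.isPrimitiveRoot_exp n hn).pow_inj j.1.2 i.1.2 h3)).symm
    exact hij (Prod.ext h1 h2)
  have hSsub : ⋃ i, S i ⊆ lemniscate (extremalPoly n) ∩ Metric.ball 0 ρ := by
    refine iUnion_subset fun i => ?_
    rintro _ ⟨t, ht, rfl⟩
    refine ⟨extremalArc_mem hn i ⟨ht.1.le, ht.2.le.trans hρ⟩, ?_⟩
    rw [mem_ball_zero_iff, norm_extremalArc n i ht.1.le]
    exact ht.2
  have hSl : ∀ i, ENNReal.ofReal ρ ≤ Measure.hausdorffMeasure 1 (S i) := by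
    intro i
    have := mul_hausdorffMeasure_le_image (extremalArc n i) (Ioo 0 ρ) one_pos (fun s hs t ht => by
      have := abs_norm_sub_norm_le (extremalArc n i s) (extremalArc n i t)
      rwa [norm_extremalArc n i hs.1.le, norm_extremalArc n i ht.1.le, ← dist_eq_norm,
        ← Real.dist_eq, ← one_mul (dist s t)] at this)
    rwa [ENNReal.ofReal_one, one_mul, hausdorffMeasure_real, Real.volume_Ioo, sub_zero] at this
  refine le_trans ?_ (measure_mono hSsub)
  rw [measure_iUnion hSd hSm, tsum_fintype]
  refine le_trans (le_of_eq ?_) (Finset.sum_le_sum fun i _ => hSl i)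
  rw [Finset.sum_const, Finset.card_univ, Fintype.card_prod, Fintype.card_fin, Fintype.card_bool,
    nsmul_eq_mul, ← ENNReal.ofReal_natCast, ← ENNReal.ofReal_mul (by positivity)]
  congr 1; push_cast; ring

theorem extremalPoly_natDegree {n : ℕ} : (extremalPoly n).natDegree = n := by
  unfold extremalPoly
  exact Polynomial.natDegree_X_pow_sub_C (r := (1 : ℂ))

/-! ### The quantitative estimate -/

/-- The image of the outer part under `Φ` may enter the disc of radius `b ^ 2` by `24 b ^ 4`. So the
extremal lemniscate is cut at `ρ = b ^ 2 - 24 b ^ 4`, which costs `48 n b ^ 4`. -/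
theorem lemniscateLength_perturbedPoly_le {n : ℕ} (hn : 2 ≤ n) :
    ∃ c C b₀ : ℝ, 0 < c ∧ 0 < C ∧ 0 < b₀ ∧ ∀ (a : ℕ → ℂ) (b : ℝ), 0 < b → b ≤ b₀ →
      (∀ i ∈ Finset.Icc 2 n, ‖a i‖ ≤ (b ^ 3) ^ i) →
      (∃ k ∈ Finset.Icc 2 n, ‖a k‖ = (b ^ 3) ^ k) → (a n).im = 0 →
      (lemniscateLength (perturbedPoly n a)).toReal ≤
        (lemniscateLength (extremalPoly n)).toReal - c * b ^ 3 + C * b ^ 4 := by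
  obtain ⟨c, C, b₀, hc, hC, hb₀, H⟩ := hausdorffMeasure_lemniscate_inner_le hn
  have hn0 : (1 : ℝ) ≤ n := by exact_mod_cast (by omega : 1 ≤ n)
  refine ⟨c, C + 48 * n + 192 * Real.pi * n, min b₀ (min (1 / 8) (1 / c)), hc, by positivity,
    by positivity, fun a b hb hbb ha hex him => ?_⟩
  have hb1 : b ≤ b₀ := hbb.trans (min_le_left _ _)
  have hb8 : b ≤ 1 / 8 := hbb.trans ((min_le_right _ _).trans (min_le_left _ _))
  have hbc : b * c ≤ 1 :=
    (le_div_iff₀ hc).1 (hbb.trans ((min_le_right _ _).trans (min_le_right _ _)))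
  have hin := H a b hb hb1 ha hex him
  have hb2 : 0 < b ^ 2 := by positivity
  have hout := hausdorffMeasure_lemniscate_outer_le hn (a := a) (A := b ^ 3) (r := b ^ 2)
    (by positivity) ha (by nlinarith)
  have e1 : 24 * (b ^ 3) ^ 2 / b ^ 2 = 24 * b ^ 4 := by field_simp
  have e2 : 192 * Real.pi * n * (b ^ 3) ^ 2 / b ^ 2 = 192 * Real.pi * n * b ^ 4 := by field_simp
  rw [e1, e2] at hout
  have hX : 0 ≤ 2 * n * b ^ 2 - c * b ^ 3 + C * b ^ 4 := by
    have h1 : c * b ^ 3 ≤ 1 * b ^ 2 := by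
      calc c * b ^ 3 = (b * c) * b ^ 2 := by ring
        _ ≤ 1 * b ^ 2 := by gcongr
    have h2 : 1 * b ^ 2 ≤ n * b ^ 2 := by gcongr
    have h3 : 0 ≤ C * b ^ 4 := by positivity
    nlinarith
  have hY : 0 ≤ 192 * Real.pi * n * b ^ 4 := by positivity
  set ρ := b ^ 2 - 24 * b ^ 4 with hρ
  have hρ0 : 0 ≤ ρ := by
    have : 24 * b ^ 2 ≤ 1 := by nlinarith
    have : b ^ 2 * (24 * b ^ 2) ≤ b ^ 2 * 1 := by gcongr
    rw [hρ]; linarith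
  have hρ1 : ρ ≤ 1 := by
    have : 0 < b ^ 4 := by positivity
    rw [hρ]; nlinarith
  have hL0 : lemniscateLength (extremalPoly n) < ⊤ :=
    lemniscateLength_lt_top (by rw [extremalPoly_natDegree]; omega)
  set D := Measure.hausdorffMeasure 1 (lemniscate (extremalPoly n) \ Metric.ball 0 ρ) with hD
  have hsplit0 : ENNReal.ofReal (2 * n * ρ) + D ≤ lemniscateLength (extremalPoly n) := by
    have := measure_inter_add_sdiff (μ := Measure.hausdorffMeasure 1) (lemniscate (extremalPoly n))
      (Metric.isOpen_ball (x := (0 : ℂ)) (ε := ρ)).measurableSet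
    unfold lemniscateLength
    rw [← this]
    gcongr
    exact le_hausdorffMeasure_extremal_inter_ball (by omega) hρ1
  have hDtop : D ≠ ⊤ := (lt_of_le_of_lt (le_add_self.trans hsplit0) hL0).ne
  have hsplit : lemniscateLength (perturbedPoly n a) ≤
      ENNReal.ofReal (2 * n * b ^ 2 - c * b ^ 3 + C * b ^ 4) +
        (D + ENNReal.ofReal (192 * Real.pi * n * b ^ 4)) := by
    have := measure_inter_add_sdiff (μ := Measure.hausdorffMeasure 1)
      (lemniscate (perturbedPoly n a))
      (Metric.isOpen_ball (x := (0 : ℂ)) (ε := b ^ 2)).measurableSet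
    unfold lemniscateLength
    rw [← this]
    exact add_le_add hin hout
  have h0 := ENNReal.toReal_mono hL0.ne hsplit0
  have h1 := ENNReal.toReal_mono (by finiteness) hsplit
  rw [ENNReal.toReal_add ENNReal.ofReal_ne_top hDtop, ENNReal.toReal_ofReal (by positivity)] at h0
  rw [ENNReal.toReal_add ENNReal.ofReal_ne_top (by finiteness),
    ENNReal.toReal_add hDtop ENNReal.ofReal_ne_top, ENNReal.toReal_ofReal hX,
    ENNReal.toReal_ofReal hY] at h1
  have h2 : 2 * (n : ℝ) * ρ = 2 * n * b ^ 2 - 48 * n * b ^ 4 := by rw [hρ]; ring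
  rw [h2] at h0
  nlinarith

theorem norm_le_coeffSize_pow {n k : ℕ} (a : ℕ → ℂ) (hk : k ∈ Finset.Icc 2 n) :
    ‖a k‖ ≤ coeffSize n a ^ k := by
  have hk0 : (k : ℝ) ≠ 0 := by
    have := (Finset.mem_Icc.1 hk).1
    exact_mod_cast (by omega : k ≠ 0)
  have h := Finset.le_sup (f := fun k : ℕ => ‖a k‖₊ ^ (1 / (k : ℝ))) hk
  have h1 := pow_le_pow_left₀ zero_le h k
  rw [← NNReal.rpow_natCast, ← NNReal.rpow_mul, one_div_mul_cancel hk0, NNReal.rpow_one] at h1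
  exact_mod_cast h1

theorem exists_norm_eq_coeffSize_pow {n : ℕ} (hn : 2 ≤ n) (a : ℕ → ℂ) :
    ∃ k ∈ Finset.Icc 2 n, ‖a k‖ = coeffSize n a ^ k := by
  obtain ⟨k, hk, h⟩ := Finset.exists_mem_eq_sup (Finset.Icc 2 n)
    (Finset.nonempty_Icc.2 hn) (fun k : ℕ => ‖a k‖₊ ^ (1 / (k : ℝ)))
  have hk0 : (k : ℝ) ≠ 0 := by
    have := (Finset.mem_Icc.1 hk).1
    exact_mod_cast (by omega : k ≠ 0)
  refine ⟨k, hk, ?_⟩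
  unfold coeffSize
  rw [h, ← NNReal.coe_pow, ← NNReal.rpow_natCast, ← NNReal.rpow_mul, one_div_mul_cancel hk0,
    NNReal.rpow_one, coe_nnnorm]

theorem coeffSize_lt {n : ℕ} {a : ℕ → ℂ} {ε : ℝ} (hε : 0 < ε)
    (h : ∀ k ∈ Finset.Icc 2 n, ‖a k‖ < ε ^ k) : coeffSize n a < ε := by
  lift ε to ℝ≥0 using hε.le
  unfold coeffSize
  rw [NNReal.coe_lt_coe, Finset.sup_lt_iff (by simpa using hε)]
  intro k hk
  have hk0 : (k : ℝ) ≠ 0 := by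
    have := (Finset.mem_Icc.1 hk).1
    exact_mod_cast (by omega : k ≠ 0)
  have h1 : ‖a k‖₊ < ε ^ k := by exact_mod_cast h k hk
  have hk1 : 0 < 1 / (k : ℝ) := by positivity
  have h2 := NNReal.rpow_lt_rpow h1 hk1
  rwa [← NNReal.rpow_natCast, ← NNReal.rpow_mul, mul_one_div_cancel hk0, NNReal.rpow_one] at h2

theorem perturbedPoly_eq_extremalPoly {n : ℕ} {a : ℕ → ℂ} (h : coeffSize n a = 0) :
    perturbedPoly n a = extremalPoly n := by
  unfold perturbedPoly
  rw [Finset.sum_eq_zero, add_zero]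
  intro k hk
  have h1 := norm_le_coeffSize_pow a hk
  have hk2 := (Finset.mem_Icc.1 hk).1
  rw [h, zero_pow (by omega)] at h1
  rw [norm_le_zero_iff.1 h1, Polynomial.C_0, zero_mul]

theorem rpow_thirds {A : ℝ} (hA : 0 < A) :
    ∃ b : ℝ, 0 < b ∧ A = b ^ 3 ∧ A ^ (2 / 3 : ℝ) = b ^ 2 ∧ A ^ (4 / 3 : ℝ) = b ^ 4 := by
  refine ⟨A ^ (1 / 3 : ℝ), Real.rpow_pos_of_pos hA _, ?_, ?_, ?_⟩ <;>
  rw [← Real.rpow_natCast, ← Real.rpow_mul hA.le] <;> norm_num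

/-- The quantitative estimate for normalized perturbations. -/
theorem exists_lemniscateLength_perturbedPoly_le {n : ℕ} (hn : 2 ≤ n) :
    ∃ c C ε : ℝ, 0 < c ∧ 0 < C ∧ 0 < ε ∧
      ∀ a : ℕ → ℂ, (a n).im = 0 → coeffSize n a < ε →
        lemniscateLength (perturbedPoly n a) < ⊤ ∧
        (∀ r : ℝ, 4 * coeffSize n a < r → r < 1 / 4 →
          (lemniscateLength (perturbedPoly n a)).toReal ≤
            (lemniscateLength (extremalPoly n)).toReal - c * coeffSize n a
              + C * (r ^ 2 + coeffSize n a ^ 2 / r)) ∧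
        (0 < coeffSize n a →
          4 * coeffSize n a < coeffSize n a ^ (2 / 3 : ℝ) ∧
          coeffSize n a ^ (2 / 3 : ℝ) < 1 / 4) ∧
        (lemniscateLength (perturbedPoly n a)).toReal ≤
          (lemniscateLength (extremalPoly n)).toReal - c * coeffSize n a
            + 2 * C * coeffSize n a ^ (4 / 3 : ℝ) ∧
        (lemniscateLength (extremalPoly n)).toReal - c * coeffSize n a
            + 2 * C * coeffSize n a ^ (4 / 3 : ℝ) ≤
          (lemniscateLength (extremalPoly n)).toReal := by
  obtain ⟨c, C, b₀, hc, hC, hb₀, H⟩ := lemniscateLength_perturbedPoly_le hn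
  -- `b < 1 / 4` makes `r = b ^ 2` admissible, and `2 C b ≤ c` lets the linear gain absorb the
  -- error.
  set β := min b₀ (min (1 / 4) (c / (2 * C))) with hβ
  have hβ0 : 0 < β := by positivity
  refine ⟨c, C, β ^ 3, hc, hC, by positivity, fun a him hε => ⟨?_, ?_⟩⟩
  · exact lemniscateLength_lt_top (by rw [perturbedPoly_natDegree hn]; omega)
  have hA0 : 0 ≤ coeffSize n a := NNReal.coe_nonneg _
  rcases hA0.eq_or_lt with h0 | hpos
  · rw [perturbedPoly_eq_extremalPoly h0.symm, ← h0,
      Real.zero_rpow (by norm_num : (4 / 3 : ℝ) ≠ 0)]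
    refine ⟨fun r _ _ => ?_, fun h => absurd h (lt_irrefl _), by simp, by simp⟩
    have : 0 ≤ C * r ^ 2 := by positivity
    simpa using this
  have hle := fun k (hk : k ∈ Finset.Icc 2 n) => norm_le_coeffSize_pow a hk
  have hex := exists_norm_eq_coeffSize_pow hn a
  obtain ⟨b, hb, e3, e2, e4⟩ := rpow_thirds hpos
  rw [e2, e4]
  rw [e3] at hle hex hε ⊢
  have hbβ : b < β := lt_of_pow_lt_pow_left₀ 3 hβ0.le hε
  have hb1 : b ≤ b₀ := hbβ.le.trans (min_le_left _ _)
  have hb4 : b < 1 / 4 := hbβ.trans_le ((min_le_right _ _).trans (min_le_left _ _))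
  have hbc : b * (2 * C) ≤ c := (le_div_iff₀ (by positivity)).1
    (hbβ.le.trans ((min_le_right _ _).trans (min_le_right _ _)))
  have hmain := H a b hb hb1 hle hex him
  have hb2 : 0 < b ^ 2 := by positivity
  have hC4 : 0 < C * b ^ 4 := by positivity
  refine ⟨fun r hr _ => ?_, fun _ => ⟨by nlinarith, by nlinarith⟩, by linarith, ?_⟩
  · have hr0 : 0 < r := lt_trans (by positivity) hr
    -- The choice `r = b ^ 2` is optimal up to a constant, so its estimate implies the one for every
    -- `r`.
    have hkey : b ^ 4 ≤ r ^ 2 + (b ^ 3) ^ 2 / r := by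
      rcases le_total (b ^ 2) r with h | h
      · have h1 : (b ^ 2) ^ 2 ≤ r ^ 2 := by gcongr
        have h2 : 0 ≤ (b ^ 3) ^ 2 / r := by positivity
        linarith [show (b ^ 2) ^ 2 = b ^ 4 by ring]
      · have h1 : b ^ 4 ≤ (b ^ 3) ^ 2 / r := by
          rw [le_div_iff₀ hr0]
          calc b ^ 4 * r ≤ b ^ 4 * b ^ 2 := by gcongr
            _ = (b ^ 3) ^ 2 := by ring
        have h2 : 0 ≤ r ^ 2 := by positivity
        linarith
    have := mul_le_mul_of_nonneg_left hkey hC.le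
    linarith
  · have h1 : b * (2 * C) * b ^ 3 ≤ c * b ^ 3 := by gcongr
    linarith [show b * (2 * C) * b ^ 3 = 2 * C * b ^ 4 by ring]

/-! ### Normalization and the main theorem -/

/-- Two polynomials conjugate under a rigid motion and a unimodular factor have lemniscates of
the same length. -/
theorem lemniscateLength_eq_of_norm_eval_eq {p q : Polynomial ℂ} {u s : ℂ} (hu : ‖u‖ = 1)
    (h : ∀ z, ‖p.eval z‖ = ‖q.eval (u * z + s)‖) : lemniscateLength p = lemniscateLength q := by
  have hu0 : u ≠ 0 := norm_ne_zero_iff.1 (by rw [hu]; exact one_ne_zero)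
  have hiso : Isometry fun z : ℂ => u * z + s := Isometry.of_dist_eq fun z w => by
    rw [dist_add_right, dist_eq_norm, ← mul_sub, norm_mul, hu, one_mul, dist_eq_norm]
  have hsurj : Function.Surjective fun z : ℂ => u * z + s := fun w =>
    ⟨(w - s) / u, by field_simp; ring⟩
  have hpre : lemniscate p = (fun z : ℂ => u * z + s) ⁻¹' lemniscate q := by
    ext z
    simp only [lemniscate, mem_ofPred_eq, mem_preimage, h z]
  unfold lemniscateLength
  rw [hpre, hiso.hausdorffMeasure_preimage (Or.inr hsurj), hsurj.range_eq, inter_univ]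

theorem extremalPoly_coeff {n k : ℕ} (hk0 : k ≠ 0) (hkn : k ≠ n) :
    (extremalPoly n).coeff k = 0 := by
  simp [extremalPoly, Polynomial.coeff_X_pow, Polynomial.coeff_one, hk0, hkn]

theorem extremalPoly_coeff_zero {n : ℕ} (hn : n ≠ 0) : (extremalPoly n).coeff 0 = -1 := by
  simp [extremalPoly, Polynomial.coeff_X_pow, hn.symm]

/-- A monic polynomial without `z ^ (n - 1)` term is, up to a rotation of the variable and a
unimodular factor, a perturbation with real last coefficient. -/
theorem exists_perturbedPoly_of_coeff_eq_zero {n : ℕ} (hn : 2 ≤ n) {q : Polynomial ℂ}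
    (hq : q.Monic) (hdeg : q.natDegree = n) (hq1 : q.coeff (n - 1) = 0) {η : ℝ}
    (hη : ∀ k < n, ‖q.coeff k - (extremalPoly n).coeff k‖ < η) :
    ∃ (a : ℕ → ℂ) (u : ℂ), ‖u‖ = 1 ∧ (a n).im = 0 ∧ (∀ k ∈ Finset.Icc 2 n, ‖a k‖ < η) ∧
      ∀ z, ‖(perturbedPoly n a).eval z‖ = ‖q.eval (u * z)‖ := by
  have hn0 : (n : ℂ) ≠ 0 := by exact_mod_cast (by omega : n ≠ 0)
  set w := -q.coeff 0 with hw
  -- The rotation turns the constant term of `q` into the negative real number `-‖w‖`, up to the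
  -- factor `u ^ n`.
  set u := Complex.exp ((w.arg / n : ℝ) * Complex.I) with hu
  have hu1 : ‖u‖ = 1 := Complex.norm_exp_ofReal_mul_I _
  have hu0 : u ≠ 0 := Complex.exp_ne_zero _
  have hun : (‖w‖ : ℂ) * u ^ n = w := by
    rw [hu, ← Complex.exp_nat_mul]
    conv_rhs => rw [← Complex.norm_mul_exp_arg_mul_I w]
    congr 2
    push_cast
    field_simp
  have hun' : u⁻¹ ^ n * q.coeff 0 = -(‖w‖ : ℂ) := by
    have h1 : q.coeff 0 = -((‖w‖ : ℂ) * u ^ n) := by rw [hun, hw, neg_neg]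
    rw [h1, inv_pow]
    field_simp
  -- The added `1` at `k = n` compensates the `-1` contained in `extremalPoly n`, so `a n = 1 - ‖w‖`
  -- is real.
  set a : ℕ → ℂ := fun k => u⁻¹ ^ k * q.coeff (n - k) + if k = n then 1 else 0 with ha
  have han : a n = ((1 - ‖w‖ : ℝ) : ℂ) := by
    simp only [ha, Nat.sub_self, if_true, hun']
    push_cast; ring
  refine ⟨a, u, hu1, by rw [han, Complex.ofReal_im], fun k hk => ?_, fun z => ?_⟩
  · have hk' := Finset.mem_Icc.1 hk
    rcases eq_or_ne k n with rfl | hkn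
    · rw [han, Complex.norm_real]
      refine lt_of_le_of_lt ?_ (hη 0 (by omega))
      rw [extremalPoly_coeff_zero (by omega), Real.norm_eq_abs]
      have h1 := abs_norm_sub_norm_le (1 : ℂ) w
      rw [norm_one] at h1
      rwa [sub_neg_eq_add, add_comm, ← sub_neg_eq_add]
    · have h1 := hη (n - k) (by omega)
      rw [extremalPoly_coeff (by omega) (by omega), sub_zero] at h1
      simpa [ha, hkn, norm_inv, hu1] using h1
  · have hqe : q.eval (u * z) = u ^ n * (perturbedPoly n a).eval z := by
      have hsum : ∑ k ∈ Finset.Icc 2 n, a k * z ^ (n - k) =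
          (∑ k ∈ Finset.Icc 2 n, u⁻¹ ^ k * q.coeff (n - k) * z ^ (n - k)) + 1 := by
        simp only [ha, add_mul, Finset.sum_add_distrib, ite_mul, one_mul, zero_mul]
        rw [Finset.sum_ite_eq' , if_pos (Finset.mem_Icc.2 ⟨hn, le_rfl⟩), Nat.sub_self, pow_zero]
      have hp : (perturbedPoly n a).eval z =
          z ^ n + ∑ k ∈ Finset.Icc 2 n, u⁻¹ ^ k * q.coeff (n - k) * z ^ (n - k) := by
        simp only [perturbedPoly, extremalPoly, Polynomial.eval_add, Polynomial.eval_sub,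
          Polynomial.eval_pow, Polynomial.eval_X, Polynomial.eval_one, Polynomial.eval_finsetSum,
          Polynomial.eval_mul, Polynomial.eval_C, hsum]
        ring
      rw [hp, Polynomial.eval_eq_sum_range, hdeg, ← Finset.sum_range_reflect, Nat.add_sub_cancel,
        Finset.range_eq_Ico, Finset.sum_eq_sum_Ico_succ_bot (by omega),
        Finset.sum_eq_sum_Ico_succ_bot (by omega)]
      have hlead : q.coeff n = 1 := by rw [← hdeg]; exact hq
      simp only [Nat.sub_zero, zero_add, hq1, zero_mul, hlead, one_mul, mul_add, Finset.mul_sum]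
      rw [mul_pow]
      congr 1
      refine Finset.sum_congr (by ext; simp) fun k hk => ?_
      have hkn : k ≤ n := (Finset.mem_Icc.1 hk).2
      have h1 : u ^ n = u ^ (n - k) * u ^ k := by rw [← pow_add, Nat.sub_add_cancel hkn]
      rw [h1, mul_pow, inv_pow]
      field_simp
    rw [hqe, norm_mul, norm_pow, hu1, one_pow, one_mul]

theorem taylor_coeff_eq_sum {p : Polynomial ℂ} {n : ℕ} (hp : p.natDegree ≤ n) (s : ℂ) (k : ℕ) :
    (Polynomial.taylor s p).coeff k =
      ∑ j ∈ Finset.range (n + 1), (j.choose k : ℂ) * p.coeff j * s ^ (j - k) := by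
  rw [Polynomial.taylor_coeff]
  conv_lhs => rw [p.as_sum_range' (n + 1) (by omega)]
  rw [map_sum, Polynomial.eval_finsetSum]
  refine Finset.sum_congr rfl fun j _ => ?_
  rw [Polynomial.hasseDeriv_monomial, Polynomial.eval_monomial]

theorem taylor_coeff_pred_eq_zero {p : Polynomial ℂ} {n : ℕ} (hn : n ≠ 0) (hp : p.Monic)
    (hdeg : p.natDegree = n) :
    (Polynomial.taylor (-(p.coeff (n - 1) / n)) p).coeff (n - 1) = 0 := by
  obtain ⟨m, rfl⟩ := Nat.exists_eq_succ_of_ne_zero hn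
  have hlead : p.coeff (m + 1) = 1 := by rw [← Nat.succ_eq_add_one, ← hdeg]; exact hp
  have hm : ((m : ℂ) + 1) ≠ 0 := by exact_mod_cast Nat.succ_ne_zero m
  rw [taylor_coeff_eq_sum hdeg.le, Finset.sum_range_succ, Finset.sum_range_succ,
    Finset.sum_eq_zero]
  · simp only [Nat.succ_eq_add_one, Nat.add_sub_cancel, Nat.choose_self, Nat.sub_self, pow_zero,
      hlead, Nat.choose_succ_self_right, Nat.add_sub_cancel_left, pow_one]
    push_cast
    field_simp
    ring
  · intro j hj
    rw [Nat.choose_eq_zero_of_lt (by simpa using hj)]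
    simp

/-- Removing the `z ^ (n - 1)` term by a shift keeps a polynomial close to `z ^ n - 1`. -/
theorem exists_taylor_coeff_close {n : ℕ} (hn : 2 ≤ n) {η : ℝ} (hη : 0 < η) :
    ∃ δ > 0, ∀ p : Polynomial ℂ, p.natDegree = n →
      (∀ k : ℕ, ‖p.coeff k - (extremalPoly n).coeff k‖ < δ) → ∀ k < n,
        ‖(Polynomial.taylor (-(p.coeff (n - 1) / n)) p).coeff k - (extremalPoly n).coeff k‖ < η := by
  -- The coefficients of the shifted polynomial, with the shift itself read off from the
  -- coefficients, are continuous functions of the coefficients; the vector of `extremalPoly n`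
  -- needs no shift because `n - 1 ≠ 0`.
  set G : (Fin (n + 1) → ℂ) → Fin n → ℂ := fun v k => ∑ j : Fin (n + 1),
    ((j : ℕ).choose k : ℂ) * v j * (-(v ⟨n - 1, by omega⟩ / n)) ^ ((j : ℕ) - k) with hG
  have hGc : Continuous G := by fun_prop
  have hGp : ∀ p : Polynomial ℂ, p.natDegree = n → ∀ k : Fin n,
      G (fun i => p.coeff i) k = (Polynomial.taylor (-(p.coeff (n - 1) / n)) p).coeff k := by
    intro p hp k
    rw [taylor_coeff_eq_sum hp.le, ← Fin.sum_univ_eq_sum_range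
      (fun j => (j.choose k : ℂ) * p.coeff j * (-(p.coeff (n - 1) / n)) ^ (j - (k : ℕ)))]
  obtain ⟨δ, hδ, h⟩ := Metric.continuous_iff.1 hGc (fun i => (extremalPoly n).coeff i) η hη
  refine ⟨δ, hδ, fun p hp hpδ k hk => ?_⟩
  have h1 := h (fun i => p.coeff i) ((dist_pi_lt_iff hδ).2 fun i => by
    rw [dist_eq_norm]; exact hpδ i)
  have h2 := (dist_pi_lt_iff hη).1 h1 ⟨k, hk⟩
  rwa [hGp p hp, hGp _ extremalPoly_natDegree, extremalPoly_coeff (by omega) (by omega), zero_div,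
    neg_zero, Polynomial.taylor_zero, dist_eq_norm] at h2

theorem mainTheorem1 (n : ℕ) (hn : 2 ≤ n) :
    -- `p₀` is a local maximizer of the length among all monic polynomials of degree `n`
    (lemniscateLength (extremalPoly n) < ⊤ ∧
      ∃ δ : ℝ, 0 < δ ∧ ∀ p : Polynomial ℂ, p.Monic → p.natDegree = n →
        (∀ k : ℕ, ‖p.coeff k - (extremalPoly n).coeff k‖ < δ) →
          lemniscateLength p ≤ lemniscateLength (extremalPoly n)) ∧
    -- the quantitative estimate for normalized polynomials, constants depending only on `n`
    (∃ c C ε : ℝ, 0 < c ∧ 0 < C ∧ 0 < ε ∧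
      ∀ a : ℕ → ℂ, (a n).im = 0 → coeffSize n a < ε →
        lemniscateLength (perturbedPoly n a) < ⊤ ∧
        (∀ r : ℝ, 4 * coeffSize n a < r → r < 1 / 4 →
          (lemniscateLength (perturbedPoly n a)).toReal ≤
            (lemniscateLength (extremalPoly n)).toReal - c * coeffSize n a
              + C * (r ^ 2 + coeffSize n a ^ 2 / r)) ∧
        -- the choice `r = a ^ (2 / 3)` is admissible and gives the local maximality
        (0 < coeffSize n a →
          4 * coeffSize n a < coeffSize n a ^ (2 / 3 : ℝ) ∧
          coeffSize n a ^ (2 / 3 : ℝ) < 1 / 4) ∧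
        (lemniscateLength (perturbedPoly n a)).toReal ≤
          (lemniscateLength (extremalPoly n)).toReal - c * coeffSize n a
            + 2 * C * coeffSize n a ^ (4 / 3 : ℝ) ∧
        (lemniscateLength (extremalPoly n)).toReal - c * coeffSize n a
            + 2 * C * coeffSize n a ^ (4 / 3 : ℝ) ≤
          (lemniscateLength (extremalPoly n)).toReal) := by
  have hL0 : lemniscateLength (extremalPoly n) < ⊤ :=
    lemniscateLength_lt_top (by rw [extremalPoly_natDegree]; omega)
  have hquant := exists_lemniscateLength_perturbedPoly_le hn
  refine ⟨⟨hL0, ?_⟩, hquant⟩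
  obtain ⟨c, C, ε, -, -, hε, H⟩ := hquant
  have hε' : 0 < min ε 1 := lt_min hε one_pos
  -- The power `n` and the cap at `1` give `‖a k‖ < min ε 1 ^ k` for every `k ≤ n` at once.
  obtain ⟨δ, hδ, hclose⟩ := exists_taylor_coeff_close hn (η := min ε 1 ^ n) (by positivity)
  refine ⟨δ, hδ, fun p hp hdeg hpδ => ?_⟩
  set s := -(p.coeff (n - 1) / n) with hs
  have hmonic : (Polynomial.taylor s p).Monic := by
    rw [Polynomial.Monic, Polynomial.leadingCoeff_taylor]; exact hp
  obtain ⟨a, u, hu, him, hsmall, heval⟩ := exists_perturbedPoly_of_coeff_eq_zero hn hmonic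
    (by rw [Polynomial.natDegree_taylor, hdeg]) (taylor_coeff_pred_eq_zero (by omega) hp hdeg)
    (hclose p hdeg hpδ)
  have hsize : coeffSize n a < ε := by
    refine (coeffSize_lt hε' fun k hk => (hsmall k hk).trans_le ?_).trans_le (min_le_left _ _)
    exact pow_le_pow_of_le_one hε'.le (min_le_right _ _) (Finset.mem_Icc.1 hk).2
  obtain ⟨htop, -, -, h1, h2⟩ := H a him hsize
  rw [← lemniscateLength_eq_of_norm_eval_eq (p := perturbedPoly n a) (q := p) hu fun z => by
    rw [heval z, Polynomial.taylor_eval]]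
  exact (ENNReal.toReal_le_toReal htop.ne hL0.ne).1 (h1.trans h2)
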